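/- **Setting.** Let $A_1,A_2,\dots$ be iid non-negative random variables with $\lim_{t\to\infty} P(A_1>tx)/P(A_1>t)=x^{-\alpha}$ for all $x>0$, where $\alpha>1$. Let $m=E A_1<c$, $K>0$, $\theta\in(0,1)$, $M>0$ and $\kappa=\frac{1-\theta}{c-m}K$. Write $\mathbb D_T$ for the real-valued càdlàg functions on $[0,T]$. *Reflection.* For $x\in\mathbb D_T$ let $\psi_0^{K}(x)=v\in\mathbb D_T$ be the regulated process of the Skorokhod problem on $[0,K]$: $v=x+l-u$ with $0\le v\le K$, where $l,u$ are non-negative, non-decreasing, right-continuous, with $\int_{[0,T]} v\,dl=0$ and $\int_{[0,T]}(K-v)\,du=0$ (the measures $dl,du$ charge $\{0\}$ with mass $l(0),u(0)$). *Queue.* Let $Q^{K}=\psi_0^{K}\big(t\mapsto\sum_{i\ge1}(A_i-c)1_{\{i\le t\}}\big)$ and $Q^{K,(n)}(t)=Q^{nK}(nt)/n$ for $t\in[0,M]$, $n\ge 1$. *Long intense period.* For $x\in\mathbb D_M$ let $L^{\eta}(x)=\sup\{t-s:\ 0\le s<t\le M,\ x(r)>\eta\ \text{for all } r\in(s,t)\}$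 (with $\sup\emptyset=0$), and let $L_n=L^{\theta K}(Q^{K,(n)})\in[0,M]$. *Limit measures.* Let $\nu_\alpha$ be the measure on $(0,\infty)$ with $\nu_\alpha(x,\infty)=x^{-\alpha}$ for $x>0$. For $z\in(0,\infty)^j$ and $0\le u_1<\dots<u_j\le M$ let $h_j^{m-c}(z,u)(t)=\sum_{i=1}^j z_i1_{\{u_i\le t\}}+(m-c)t$. Let $$\mu_L^{(j)}=(\nu_\alpha^j\times \mathrm{Leb}_j)\circ(h_j^{m-c})^{-1}\circ(\psi_0^K)^{-1}\circ(L^{\theta K})^{-1}\quad\text{on }[0,M]\setminus[0,(j-1)\kappa],$$ where $\mathrm{Leb}_j$ is Lebesgue measure on the ordered jump times in $[0,M]^j$. Let $\gamma_n^{(j)}=[\,n\,P(A_1>n)\,]^{-j}$. *LDP.* For a closed subset $C$ of a metric space $S$, random elements $X_n$ of $S$ satisfy $X_n\in\mathrm{LD}(\gamma_n,\mu,S\setminus C)$ if $\gamma_n>0$ for $n\ge1$, $\gamma_n\to\infty$, $\mu$ is a non-zero Borel measure on $S\setminus C$ that is finite on Borel sets at positive distance from $C$, and for all closed $F$ and open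 $G$ at positive distance from $C$ $$\limsup_n\gamma_nP(X_n\in F)\le\mu(F),\qquad \liminf_n\gamma_nP(X_n\in G)\ge\mu(G).$$ **Theorem.** The $L_n$ satisfy a sequence of heavy-tailed large deviation principles on $[0,M]\setminus[0,(j-1)\kappa]$: $$L_n\in \mathrm{LD}\big(\gamma_n^{(j)},\mu_L^{(j)},[0,M]\setminus[0,(j-1)\kappa]\big),\qquad 1\le j\le\lfloor M/\kappa\rfloor .$$ Here $[0,(j-1)\kappa]\subset[0,j\kappa]$ and $\gamma_n^{(j+1)}/\gamma_n^{(j)}\to\infty$ as $n\to\infty$ for $1\le j<\lfloor M/\kappa\rfloor$. Moreover, for $1\le j\le\lfloor M/\kappa\rfloor$, $\mu_L^{(j)}$ is concentrated on $((j-1)\kappa,j\kappa]$. -/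

import Mathlib

open MeasureTheory ProbabilityTheory Filter Topology Set
open scoped ENNReal

noncomputable section

/-! ### Convergence of measures on `S \ C` and heavy-tailed large deviation principles -/

/-- `A` is bounded away from `C`: the distance between points of `C` and points of `A` is bounded
below by a positive constant. -/
def BoundedAway {S : Type*} [MetricSpace S] (C A : Set S) : Prop :=
  ∃ ε : ℝ, 0 < ε ∧ ∀ x ∈ C, ∀ y ∈ A, ε ≤ dist x y

/-- The class `𝕄(S \ C)` of Borel measures on `S \ C` that are finite on Borel sets bounded away
from `C`. A measure on `S \ C` is represented by the measure on `S` extending it by zero on `C`. -/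
def IsMMeasure {S : Type*} [MetricSpace S] [MeasurableSpace S] (C : Set S) (μ : Measure S) :
    Prop :=
  μ C = 0 ∧ ∀ A : Set S, MeasurableSet A → BoundedAway C A → μ A < ∞

/-- Convergence `μₙ → μ` in `𝕄(S \ C)`: `limsup μₙ(F) ≤ μ(F)` for closed `F` and
`μ(G) ≤ liminf μₙ(G)` for open `G`, where `F` and `G` are bounded away from `C`. -/
def TendstoM {S : Type*} [MetricSpace S] [MeasurableSpace S] (C : Set S)
    (μs : ℕ → Measure S) (μ : Measure S) : Prop :=
  (∀ F : Set S, IsClosed F → BoundedAway C F → limsup (fun n => μs n F) atTop ≤ μ F) ∧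
  (∀ G : Set S, IsOpen G → BoundedAway C G → μ G ≤ liminf (fun n => μs n G) atTop)

/-- The random elements `X n`, `n ≥ 1`, satisfy the heavy-tailed large deviation principle
`LD(γₙ, μ, S \ C)`: the rate is positive and tends to infinity, the limit measure is a non-zero
element of `𝕄(S \ C)`, and `γₙ P(Xₙ ∈ ·) → μ` in `𝕄(S \ C)`. -/
structure IsLDP {Ω S : Type*} [MeasurableSpace Ω] [MetricSpace S] [MeasurableSpace S]
    (P : Measure Ω) (X : ℕ → Ω → S) (γ : ℕ → ℝ) (μ : Measure S) (C : Set S) : Prop where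
  isClosed : IsClosed C
  aemeasurable : ∀ n, 1 ≤ n → AEMeasurable (X n) P
  rate_pos : ∀ n, 1 ≤ n → 0 < γ n
  rate_tendsto : Tendsto γ atTop atTop
  isMMeasure : IsMMeasure C μ
  ne_zero : μ ≠ 0
  tendsto : TendstoM C (fun n => ENNReal.ofReal (γ n) • P.map (X n)) μ

/-- The random elements `X n` satisfy a (finite) sequence of heavy-tailed large deviation
principles with levels `j = 1, …, J`: the removed closed sets increase with the level, each rate
is of larger order than the preceding one, and a large deviation principle holds at each level. -/
structure IsLDPSequence {Ω S : Type*} [MeasurableSpace Ω] [MetricSpace S] [MeasurableSpace S]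
    (P : Measure Ω) (J : ℕ) (X : ℕ → Ω → S) (γ : ℕ → ℕ → ℝ) (μ : ℕ → Measure S)
    (C : ℕ → Set S) : Prop where
  subset : ∀ j, 1 ≤ j → j + 1 ≤ J → C j ⊆ C (j + 1)
  rate_ratio : ∀ j, 1 ≤ j → j + 1 ≤ J → Tendsto (fun n => γ (j + 1) n / γ j n) atTop atTop
  ldp : ∀ j, 1 ≤ j → j ≤ J → IsLDP P X (γ j) (μ j) (C j)

/-! ### Regular variation -/

/-- Regular variation at infinity with index `β`. -/
def RegularlyVarying (β : ℝ) (f : ℝ → ℝ) : Prop :=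
  ∀ x : ℝ, 0 < x → Tendsto (fun t => f (t * x) / f t) atTop (𝓝 (x ^ β))

/-- The measure `ν_α` on `(0, ∞)` with `ν_α (x, ∞) = x ^ (-α)` for `x > 0`, given by its
density (the limit measure of a non-negative regularly varying random variable; it puts no mass
on the negative half-line). -/
def nuMeasure (α : ℝ) : Measure ℝ :=
  (volume.restrict (Ioi 0)).withDensity fun x => ENNReal.ofReal (α * x ^ (-α - 1))

/-! ### Càdlàg functions -/

/-- The space `𝔻_T` of real-valued càdlàg functions on `[0, T]`. -/
structure CadlagFun (T : ℝ) where
  toFun : Icc (0 : ℝ) T → ℝ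
  right_continuous : ∀ t, ContinuousWithinAt toFun (Ici t) t
  left_limit : ∀ t, ∃ a, Tendsto toFun (𝓝[<] t) (𝓝 a)

instance (T : ℝ) : CoeFun (CadlagFun T) fun _ => Icc (0 : ℝ) T → ℝ := ⟨CadlagFun.toFun⟩

/-- The zero function. -/
def CadlagFun.zero (T : ℝ) : CadlagFun T where
  toFun := fun _ => 0
  right_continuous := fun _ => continuousWithinAt_const
  left_limit := fun _ => ⟨0, tendsto_const_nhds⟩

lemma step_right_continuous {T : ℝ} (z u : ℝ) (t : Icc (0 : ℝ) T) :
    ContinuousWithinAt (fun s : Icc (0 : ℝ) T => if u ≤ (s : ℝ) then z else 0) (Ici t) t := by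
  by_cases h : u ≤ (t : ℝ)
  · refine (continuousWithinAt_const (b := z)).congr (fun s hs => ?_) ?_
    · have hs' : (t : ℝ) ≤ (s : ℝ) := hs
      simp [h.trans hs']
    · simp [h]
  · refine (continuousAt_const (y := (0 : ℝ))).congr ?_ |>.continuousWithinAt
    have : ∀ᶠ s : Icc (0 : ℝ) T in 𝓝 t, (s : ℝ) < u :=
      continuous_subtype_val.continuousAt.eventually_lt continuousAt_const (not_le.mp h)
    filter_upwards [this] with s hs
    simp [not_le.mpr hs]

lemma step_left_limit {T : ℝ} (z u : ℝ) (t : Icc (0 : ℝ) T) :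
    ∃ a, Tendsto (fun s : Icc (0 : ℝ) T => if u ≤ (s : ℝ) then z else 0) (𝓝[<] t) (𝓝 a) := by
  by_cases h : u < (t : ℝ)
  · refine ⟨z, tendsto_const_nhds.congr' ?_⟩
    have : ∀ᶠ s : Icc (0 : ℝ) T in 𝓝 t, u < (s : ℝ) :=
      continuousAt_const.eventually_lt continuous_subtype_val.continuousAt h
    filter_upwards [nhdsWithin_le_nhds this] with s hs
    simp [hs.le]
  · refine ⟨0, tendsto_const_nhds.congr' ?_⟩
    filter_upwards [self_mem_nhdsWithin] with s hs
    have hs' : (s : ℝ) < (t : ℝ) := hs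
    have : ¬ u ≤ (s : ℝ) := by linarith [not_lt.mp h]
    simp [this]

/-- The càdlàg function `h_j^d(z, u)(t) = ∑ᵢ zᵢ 1{uᵢ ≤ t} + d t` on `[0, T]`. -/
def stepPath (T : ℝ) {j : ℕ} (d : ℝ) (z u : Fin j → ℝ) : CadlagFun T where
  toFun := fun t => (∑ i, if u i ≤ (t : ℝ) then z i else 0) + d * t
  right_continuous := fun t =>
    (tendsto_finsetSum _ fun i _ => step_right_continuous (z i) (u i) t).add
      (by fun_prop : Continuous fun s : Icc (0 : ℝ) T => d * (s : ℝ)).continuousWithinAt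
  left_limit := fun t => by
    choose a ha using fun i => step_left_limit (z i) (u i) t
    exact ⟨(∑ i, a i) + d * t, (tendsto_finsetSum _ fun i _ => ha i).add
      (by fun_prop : Continuous fun s : Icc (0 : ℝ) T => d * (s : ℝ)).continuousWithinAt⟩

/-- The time change `t ↦ nt` from `[0, M]` to `[0, nM]`. -/
def scaleTime {M : ℝ} (n : ℕ) (t : Icc (0 : ℝ) M) : Icc (0 : ℝ) (n * M) :=
  ⟨n * (t : ℝ), mul_nonneg n.cast_nonneg t.2.1, mul_le_mul_of_nonneg_left t.2.2 n.cast_nonneg⟩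

lemma continuous_scaleTime {M : ℝ} (n : ℕ) : Continuous (scaleTime n : Icc (0 : ℝ) M → _) :=
  Continuous.subtype_mk (by fun_prop) _

/-- The function `t ↦ x(nt) / n` on `[0, M]`, for `x` defined on `[0, nM]`, `n ≥ 1`. -/
def rescale {M : ℝ} (n : ℕ) (x : CadlagFun (n * M)) : CadlagFun M where
  toFun := fun t => x (scaleTime n t) / n
  right_continuous := fun t =>
    ((x.right_continuous (scaleTime n t)).comp (continuous_scaleTime n).continuousWithinAt
      (fun s hs => by
        have hs' : (t : ℝ) ≤ (s : ℝ) := hs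
        exact mul_le_mul_of_nonneg_left hs' n.cast_nonneg)).div_const _
  left_limit := fun t => by
    rcases Nat.eq_zero_or_pos n with rfl | hn
    · exact ⟨0, by simpa using tendsto_const_nhds⟩
    · obtain ⟨a, ha⟩ := x.left_limit (scaleTime n t)
      refine ⟨a / n, (ha.comp ?_).div_const _⟩
      refine tendsto_nhdsWithin_iff.mpr
        ⟨(continuous_scaleTime n).continuousAt.mono_left nhdsWithin_le_nhds, ?_⟩
      filter_upwards [self_mem_nhdsWithin] with s hs
      have hs' : (s : ℝ) < (t : ℝ) := hs
      exact mul_lt_mul_of_pos_left hs' (by exact_mod_cast hn)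

/-! ### The Skorokhod reflection map and the queueing process -/

/-- `(v, l, u)` solves the Skorokhod problem on `[0, K]` for `x`: `v` takes values in `[0, K]`,
`v = x + l - u`, `∫ v dl = 0` and `∫ (K - v) du = 0`, where the regulators `l` and `u` are
non-negative, non-decreasing and right-continuous. The regulators are extended by `0` to negative
times, so that the Stieltjes measures `dl` and `du` charge the point `0` with mass `l(0)`
and `u(0)`. -/
structure IsSkorokhodSolution {T : ℝ} (K : ℝ) (x v : CadlagFun T)
    (l u : StieltjesFunction ℝ) : Prop where
  mem_Icc : ∀ t, v t ∈ Icc 0 K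
  eq : ∀ t : Icc (0 : ℝ) T, v t = x t + l t - u t
  lower_zero : ∀ t < 0, l t = 0
  upper_zero : ∀ t < 0, u t = 0
  lower_compl : ∫⁻ t, ENNReal.ofReal (v t) ∂(l.measure.comap Subtype.val) = 0
  upper_compl : ∫⁻ t, ENNReal.ofReal (K - v t) ∂(u.measure.comap Subtype.val) = 0

open Classical in
/-- The reflection map `ψ₀^K`, sending `x` to the regulated process `v` of the Skorokhod problem
on `[0, K]`. -/
def reflect {T : ℝ} (K : ℝ) (x : CadlagFun T) : CadlagFun T :=
  if h : ∃ v : CadlagFun T, ∃ l u, IsSkorokhodSolution K x v l u then h.choose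
  else CadlagFun.zero T

/-- The net input `t ↦ ∑_{i ≥ 1} (Aᵢ - c) 1{i ≤ t}` on `[0, T]` (only the terms with `i ≤ T`
matter); the sequence `a` is indexed from `0`, so `a i` is the `(i + 1)`-st arrival. -/
def netInput (T c : ℝ) (a : ℕ → ℝ) : CadlagFun T :=
  stepPath T (j := ⌊T⌋₊) 0 (fun i => a i - c) (fun i => (i : ℝ) + 1)

/-- The queueing process with buffer `K` on `[0, T]`, service rate `c` and arrivals `a`. -/
def queue (T K c : ℝ) (a : ℕ → ℝ) : CadlagFun T :=
  reflect K (netInput T c a)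

/-- The scaled queueing process `t ↦ Q^{nK}(nt) / n` on `[0, M]`. -/
def scaledQueue (M K c : ℝ) (n : ℕ) (a : ℕ → ℝ) : CadlagFun M :=
  rescale n (queue (n * M) (n * K) c a)

/-! ### Long intense periods -/

/-- The lengths of the intervals `(s, t)` in `[0, M]` on which `x` exceeds `η`. -/
def intenseLengths {M : ℝ} (η : ℝ) (x : CadlagFun M) : Set ℝ :=
  {d | ∃ s t : ℝ, 0 ≤ s ∧ s < t ∧ t ≤ M ∧
    (∀ r : Icc (0 : ℝ) M, s < r → (r : ℝ) < t → η < x r) ∧ d = t - s}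

/-- The length `L^η(x)` of the longest period that `x` spends above `η`, an element of `[0, M]`
(it is `0` if there is no such period). -/
def intenseLength {M : ℝ} (hM : 0 ≤ M) (η : ℝ) (x : CadlagFun M) : Icc (0 : ℝ) M :=
  ⟨sSup (intenseLengths η x),
    Real.sSup_nonneg (by rintro _ ⟨s, t, -, hst, -, -, rfl⟩; linarith),
    Real.sSup_le (by rintro _ ⟨s, t, hs, -, ht, -, rfl⟩; linarith) hM⟩

/-! ### Rates and limit measures -/

/-- The rate `γₙ^{(j)} = (n P(Y > n))^{-j}`. -/
def ldpRate {Ω : Type*} [MeasurableSpace Ω] (P : Measure Ω) (Y : Ω → ℝ) (j n : ℕ) : ℝ :=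
  ((n * P.real {ω | (n : ℝ) < Y ω}) ^ j)⁻¹

/-- The set of strictly increasing jump times `0 ≤ u₁ < ⋯ < u_j ≤ M`. -/
def orderedTimes (M : ℝ) (j : ℕ) : Set (Fin j → ℝ) :=
  {u | (∀ i, u i ∈ Icc 0 M) ∧ StrictMono u}

/-- The closed subset `[0, r]` of the space `[0, M]`. -/
def initialSegment (M r : ℝ) : Set (Icc (0 : ℝ) M) := {y | (y : ℝ) ≤ r}

/-- The push-forward of `ν_α^j × Leb_j`, on jump sizes and ordered jump times in `[0, M]`, under
`h_j^d`, then the reflection map on `[0, K]`, then `L^η`; considered on `[0, M] \ C`. -/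
def limitMeasure {M : ℝ} (hM : 0 ≤ M) (α d K η : ℝ) (C : Set (Icc (0 : ℝ) M)) (j : ℕ) :
    Measure (Icc (0 : ℝ) M) :=
  (((Measure.pi fun _ : Fin j => nuMeasure α).prod (volume.restrict (orderedTimes M j))).map
    fun p => intenseLength hM η (reflect K (stepPath M d p.1 p.2))).restrict Cᶜ

end

/-! A run of length of order `n` above the level `η = θK` is produced by a few arrivals of order
`n`; all the others act through their mean. On the scale `n` the input therefore looks like a step
path with drift `m - c < 0`. A jump lifts the content at most to `K`, and the descent from `K` to
`η` takes time `(K - η) / (c - m) = κ`, so `j` jumps keep the content above `η` for at most `jκ`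
(`runLength_bufferLevel_le`). A run longer than `(j - 1)κ` thus needs at least `j` large arrivals.
The probability of this has order `(n P(A > n))^j`, and further large arrivals are negligible.

Three ingredients make this rigorous.

Pathwise: the reflection map is Lipschitz for the uniform norm (`IsSkorokhodSolution.abs_sub_le`),
hence single-valued, and for step paths with non-positive drift it is given by the recursion
`bufferLevel`. By `runLength_largeJumps`, once the truncated sums follow their mean, the run length
of the queue lies between those of the path of large jumps at the levels `η + e` and `η - e`.

Probability: after truncation at `nδ`, Chernoff's bound makes deviations of size `nε` of smaller
order than any prescribed power of `1 / n`, if `δ` is small (`exists_truncation_level`). The scaled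
law of a large arrival, divided by `P(A > n)`, converges to `nuMeasure α` away from zero
(`bigJumpLaw_pi_bounds`). Sums over arrival indices are Riemann sums over ordered times
(`limsup_lattice_sum_le`, `le_liminf_lattice_sum`).

Continuity: the run length is discontinuous where the content equals `η` immediately before a jump.
Such configurations are null, as the content before a jump is strictly decreasing in the time of
that jump while it is positive (`volume_not_jumpGap`); elsewhere the run length depends continuously
on the level (`runLength_le_of_jumpGap`). All comparisons are made through `hitSet`, whose tolerance
`e` absorbs the perturbations of level, sizes and times and tends to zero at the end. -/

noncomputable section

/-! ### Stability of the Skorokhod problem -/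

/-- A function on a compact interval that is right-continuous is Borel measurable. -/
lemma CadlagFun.measurable {T : ℝ} (x : CadlagFun T) : Measurable x.toFun := by
  -- The next point of the grid of mesh `1 / (n + 1)` to the right of `t`, capped at `T`. Composing
  -- with it gives a countably valued function, and right-continuity gives convergence.
  let p : ℕ → Icc (0 : ℝ) T → Icc (0 : ℝ) T := fun n t =>
    ⟨min T (((⌊(t : ℝ) * (n + 1)⌋ : ℝ) + 1) / (n + 1)), by
      have h0 : (0 : ℝ) ≤ (⌊(t : ℝ) * (n + 1)⌋ : ℝ) := by
        have : 0 ≤ ⌊(t : ℝ) * (n + 1)⌋ := Int.floor_nonneg.2 (mul_nonneg t.2.1 (by positivity))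
        exact_mod_cast this
      exact le_min (t.2.1.trans t.2.2) (by positivity), min_le_left _ _⟩
  have hp_ge : ∀ n t, t ≤ p n t := by
    intro n t
    refine le_min t.2.2 ?_
    rw [le_div_iff₀ (by positivity)]
    exact (Int.lt_floor_add_one _).le
  have hp_le : ∀ n t, (p n t : ℝ) ≤ t + 1 / (n + 1) := by
    intro n t
    refine (min_le_right _ _).trans ?_
    rw [div_le_iff₀ (by positivity), add_mul, one_div, inv_mul_cancel₀ (by positivity)]
    linarith [Int.floor_le ((t : ℝ) * (n + 1))]
  have hp_tendsto : ∀ t, Tendsto (fun n => p n t) atTop (𝓝[≥] t) := by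
    intro t
    refine tendsto_nhdsWithin_iff.2 ⟨?_, Eventually.of_forall fun n => hp_ge n t⟩
    rw [tendsto_subtype_rng]
    refine tendsto_of_tendsto_of_tendsto_of_le_of_le tendsto_const_nhds ?_
      (fun n => hp_ge n t) (fun n => hp_le n t)
    simpa using tendsto_const_nhds.add (tendsto_one_div_add_atTop_nhds_zero_nat (𝕜 := ℝ))
  refine measurable_of_tendsto_metrizable (f := fun n t => x (p n t)) (fun n => ?_)
    (tendsto_pi_nhds.2 fun t => (x.right_continuous t).tendsto.comp (hp_tendsto t))
  by_cases hT : 0 ≤ T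
  · have h1 : Measurable fun k : ℤ =>
        x (projIcc 0 T hT (((k : ℝ) + 1) / (n + 1))) := measurable_from_top
    have h2 : Measurable fun t : Icc (0 : ℝ) T => ⌊(t : ℝ) * (n + 1)⌋ :=
      Int.measurable_floor.comp (measurable_subtype_coe.mul_const _)
    convert h1.comp h2 using 2 with t
    refine congrArg _ (Subtype.ext ?_)
    simp only [projIcc, p]
    rw [max_eq_right]
    exact (p n t).2.1
  · have : IsEmpty (Icc (0 : ℝ) T) := ⟨fun t => hT (t.2.1.trans t.2.2)⟩
    exact measurable_of_empty _

/-- For an interval `S` the conclusion says that a regulator does not increase there. In this form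
the complementarity conditions are used in the comparison of two solutions. -/
lemma measure_pos_eq_zero_of_lintegral {T : ℝ} {g : Icc (0 : ℝ) T → ℝ} (hg : Measurable g)
    {μ : Measure ℝ} (h : ∫⁻ t, ENNReal.ofReal (g t) ∂(μ.comap Subtype.val) = 0)
    {S : Set ℝ} (hS : ∀ r ∈ S, ∃ hr : r ∈ Icc 0 T, 0 < g ⟨r, hr⟩) : μ S = 0 := by
  rw [lintegral_eq_zero_iff hg.ennreal_ofReal] at h
  have h1 : (μ.comap (Subtype.val : Icc (0 : ℝ) T → ℝ)) {t | 0 < g t} = 0 := by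
    refine measure_mono_null (fun t ht => ?_) h
    simpa using ht
  rw [Measure.comap_apply₀ _ _ Subtype.val_injective] at h1
  · refine measure_mono_null (fun r hr => ?_) h1
    obtain ⟨hr', hpos⟩ := hS r hr
    exact ⟨⟨r, hr'⟩, hpos, rfl⟩
  · exact fun s hs => (measurableSet_Icc.subtype_image hs).nullMeasurableSet
  · exact (measurableSet_lt measurable_const hg).nullMeasurableSet

/-- Let `D` be the difference of the net regulators, so that `v - v' = D + (x - x')`. While `D > ε`,
one has `v > v'`, hence `v > 0` and `v' < K`; then `l` and `u'` are constant, and `u`, `l'` only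
decrease `D`. So `D` cannot rise above `ε`. -/
lemma IsSkorokhodSolution.sub_le {T K ε : ℝ} {x v x' v' : CadlagFun T}
    {l u l' u' : StieltjesFunction ℝ} (h : IsSkorokhodSolution K x v l u)
    (h' : IsSkorokhodSolution K x' v' l' u') (hε : 0 ≤ ε)
    (hx : ∀ t, |x t - x' t| ≤ ε) (t : Icc (0 : ℝ) T) : v t - v' t ≤ 2 * ε := by
  set D : ℝ → ℝ := fun s => l s - u s - l' s + u' s with hD
  have hneg : ∀ s < 0, D s = 0 := fun s hs => by
    simp [hD, h.lower_zero s hs, h.upper_zero s hs, h'.lower_zero s hs, h'.upper_zero s hs]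
  have hvD : ∀ s : Icc (0 : ℝ) T, v s - v' s = D s + (x s - x' s) := fun s => by
    rw [h.eq, h'.eq]; simp only [hD]; ring
  have hDt : D t ≤ ε := by
    by_contra! hlt
    set S : Set ℝ := {s | s ≤ t ∧ D s ≤ ε} with hS
    -- The extension of the regulators by `0` to negative times supplies a starting point with `D ≤
    -- ε`, so a mass at time `0` needs no separate treatment.
    have hSne : (-1 : ℝ) ∈ S := ⟨by linarith [t.2.1], by rw [hneg _ (by norm_num)]; exact hε⟩
    have hSbdd : BddAbove S := ⟨t, fun s hs => hs.1⟩
    set σ := sSup S with hσ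
    have hσt : σ ≤ t := csSup_le ⟨_, hSne⟩ fun s hs => hs.1
    have hgt : ∀ s : ℝ, σ < s → s ≤ t → ε < D s := fun s hs hst => by
      by_contra! hc
      exact (le_csSup hSbdd (show s ∈ S from ⟨hst, hc⟩)).not_gt hs
    have hpos : ∀ s : ℝ, s ≤ t → ε < D s →
        ∃ hs : s ∈ Icc 0 T, 0 < v ⟨s, hs⟩ ∧ 0 < K - v' ⟨s, hs⟩ := fun s hst hs => by
      have hs0 : 0 ≤ s := by
        by_contra! hc
        rw [hneg s hc] at hs
        linarith
      refine ⟨⟨hs0, hst.trans t.2.2⟩, ?_⟩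
      set r : Icc (0 : ℝ) T := ⟨s, hs0, hst.trans t.2.2⟩
      have h1 := hvD r
      have h2 := abs_le.1 (hx r)
      have h3 := (h.mem_Icc r).2
      have h4 := (h'.mem_Icc r).1
      constructor <;> linarith
    have hl0 : ∀ R : Set ℝ, (∀ s ∈ R, s ≤ t ∧ ε < D s) → l.measure R = 0 := fun R hR =>
      measure_pos_eq_zero_of_lintegral v.measurable h.lower_compl fun s hs =>
        let ⟨h1, h2, _⟩ := hpos s (hR s hs).1 (hR s hs).2
        ⟨h1, h2⟩
    have hu0 : ∀ R : Set ℝ, (∀ s ∈ R, s ≤ t ∧ ε < D s) → u'.measure R = 0 := fun R hR =>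
      measure_pos_eq_zero_of_lintegral (measurable_const.sub v'.measurable) h'.upper_compl
        fun s hs =>
          let ⟨h1, _, h2⟩ := hpos s (hR s hs).1 (hR s hs).2
          ⟨h1, h2⟩
    by_cases hσS : D σ ≤ ε
    · have hR : ∀ s ∈ Ioc σ (t : ℝ), s ≤ t ∧ ε < D s := fun s hs => ⟨hs.2, hgt s hs.1 hs.2⟩
      have h1 := hl0 _ hR
      have h2 := hu0 _ hR
      rw [StieltjesFunction.measure_Ioc, ENNReal.ofReal_eq_zero] at h1 h2
      have h3 := u.mono hσt
      have h4 := l'.mono hσt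
      simp only [hD] at hlt hσS
      linarith
    · have hR : ∀ s ∈ Icc σ (t : ℝ), s ≤ t ∧ ε < D s := fun s hs => by
        refine ⟨hs.2, ?_⟩
        rcases hs.1.eq_or_lt with rfl | hlt'
        · exact not_le.1 hσS
        · exact hgt s hlt' hs.2
      have h1 := hl0 _ hR
      have h2 := hu0 _ hR
      rw [StieltjesFunction.measure_Icc, ENNReal.ofReal_eq_zero] at h1 h2
      -- Here `D` jumps over `ε` at `σ` itself, and `l`, `u'` do not charge the closed interval from
      -- `σ` to `t`. The comparison is made with a point of `S` shortly before `σ`, where `l` and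
      -- `u'` are within `e / 2` of their left limits.
      set e := (D t - ε) / 2 with he
      have hepos : 0 < e := by linarith
      have e1 : ∀ᶠ s in 𝓝[<] σ, Function.leftLim l σ - e / 2 < l s :=
        (l.mono.tendsto_leftLim σ).eventually (lt_mem_nhds (by linarith))
      have e2 : ∀ᶠ s in 𝓝[<] σ, Function.leftLim u' σ - e / 2 < u' s :=
        (u'.mono.tendsto_leftLim σ).eventually (lt_mem_nhds (by linarith))
      obtain ⟨a, haσ, ha⟩ := (mem_nhdsLT_iff_exists_Ioo_subset).1 (e1.and e2)
      obtain ⟨s, hsS, has⟩ := exists_lt_of_lt_csSup ⟨_, hSne⟩ haσ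
      have hsσ : s < σ := by
        refine (le_csSup hSbdd hsS).lt_of_ne ?_
        rintro rfl
        exact hσS hsS.2
      obtain ⟨h5, h6⟩ := ha ⟨has, hsσ⟩
      have h3 := u.mono (hsσ.le.trans hσt)
      have h4 := l'.mono (hsσ.le.trans hσt)
      have h7 := hsS.2
      simp only [hD] at hlt h7 he
      linarith
  have := hvD t
  have := abs_le.1 (hx t)
  linarith

/-- The regulated process depends in a Lipschitz way on the input. -/
lemma IsSkorokhodSolution.abs_sub_le {T K ε : ℝ} {x v x' v' : CadlagFun T}
    {l u l' u' : StieltjesFunction ℝ} (h : IsSkorokhodSolution K x v l u)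
    (h' : IsSkorokhodSolution K x' v' l' u') (hε : 0 ≤ ε)
    (hx : ∀ t, |x t - x' t| ≤ ε) (t : Icc (0 : ℝ) T) : |v t - v' t| ≤ 2 * ε := by
  rw [abs_le]
  have h1 := h.sub_le h' hε hx t
  have h2 := h'.sub_le h hε (fun s => by rw [abs_sub_comm]; exact hx s) t
  constructor <;> linarith

/-- The Lipschitz bound with `ε = 0` is uniqueness, so the choice made in `reflect` is immaterial.
-/
lemma IsSkorokhodSolution.reflect_eq {T K : ℝ} {x v : CadlagFun T}
    {l u : StieltjesFunction ℝ} (h : IsSkorokhodSolution K x v l u) (t : Icc (0 : ℝ) T) :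
    reflect K x t = v t := by
  have hex : ∃ v : CadlagFun T, ∃ l u, IsSkorokhodSolution K x v l u := ⟨v, l, u, h⟩
  rw [reflect, dif_pos hex]
  obtain ⟨l', u', h'⟩ := hex.choose_spec
  have := h'.abs_sub_le h le_rfl (by simp) t
  rw [mul_zero, abs_nonpos_iff, sub_eq_zero] at this
  exact this

/-- A finite measure on the line is the Stieltjes measure of its distribution function. -/
lemma exists_stieltjes_of_isFiniteMeasure (μ : Measure ℝ) [IsFiniteMeasure μ] :
    ∃ f : StieltjesFunction ℝ, (∀ t, f t = μ.real (Iic t)) ∧ f.measure = μ := by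
  have hmono : Monotone fun t => μ.real (Iic t) := fun a b hab =>
    measureReal_mono (Iic_subset_Iic.2 hab)
  have hcont : ∀ x, ContinuousWithinAt (fun t => μ.real (Iic t)) (Ici x) x := by
    intro x
    rw [← continuousWithinAt_Ioi_iff_Ici]
    have : Tendsto (fun t => μ (Iic t)) (𝓝[>] x) (𝓝 (μ (⋂ r > x, Iic r))) := by
      refine tendsto_measure_biInter_gt (fun r _ => measurableSet_Iic.nullMeasurableSet)
        (fun i j _ hij => Iic_subset_Iic.2 hij) ⟨x + 1, by simp, measure_ne_top _ _⟩
    have hI : (⋂ r > x, Iic r) = Iic x := by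
      ext y
      simp only [mem_iInter, mem_Iic]
      exact ⟨fun h => le_of_forall_gt_imp_ge_of_dense h, fun h r hr => h.trans (le_of_lt hr)⟩
    rw [hI] at this
    exact (ENNReal.tendsto_toReal (measure_ne_top _ _)).comp this
  let f : StieltjesFunction ℝ := ⟨fun t => μ.real (Iic t), hmono, hcont⟩
  refine ⟨f, fun t => rfl, ?_⟩
  refine Measure.ext_of_Ioc _ _ fun a b hab => ?_
  rw [StieltjesFunction.measure_Ioc]
  change ENNReal.ofReal (μ.real (Iic b) - μ.real (Iic a)) = _
  rw [← Iic_sdiff_Iic, ← measureReal_sdiff (Iic_subset_Iic.2 hab.le) measurableSet_Iic,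
    ofReal_measureReal]

end

noncomputable section

/-! ### The explicit solution for step functions with non-positive drift -/

/-- The buffer content at time `t` when the jumps `z i` occur at the increasing times `u i`, the
drift is `d ≤ 0` and the content is kept in `[0, K]`. -/
def bufferLevel (K d : ℝ) : (n : ℕ) → (Fin n → ℝ) → (Fin n → ℝ) → ℝ → ℝ
  | 0, _, _, _ => 0
  | n + 1, z, u, t =>
    if t < u (Fin.last n) then bufferLevel K d n (fun i => z i.castSucc) (fun i => u i.castSucc) t
    else max 0 (max 0 (min K (bufferLevel K d n (fun i => z i.castSucc) (fun i => u i.castSucc)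
      (u (Fin.last n)) + z (Fin.last n))) + d * (t - u (Fin.last n)))

/-! ### Flow property, regularity and regulators of the recursion -/

section bufferLevel

variable {K d : ℝ} {n : ℕ} {z u : Fin n → ℝ} {s t : ℝ}

lemma bufferLevel_succ_of_lt {z u : Fin (n + 1) → ℝ} (h : t < u (Fin.last n)) :
    bufferLevel K d (n + 1) z u t =
      bufferLevel K d n (fun i => z i.castSucc) (fun i => u i.castSucc) t := by
  rw [bufferLevel, if_pos h]

lemma bufferLevel_succ_of_le {z u : Fin (n + 1) → ℝ} (h : u (Fin.last n) ≤ t) :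
    bufferLevel K d (n + 1) z u t =
      max 0 (max 0 (min K (bufferLevel K d n (fun i => z i.castSucc) (fun i => u i.castSucc)
        (u (Fin.last n)) + z (Fin.last n))) + d * (t - u (Fin.last n))) := by
  rw [bufferLevel, if_neg h.not_gt]

lemma StrictMono.castSucc_comp {u : Fin (n + 1) → ℝ} (hu : StrictMono u) :
    StrictMono fun i : Fin n => u i.castSucc :=
  fun _ _ hij => hu (Fin.castSucc_lt_castSucc_iff.2 hij)

lemma bufferLevel_nonneg : 0 ≤ bufferLevel K d n z u t := by
  induction n with
  | zero => exact le_rfl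
  | succ n ih =>
    rcases lt_or_ge t (u (Fin.last n)) with h | h
    · rw [bufferLevel_succ_of_lt h]; exact ih
    · rw [bufferLevel_succ_of_le h]; exact le_max_left _ _

lemma bufferLevel_le (hK : 0 ≤ K) (hd : d ≤ 0) : bufferLevel K d n z u t ≤ K := by
  induction n with
  | zero => exact hK
  | succ n ih =>
    rcases lt_or_ge t (u (Fin.last n)) with h | h
    · rw [bufferLevel_succ_of_lt h]; exact ih
    · rw [bufferLevel_succ_of_le h]
      have := mul_nonpos_of_nonpos_of_nonneg hd (sub_nonneg.2 h)
      exact max_le hK (by linarith [max_le hK (min_le_left K (bufferLevel K d n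
        (fun i => z i.castSucc) (fun i => u i.castSucc) (u (Fin.last n)) + z (Fin.last n)))])

/-- Between jumps the content decreases at rate `-d` until it reaches zero. -/
lemma bufferLevel_flow (hd : d ≤ 0) (hu : ∀ i, u i ≤ s) (hst : s ≤ t) :
    bufferLevel K d n z u t = max 0 (bufferLevel K d n z u s + d * (t - s)) := by
  have h1 := mul_nonpos_of_nonpos_of_nonneg hd (sub_nonneg.2 hst)
  cases n with
  | zero => simp only [bufferLevel]; rw [max_eq_left]; linarith
  | succ n =>
    have h := hu (Fin.last n)
    rw [bufferLevel_succ_of_le h, bufferLevel_succ_of_le (h.trans hst)]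
    set W := max 0 (min K (bufferLevel K d n (fun i => z i.castSucc) (fun i => u i.castSucc)
      (u (Fin.last n)) + z (Fin.last n)))
    have h2 : d * (t - u (Fin.last n)) = d * (t - s) + d * (s - u (Fin.last n)) := by ring
    rcases le_total 0 (W + d * (s - u (Fin.last n))) with h3 | h3
    · rw [max_eq_right h3]; congr 1; linarith
    · rw [max_eq_left h3, max_eq_left, max_eq_left] <;> linarith

lemma bufferLevel_flow_right (hd : d ≤ 0) (r : ℝ) :
    ∃ b, r < b ∧ ∀ t ∈ Ico r b,
      bufferLevel K d n z u t = max 0 (bufferLevel K d n z u r + d * (t - r)) := by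
  induction n with
  | zero =>
    exact ⟨r + 1, by linarith, fun t ht => bufferLevel_flow hd (fun i => i.elim0) ht.1⟩
  | succ n ih =>
    rcases lt_or_ge r (u (Fin.last n)) with h | h
    · obtain ⟨b, hb, H⟩ := ih (z := fun i => z i.castSucc) (u := fun i => u i.castSucc)
      refine ⟨min b (u (Fin.last n)), lt_min hb h, fun t ht => ?_⟩
      rw [bufferLevel_succ_of_lt (ht.2.trans_le (min_le_right _ _)), bufferLevel_succ_of_lt h]
      exact H t ⟨ht.1, ht.2.trans_le (min_le_left _ _)⟩
    · refine ⟨r + 1, by linarith, fun t ht => ?_⟩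
      rw [bufferLevel_succ_of_le h, bufferLevel_succ_of_le (h.trans ht.1)]
      set W := max 0 (min K (bufferLevel K d n (fun i => z i.castSucc) (fun i => u i.castSucc)
        (u (Fin.last n)) + z (Fin.last n)))
      have h1 := mul_nonpos_of_nonpos_of_nonneg hd (sub_nonneg.2 ht.1)
      have h2 : d * (t - u (Fin.last n)) = d * (t - r) + d * (r - u (Fin.last n)) := by ring
      rcases le_total 0 (W + d * (r - u (Fin.last n))) with h3 | h3
      · rw [max_eq_right h3]; congr 1; linarith
      · rw [max_eq_left h3, max_eq_left, max_eq_left] <;> linarith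

lemma continuousWithinAt_bufferLevel (hd : d ≤ 0) (r : ℝ) :
    ContinuousWithinAt (bufferLevel K d n z u) (Ici r) r := by
  obtain ⟨b, hb, H⟩ := bufferLevel_flow_right (K := K) (z := z) (u := u) hd r
  have hc : ContinuousWithinAt (fun t => max 0 (bufferLevel K d n z u r + d * (t - r)))
      (Ici r) r := by fun_prop
  refine hc.congr_of_eventuallyEq ?_ (H r ⟨le_rfl, hb⟩)
  filter_upwards [Ico_mem_nhdsGE hb] with t ht using H t ht

lemma continuousAt_bufferLevel (hd : d ≤ 0) (hu : StrictMono u) (ht : ∀ i, u i < t) :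
    ContinuousAt (bufferLevel K d n z u) t := by
  obtain ⟨s, hst, hs⟩ : ∃ s < t, ∀ i, u i ≤ s := by
    cases n with
    | zero => exact ⟨t - 1, by linarith, fun i => i.elim0⟩
    | succ n => exact ⟨u (Fin.last n), ht _, fun i => hu.monotone (Fin.le_last i)⟩
  have hc : ContinuousAt (fun t => max 0 (bufferLevel K d n z u s + d * (t - s))) t := by fun_prop
  refine hc.congr ?_
  filter_upwards [lt_mem_nhds hst] with r hr using (bufferLevel_flow hd hs hr.le).symm

lemma exists_tendsto_bufferLevel (hd : d ≤ 0) (hu : StrictMono u) (t : ℝ) :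
    ∃ a, Tendsto (bufferLevel K d n z u) (𝓝[<] t) (𝓝 a) := by
  induction n with
  | zero => exact ⟨0, tendsto_const_nhds⟩
  | succ n ih =>
    rcases le_or_gt t (u (Fin.last n)) with h | h
    · obtain ⟨a, ha⟩ := ih (z := fun i => z i.castSucc) hu.castSucc_comp
      refine ⟨a, ha.congr' ?_⟩
      filter_upwards [self_mem_nhdsWithin] with r hr
      rw [bufferLevel_succ_of_lt (lt_of_lt_of_le hr h)]
    · refine ⟨_, (continuousAt_bufferLevel hd hu fun i => ?_).tendsto.mono_left
        nhdsWithin_le_nhds⟩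
      exact (hu.monotone (Fin.le_last i)).trans_lt h

lemma measurable_bufferLevel (K d : ℝ) (n : ℕ) :
    Measurable fun p : (Fin n → ℝ) × (Fin n → ℝ) × ℝ => bufferLevel K d n p.1 p.2.1 p.2.2 := by
  induction n with
  | zero => exact measurable_const
  | succ n ih =>
    simp only [bufferLevel]
    have h1 : Measurable fun p : (Fin (n + 1) → ℝ) × (Fin (n + 1) → ℝ) × ℝ =>
        p.2.1 (Fin.last n) := by fun_prop
    have h2 : Measurable fun p : (Fin (n + 1) → ℝ) × (Fin (n + 1) → ℝ) × ℝ =>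
        bufferLevel K d n (fun i => p.1 i.castSucc) (fun i => p.2.1 i.castSucc) p.2.2 :=
      ih.comp (g := fun p : (Fin n → ℝ) × (Fin n → ℝ) × ℝ => bufferLevel K d n p.1 p.2.1 p.2.2)
        (f := fun p : (Fin (n + 1) → ℝ) × (Fin (n + 1) → ℝ) × ℝ =>
          ((fun i => p.1 i.castSucc), (fun i => p.2.1 i.castSucc), p.2.2)) (by fun_prop)
    have h3 : Measurable fun p : (Fin (n + 1) → ℝ) × (Fin (n + 1) → ℝ) × ℝ =>
        bufferLevel K d n (fun i => p.1 i.castSucc) (fun i => p.2.1 i.castSucc)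
          (p.2.1 (Fin.last n)) :=
      ih.comp (g := fun p : (Fin n → ℝ) × (Fin n → ℝ) × ℝ => bufferLevel K d n p.1 p.2.1 p.2.2)
        (f := fun p : (Fin (n + 1) → ℝ) × (Fin (n + 1) → ℝ) × ℝ =>
          ((fun i => p.1 i.castSucc), (fun i => p.2.1 i.castSucc), p.2.1 (Fin.last n)))
          (by fun_prop)
    refine Measurable.ite (measurableSet_lt (by fun_prop) h1) h2 ?_
    fun_prop

/-- With `a = n` this carries the queue with buffer `nK` on `[0, nM]` to buffer `K` on `[0, M]`. The
drift is invariant because time and space are scaled alike. -/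
lemma bufferLevel_scale {a : ℝ} (ha : 0 < a) :
    bufferLevel (a * K) d n z u (a * t) / a =
      bufferLevel K d n (fun i => z i / a) (fun i => u i / a) t := by
  induction n generalizing t with
  | zero => simp [bufferLevel]
  | succ n ih =>
    have e : u (Fin.last n) = a * (u (Fin.last n) / a) := by field_simp
    rcases lt_or_ge t (u (Fin.last n) / a) with h | h
    · rw [bufferLevel_succ_of_lt (u := fun i => u i / a) h, bufferLevel_succ_of_lt, ih]
      rwa [lt_div_iff₀' ha] at h
    · rw [bufferLevel_succ_of_le (u := fun i => u i / a) h, bufferLevel_succ_of_le, ← ih, ← e]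
      · set w := bufferLevel (a * K) d n (fun i => z i.castSucc) (fun i => u i.castSucc)
          (u (Fin.last n))
        have hm : ∀ x y : ℝ, max x y / a = max (x / a) (y / a) := fun x y =>
          (monotone_div_right_of_nonneg ha.le).map_max
        have hm' : ∀ x y : ℝ, min x y / a = min (x / a) (y / a) := fun x y =>
          (monotone_div_right_of_nonneg ha.le).map_min
        rw [hm, add_div, hm, hm', add_div, zero_div, mul_div_cancel_left₀ K ha.ne']
        congr 2
        field_simp
      · rwa [div_le_iff₀' ha] at h

/-- The regulators of the explicit solution, as measures. -/
lemma exists_regulators (hK : 0 < K) (hd : d ≤ 0) (hu : StrictMono u) (hu0 : ∀ i, 0 ≤ u i)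
    (T : ℝ) :
    ∃ μ ν : Measure ℝ, IsFiniteMeasure μ ∧ IsFiniteMeasure ν ∧ μ (Iio 0) = 0 ∧ ν (Iio 0) = 0 ∧
      (∀ t, (∀ i, u i < t) → μ {t} = 0 ∧ ν {t} = 0) ∧
      μ {t | 0 < bufferLevel K d n z u t} = 0 ∧ ν {t | bufferLevel K d n z u t < K} = 0 ∧
      ∀ t, 0 ≤ t → t ≤ T → bufferLevel K d n z u t =
        (∑ i, if u i ≤ t then z i else 0) + d * t + μ.real (Iic t) - ν.real (Iic t) := by
  induction n with
  | zero =>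
    -- Without jumps the content stays at zero and the lower regulator compensates the drift.
    -- Restriction to `[0, T]` keeps the measure finite.
    refine ⟨ENNReal.ofReal (-d) • volume.restrict (Icc 0 T), 0,
      Measure.smul_finite _ ENNReal.ofReal_ne_top, inferInstance,
      ?_, by simp, fun t _ => ⟨?_, by simp⟩, by simp [bufferLevel], by simp, fun t h0 hT => ?_⟩
    · rw [Measure.smul_apply, Measure.restrict_apply measurableSet_Iio,
        show Iio (0 : ℝ) ∩ Icc 0 T = ∅ by ext; simp; intros; linarith]; simp
    · simp
    · rw [measureReal_def, Measure.smul_apply, Measure.restrict_apply measurableSet_Iic,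
        show Iic t ∩ Icc 0 T = Icc 0 t by
          ext r; simp only [mem_inter_iff, mem_Iic, mem_Icc]; constructor
          · rintro ⟨h1, h2, h3⟩; exact ⟨h2, h1⟩
          · rintro ⟨h1, h2⟩; exact ⟨h2, h1, h2.trans hT⟩]
      simp [bufferLevel, h0, hd]
  | succ n ih =>
    obtain ⟨μ, ν, hμ, hν, hμ0, hν0, hat, hμc, hνc, heq⟩ :=
      ih (z := fun i => z i.castSucc) hu.castSucc_comp fun i => hu0 _
    set τ := u (Fin.last n) with hτ
    have hτ0 : 0 ≤ τ := hu0 _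
    have hlt : ∀ i : Fin n, u i.castSucc < τ := fun i => hu (Fin.castSucc_lt_last i)
    set w := bufferLevel K d n (fun i => z i.castSucc) (fun i => u i.castSucc) τ with hw
    set W := max 0 (min K (w + z (Fin.last n))) with hW
    have hW0 : 0 ≤ W := le_max_left _ _
    set R : Set ℝ := {t | τ ≤ t ∧ t ≤ T ∧ W + d * (t - τ) ≤ 0} with hR
    have hRm : MeasurableSet R := by
      have h1 : Measurable fun t => W + d * (t - τ) := by fun_prop
      exact (measurableSet_le measurable_const measurable_id).inter
        ((measurableSet_le measurable_id measurable_const).inter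
        (measurableSet_le h1 measurable_const))
    have hRfin : volume R < ∞ := (measure_mono (show R ⊆ Icc τ T from
      fun t ht => ⟨ht.1, ht.2.1⟩)).trans_lt (by simp)
    have : IsFiniteMeasure (volume.restrict R) := ⟨by simpa using hRfin⟩
    have hlevel : ∀ t, τ ≤ t → bufferLevel K d (n + 1) z u t = max 0 (W + d * (t - τ)) :=
      fun t ht => bufferLevel_succ_of_le ht
    have hlevelτ : bufferLevel K d (n + 1) z u τ = W := by
      rw [hlevel τ le_rfl]; simpa using hW0
    have hnull : ∀ (ρ : Measure ℝ) (p : ℝ → Prop),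
        ρ {t | p (bufferLevel K d n (fun i => z i.castSucc) (fun i => u i.castSucc) t)} = 0 →
        ρ.restrict (Iio τ) {t | p (bufferLevel K d (n + 1) z u t)} = 0 := by
      intro ρ p h
      rw [Measure.restrict_apply' measurableSet_Iio]
      refine measure_mono_null (fun t ht => ?_) h
      have h1 := ht.1
      rw [mem_ofPred_eq, bufferLevel_succ_of_lt ht.2] at h1
      exact h1
    -- The old regulators are kept strictly before `τ`. At `τ` an atom removes the undershoot below
    -- `0` or the overflow above `K`. Afterwards the lower regulator grows at rate `-d` on `R`, the
    -- times at which the buffer has run empty.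
    refine ⟨μ.restrict (Iio τ) + ENNReal.ofReal (-(w + z (Fin.last n))) • Measure.dirac τ +
        ENNReal.ofReal (-d) • volume.restrict R,
      ν.restrict (Iio τ) + ENNReal.ofReal (w + z (Fin.last n) - K) • Measure.dirac τ, ?_, ?_, ?_,
      ?_, ?_, ?_, ?_, ?_⟩
    · have := Measure.smul_finite (Measure.dirac τ)
        (ENNReal.ofReal_ne_top (r := -(w + z (Fin.last n))))
      have := Measure.smul_finite (volume.restrict R) (ENNReal.ofReal_ne_top (r := -d))
      infer_instance
    · have := Measure.smul_finite (Measure.dirac τ)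
        (ENNReal.ofReal_ne_top (r := w + z (Fin.last n) - K))
      infer_instance
    · have h1 : μ.restrict (Iio τ) (Iio 0) = 0 :=
        le_antisymm ((Measure.restrict_apply_le _ _).trans hμ0.le) bot_le
      have h2 : Iio (0 : ℝ) ∩ R = ∅ := by
        ext t; simp only [hR, mem_inter_iff, mem_Iio, mem_ofPred_eq, mem_empty_iff_false, iff_false]
        rintro ⟨h, h', -⟩; linarith
      simp [h1, Measure.restrict_apply measurableSet_Iio, h2, hτ0]
    · have h1 : ν.restrict (Iio τ) (Iio 0) = 0 :=
        le_antisymm ((Measure.restrict_apply_le _ _).trans hν0.le) bot_le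
      simp [h1, hτ0]
    · intro t ht
      have htτ := ht (Fin.last n)
      have h1 : ({t} : Set ℝ) ∩ Iio τ = ∅ := by
        ext r; simp only [mem_inter_iff, mem_singleton_iff, mem_Iio, mem_empty_iff_false, iff_false]
        rintro ⟨rfl, h⟩; linarith
      have h2 : Measure.dirac τ {t} = 0 := by
        rw [Measure.dirac_apply' _ (measurableSet_singleton t)]
        simp [htτ.ne, hτ]
      simp [Measure.restrict_apply, h1, h2]
    · rw [Measure.add_apply, Measure.add_apply, hnull μ (0 < ·) hμc, Measure.smul_apply,
        Measure.smul_apply, Measure.restrict_apply' hRm]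
      have h2 : {t | 0 < bufferLevel K d (n + 1) z u t} ∩ R = ∅ := by
        ext t; simp only [hR, mem_inter_iff, mem_ofPred_eq, mem_empty_iff_false, iff_false]
        rintro ⟨h, h1, -, h3⟩
        rw [hlevel t h1, max_eq_left h3] at h
        exact h.false
      rw [h2, measure_empty, smul_zero, add_zero, zero_add, smul_eq_mul, mul_eq_zero,
        ENNReal.ofReal_eq_zero]
      by_cases h : 0 < W
      · left
        by_contra! hc
        rw [hW, max_eq_left ((min_le_right _ _).trans (by linarith))] at h
        exact h.false
      · right
        rw [Measure.dirac_apply']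
        · simpa [hlevelτ] using h
        · exact measurableSet_lt measurable_const ((measurable_bufferLevel K d (n + 1)).comp
            (measurable_const.prodMk (measurable_const.prodMk measurable_id)))
    · rw [Measure.add_apply, hnull ν (· < K) hνc, Measure.smul_apply]
      simp only [zero_add, smul_eq_mul, mul_eq_zero, ENNReal.ofReal_eq_zero]
      by_cases h : W < K
      · left
        by_contra! hc
        rw [hW, min_eq_left (by linarith), max_eq_right hK.le] at h
        exact h.false
      · right
        rw [Measure.dirac_apply']
        · simpa [hlevelτ] using h
        · exact measurableSet_lt ((measurable_bufferLevel K d (n + 1)).comp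
            (measurable_const.prodMk (measurable_const.prodMk measurable_id))) measurable_const
    · intro t h0 hT
      rw [Fin.sum_univ_castSucc, measureReal_def, measureReal_def]
      simp only [Measure.add_apply, Measure.smul_apply, Measure.restrict_apply measurableSet_Iic,
        smul_eq_mul]
      rcases lt_or_ge t τ with h | h
      · have h1 : Iic t ∩ Iio τ = Iic t := inter_eq_left.2 fun r hr => lt_of_le_of_lt hr h
        have h2 : Iic t ∩ R = ∅ := by
          ext r; simp only [hR, mem_inter_iff, mem_Iic, mem_ofPred_eq, mem_empty_iff_false,
            iff_false]
          rintro ⟨h3, h4, -⟩; linarith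
        rw [bufferLevel_succ_of_lt h, heq t h0 hT, h1, h2]
        simp [← hτ, h, measureReal_def]
      · have h1 : Iic t ∩ Iio τ = Iio τ := inter_eq_right.2 fun r hr => (le_of_lt hr).trans h
        -- This is the purpose of the no-atom clause in the induction: the old balance equation is
        -- evaluated at `τ` inclusive, but only the mass before `τ` is kept.
        have h2 : ∀ ρ : Measure ℝ, ρ {τ} = 0 → ρ (Iio τ) = ρ (Iic τ) := fun ρ hρ => by
          rw [← Iio_union_right, measure_union _ (measurableSet_singleton _), hρ, add_zero]
          simp
        have h3 := hat τ hlt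
        have h4 : ENNReal.ofReal (-d) * volume (Iic t ∩ R) =
            ENNReal.ofReal (-d * (t - τ) - W) := by
          rcases hd.eq_or_lt with rfl | hd'
          · simp [hW0]
          · have h5 : Iic t ∩ R = Icc (τ + W / (-d)) t := by
              ext r
              simp only [hR, mem_inter_iff, mem_Iic, mem_ofPred_eq, mem_Icc]
              have h6 : τ + W / (-d) ≤ r ↔ W + d * (r - τ) ≤ 0 := by
                rw [← le_sub_iff_add_le', div_le_iff₀ (by linarith)]
                constructor <;> intro <;> nlinarith
              rw [h6]
              constructor
              · rintro ⟨h7, h8, h9, h10⟩; exact ⟨h10, h7⟩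
              · rintro ⟨h7, h8⟩
                refine ⟨h8, ?_, h8.trans hT, h7⟩
                exact (le_add_of_nonneg_right (div_nonneg hW0 (by linarith))).trans (h6.2 h7)
            rw [h5, Real.volume_Icc, ← ENNReal.ofReal_mul (by linarith)]
            congr 1
            field_simp [hd'.ne]
            ring
        rw [hlevel t h, h1, h2 μ h3.1, h2 ν h3.2, h4]
        have h5 := heq τ hτ0 (h.trans hT)
        have h6 : ∀ i : Fin n, u i.castSucc ≤ t := fun i => (hlt i).le.trans h
        simp only [(hlt _).le, h6, if_true, ← hτ, h] at h5 ⊢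
        rw [← hw] at h5
        rw [ENNReal.toReal_add (by finiteness) (by finiteness), ENNReal.toReal_add (by finiteness)
          (by finiteness), ENNReal.toReal_add (by finiteness) (by finiteness)]
        simp only [Measure.dirac_apply' _ measurableSet_Iic, indicator, mem_Iic, h, if_true,
          ENNReal.toReal_ofReal', Pi.one_apply, mul_one]
        rw [measureReal_def, measureReal_def] at h5
        set a := (μ (Iic τ)).toReal
        set b := (ν (Iic τ)).toReal
        set S := ∑ i : Fin n, z i.castSucc
        have h7 : d * (t - τ) ≤ 0 := mul_nonpos_of_nonpos_of_nonneg hd (sub_nonneg.2 h)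
        have h8 : d * t = d * τ + d * (t - τ) := by ring
        rw [h8, neg_mul]
        generalize d * (t - τ) = q at *
        rcases le_total (w + z (Fin.last n)) 0 with c1 | c1
        · have e1 : W = 0 := by rw [hW, max_eq_left ((min_le_right _ _).trans c1)]
          rw [e1, max_eq_left (by linarith : (0 : ℝ) + q ≤ 0),
            max_eq_left (by linarith : 0 ≤ -(w + z (Fin.last n))),
            max_eq_left (by linarith : 0 ≤ -q - 0),
            max_eq_right (by linarith : w + z (Fin.last n) - K ≤ 0)]
          linarith
        · rw [max_eq_right (by linarith : -(w + z (Fin.last n)) ≤ 0)]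
          rcases le_total (w + z (Fin.last n)) K with c2 | c2
          · have e1 : W = w + z (Fin.last n) := by rw [hW, min_eq_right c2, max_eq_right c1]
            rw [max_eq_right (by linarith : w + z (Fin.last n) - K ≤ 0)]
            rcases le_total 0 (W + q) with c3 | c3
            · rw [max_eq_right c3, max_eq_right (by linarith : -q - W ≤ 0)]; linarith
            · rw [max_eq_left c3, max_eq_left (by linarith : 0 ≤ -q - W)]; linarith
          · have e1 : W = K := by rw [hW, min_eq_left c2, max_eq_right hK.le]
            rw [max_eq_left (by linarith : 0 ≤ w + z (Fin.last n) - K)]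
            rcases le_total 0 (W + q) with c3 | c3
            · rw [max_eq_right c3, max_eq_right (by linarith : -q - W ≤ 0)]; linarith
            · rw [max_eq_left c3, max_eq_left (by linarith : 0 ≤ -q - W)]; linarith

/-- The buffer content as a càdlàg function. -/
def bufferPath (T K d : ℝ) (hd : d ≤ 0) (z u : Fin n → ℝ) (hu : StrictMono u) : CadlagFun T where
  toFun := fun t => bufferLevel K d n z u t
  right_continuous := fun t =>
    (continuousWithinAt_bufferLevel hd (t : ℝ)).comp continuous_subtype_val.continuousWithinAt
      fun _ hs => hs
  left_limit := fun t => by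
    obtain ⟨a, ha⟩ := exists_tendsto_bufferLevel (K := K) (z := z) hd hu (t : ℝ)
    refine ⟨a, ha.comp (tendsto_nhdsWithin_iff.2
      ⟨continuous_subtype_val.continuousAt.mono_left nhdsWithin_le_nhds, ?_⟩)⟩
    filter_upwards [self_mem_nhdsWithin] with s hs using hs

lemma exists_isSkorokhodSolution_bufferPath (T : ℝ) (hK : 0 < K) (hd : d ≤ 0) (hu : StrictMono u)
    (hu0 : ∀ i, 0 ≤ u i) :
    ∃ l v, IsSkorokhodSolution K (stepPath T d z u) (bufferPath T K d hd z u hu) l v := by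
  obtain ⟨μ, ν, hμ, hν, hμ0, hν0, -, hμc, hνc, heq⟩ := exists_regulators (z := z) hK hd hu hu0 T
  obtain ⟨l, hl, rfl⟩ := exists_stieltjes_of_isFiniteMeasure μ
  obtain ⟨v, hv, rfl⟩ := exists_stieltjes_of_isFiniteMeasure ν
  have hneg : ∀ (ρ : Measure ℝ), ρ (Iio 0) = 0 → ∀ t < 0, ρ.real (Iic t) = 0 := by
    intro ρ hρ t ht
    rw [measureReal_def, measure_mono_null (Iic_subset_Iio.2 ht) hρ, ENNReal.toReal_zero]
  have hint : ∀ (ρ : Measure ℝ) (g : Icc (0 : ℝ) T → ℝ) (p : ℝ → Prop),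
      (∀ t : Icc (0 : ℝ) T, ¬ p t → g t ≤ 0) →
      ρ {t | p t} = 0 → ∫⁻ t, ENNReal.ofReal (g t) ∂(ρ.comap Subtype.val) = 0 := by
    intro ρ g p hg hp
    rw [lintegral_eq_zero_of_ae_eq_zero]
    have : ∀ᵐ t : Icc (0 : ℝ) T ∂(ρ.comap (Subtype.val : Icc (0 : ℝ) T → ℝ)), ¬ p t := by
      rw [ae_iff]
      simp only [not_not]
      rw [(MeasurableEmbedding.subtype_coe measurableSet_Icc).comap_apply]
      refine measure_mono_null ?_ hp
      rintro _ ⟨t, ht, rfl⟩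
      exact ht
    filter_upwards [this] with t ht
    simpa using hg t ht
  refine ⟨l, v, ?_, ?_, ?_, ?_, ?_, ?_⟩
  · exact fun t => ⟨bufferLevel_nonneg, bufferLevel_le hK.le hd⟩
  · intro t
    change bufferLevel K d n z u t = _
    rw [heq t t.2.1 t.2.2, ← hl, ← hv]
    rfl
  · exact fun t ht => by rw [hl, hneg _ hμ0 t ht]
  · exact fun t ht => by rw [hv, hneg _ hν0 t ht]
  · exact hint _ _ _ (fun t ht => not_lt.1 ht) hμc
  · exact hint _ _ _ (fun t ht => sub_nonpos.2 (not_lt.1 ht)) hνc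

/-- Both processes to be compared are covered: the queue, with drift `0` and jumps `a i - c`, and
the limit paths, with drift `m - c`. -/
lemma reflect_stepPath {T : ℝ} (hK : 0 < K) (hd : d ≤ 0) (hu : StrictMono u)
    (hu0 : ∀ i, 0 ≤ u i) (t : Icc (0 : ℝ) T) :
    reflect K (stepPath T d z u) t = bufferLevel K d n z u t := by
  obtain ⟨l, v, h⟩ := exists_isSkorokhodSolution_bufferPath (z := z) T hK hd hu hu0
  exact h.reflect_eq t

/-- The buffer content is Lipschitz in the net input, for the uniform norm. -/
lemma abs_bufferLevel_sub_le {m : ℕ} {d' : ℝ} {z' u' : Fin m → ℝ} {T ε : ℝ} (hK : 0 < K)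
    (hd : d ≤ 0) (hd' : d' ≤ 0) (hu : StrictMono u) (hu0 : ∀ i, 0 ≤ u i) (hu' : StrictMono u')
    (hu0' : ∀ i, 0 ≤ u' i) (hε : 0 ≤ ε)
    (h : ∀ t, 0 ≤ t → t ≤ T → |((∑ i, if u i ≤ t then z i else 0) + d * t) -
      ((∑ i, if u' i ≤ t then z' i else 0) + d' * t)| ≤ ε) (ht0 : 0 ≤ t) (htT : t ≤ T) :
    |bufferLevel K d n z u t - bufferLevel K d' m z' u' t| ≤ 2 * ε := by
  obtain ⟨l, v, H⟩ := exists_isSkorokhodSolution_bufferPath (z := z) T hK hd hu hu0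
  obtain ⟨l', v', H'⟩ := exists_isSkorokhodSolution_bufferPath (z := z') T hK hd' hu' hu0'
  exact H.abs_sub_le H' hε (fun s => h s s.2.1 s.2.2) ⟨t, ht0, htT⟩

end bufferLevel

end

noncomputable section

/-! ### The longest run above a level -/

/-- The lengths of the intervals in `[0, M]` on which `v` exceeds `η`. -/
def runSet (M η : ℝ) (v : ℝ → ℝ) : Set ℝ :=
  {d | ∃ s t : ℝ, 0 ≤ s ∧ s < t ∧ t ≤ M ∧ (∀ r, s < r → r < t → η < v r) ∧ d = t - s}

/-- The length of the longest run of `v` above `η` in `[0, M]`. -/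
def runLength (M η : ℝ) (v : ℝ → ℝ) : ℝ := sSup (runSet M η v)

section runLength

variable {M η η' : ℝ} {v v' : ℝ → ℝ}

lemma intenseLength_eq_runLength (hM : 0 ≤ M) {x : CadlagFun M} (h : ∀ t, x t = v t) :
    (intenseLength hM η x : ℝ) = runLength M η v := by
  have : intenseLengths η x = runSet M η v := by
    ext d
    constructor
    · rintro ⟨s, t, h0, hst, htM, hr, rfl⟩
      refine ⟨s, t, h0, hst, htM, fun r h1 h2 => ?_, rfl⟩
      have := hr ⟨r, h0.trans h1.le, h2.le.trans htM⟩ h1 h2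
      rwa [h] at this
    · rintro ⟨s, t, h0, hst, htM, hr, rfl⟩
      exact ⟨s, t, h0, hst, htM, fun r h1 h2 => by rw [h]; exact hr r h1 h2, rfl⟩
  simp only [intenseLength, runLength, this]

lemma bddAbove_runSet : BddAbove (runSet M η v) :=
  ⟨M, by rintro _ ⟨s, t, hs, -, ht, -, rfl⟩; linarith⟩

lemma runLength_nonneg : 0 ≤ runLength M η v :=
  Real.sSup_nonneg (by rintro _ ⟨s, t, -, hst, -, -, rfl⟩; linarith)

lemma runLength_le {b : ℝ} (hb : 0 ≤ b) (h : ∀ s t, 0 ≤ s → s < t → t ≤ M →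
    (∀ r, s < r → r < t → η < v r) → t - s ≤ b) : runLength M η v ≤ b :=
  Real.sSup_le (by rintro _ ⟨s, t, hs, hst, ht, hr, rfl⟩; exact h s t hs hst ht hr) hb

lemma runLength_le_self (hM : 0 ≤ M) : runLength M η v ≤ M :=
  runLength_le hM fun s t hs _ ht _ => by linarith

lemma sub_le_runLength {s t : ℝ} (hs : 0 ≤ s) (ht : t ≤ M)
    (h : ∀ r, s < r → r < t → η < v r) : t - s ≤ runLength M η v := by
  rcases lt_or_ge s t with hst | hst
  · exact le_csSup bddAbove_runSet ⟨s, t, hs, hst, ht, h, rfl⟩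
  · linarith [runLength_nonneg (M := M) (η := η) (v := v)]

lemma lt_runLength_iff {y : ℝ} (hy : 0 ≤ y) : y < runLength M η v ↔
    ∃ s t : ℝ, 0 ≤ s ∧ t ≤ M ∧ (∀ r, s < r → r < t → η < v r) ∧ y < t - s := by
  constructor
  · intro h
    rcases (runSet M η v).eq_empty_or_nonempty with he | hne
    · rw [runLength, he, Real.sSup_empty] at h
      linarith
    · obtain ⟨_, ⟨s, t, h0, hst, htM, hr, rfl⟩, hlt⟩ := exists_lt_of_lt_csSup hne h
      exact ⟨s, t, h0, htM, hr, hlt⟩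
  · rintro ⟨s, t, h0, htM, hr, hlt⟩
    exact hlt.trans_le (sub_le_runLength h0 htM hr)

/-- Every run of `v`, shortened by `ρ` at both ends, lies in a run of `v'`. This is the form in
which perturbations of levels and of jump times are compared. -/
lemma runLength_le_add {ρ : ℝ} (hρ : 0 ≤ ρ)
    (h : ∀ s t, 0 ≤ s → s < t → t ≤ M → (∀ r, s < r → r < t → η < v r) →
      ∀ r, s + ρ < r → r < t - ρ → η' < v' r) :
    runLength M η v ≤ runLength M η' v' + 2 * ρ := by
  refine runLength_le (add_nonneg runLength_nonneg (by linarith)) fun s t hs hst ht hr => ?_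
  have := sub_le_runLength (η := η') (v := v') (s := s + ρ) (t := t - ρ) (by linarith)
    (by linarith : t - ρ ≤ M) (h s t hs hst ht hr)
  linarith

lemma runLength_mono (h : ∀ r, 0 ≤ r → r ≤ M → η < v r → η' < v' r) :
    runLength M η v ≤ runLength M η' v' := by
  have := runLength_le_add (M := M) (η := η) (η' := η') (v := v) (v' := v') (le_refl 0)
    fun s t hs hst ht hr r h1 h2 => h r (by linarith) (by linarith)
      (hr r (by linarith) (by linarith))
  linarith

lemma runLength_anti (h : η ≤ η') : runLength M η' v ≤ runLength M η v :=
  runLength_mono fun _ _ _ h' => h.trans_lt h'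

end runLength

/-! ### Runs of the buffer content -/

section bufferRun

variable {K d η ε M : ℝ} {n : ℕ} {z u : Fin n → ℝ} {s t : ℝ}

/-- By the flow property a jump of size zero leaves no trace. Hence the bound on runs can count
non-zero jumps only, which is needed when a small jump is replaced by zero. -/
lemma bufferLevel_succ_of_eq_zero (hK : 0 < K) (hd : d ≤ 0) {z u : Fin (n + 1) → ℝ}
    (hu : StrictMono u) (hz : z (Fin.last n) = 0) (t : ℝ) :
    bufferLevel K d (n + 1) z u t =
      bufferLevel K d n (fun i => z i.castSucc) (fun i => u i.castSucc) t := by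
  rcases lt_or_ge t (u (Fin.last n)) with h | h
  · rw [bufferLevel_succ_of_lt h]
  · rw [bufferLevel_succ_of_le h, bufferLevel_flow hd
      (fun i => (hu (Fin.castSucc_lt_last i)).le) h, hz, add_zero,
      min_eq_right (bufferLevel_le hK.le hd), max_eq_right bufferLevel_nonneg]

/-- The number of non-zero jumps, as a real number. -/
def jumpCount (z : Fin n → ℝ) : ℝ := ∑ i, if z i = 0 then 0 else 1

lemma jumpCount_nonneg : 0 ≤ jumpCount z :=
  Finset.sum_nonneg fun i _ => by split_ifs <;> norm_num

/-- The content generated by the earlier jumps is continuous at the last jump time, so bounds on the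
path shortly before that time pass to the level from which the jump starts. -/
lemma bufferLevel_last_ge {z u : Fin (n + 1) → ℝ} (hd : d ≤ 0) (hu : StrictMono u)
    (hs : s < u (Fin.last n))
    (h : ∀ r, s < r → r < u (Fin.last n) → η ≤ bufferLevel K d (n + 1) z u r) :
    η ≤ bufferLevel K d n (fun i => z i.castSucc) (fun i => u i.castSucc) (u (Fin.last n)) := by
  have hc := continuousAt_bufferLevel (K := K) (z := fun i => z i.castSucc) hd hu.castSucc_comp
    fun i => hu (Fin.castSucc_lt_last i)
  refine ge_of_tendsto (hc.tendsto.mono_left nhdsWithin_le_nhds :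
    Tendsto _ (𝓝[<] (u (Fin.last n))) _) ?_
  filter_upwards [Ioo_mem_nhdsLT hs] with r hr
  rw [← bufferLevel_succ_of_lt hr.2]
  exact h r hr.1 hr.2

lemma bufferLevel_last_le {z u : Fin (n + 1) → ℝ} (hd : d ≤ 0) (hu : StrictMono u)
    (hs : s < u (Fin.last n))
    (h : ∀ r, s < r → r < u (Fin.last n) → bufferLevel K d (n + 1) z u r ≤ η) :
    bufferLevel K d n (fun i => z i.castSucc) (fun i => u i.castSucc) (u (Fin.last n)) ≤ η := by
  have hc := continuousAt_bufferLevel (K := K) (z := fun i => z i.castSucc) hd hu.castSucc_comp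
    fun i => hu (Fin.castSucc_lt_last i)
  refine le_of_tendsto (hc.tendsto.mono_left nhdsWithin_le_nhds :
    Tendsto _ (𝓝[<] (u (Fin.last n))) _) ?_
  filter_upwards [Ioo_mem_nhdsLT hs] with r hr
  rw [← bufferLevel_succ_of_lt hr.2]
  exact h r hr.1 hr.2

/-- Each jump prolongs a run above `η` by at most the time to go down from `K` to `η`. -/
lemma bufferLevel_run_le (hK : 0 < K) (hd : d < 0) (hη : 0 < η) (hηK : η ≤ K) (hu : StrictMono u)
    (hst : s < t) (h : ∀ r, s < r → r ≤ t → η ≤ bufferLevel K d n z u r) :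
    -d * (t - s) + (bufferLevel K d n z u t - η) ≤ jumpCount z * (K - η) := by
  -- Within a run above `η > 0` the left side is constant between jumps, since the height lost is
  -- `-d` times the time elapsed. A jump starts at a height at least `η` and ends at most at `K`, so
  -- it adds at most `K - η`.
  induction n generalizing t with
  | zero => exact absurd (h t hst le_rfl) (not_le.2 (by simpa [bufferLevel] using hη))
  | succ n ih =>
    have hcount : jumpCount z = jumpCount (fun i : Fin n => z i.castSucc) +
        if z (Fin.last n) = 0 then 0 else 1 := by
      rw [jumpCount, Fin.sum_univ_castSucc]; rfl
    by_cases hz : z (Fin.last n) = 0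
    · simp only [bufferLevel_succ_of_eq_zero hK hd.le hu hz] at h ⊢
      rw [hcount, if_pos hz, add_zero]
      exact ih hu.castSucc_comp hst h
    rw [hcount, if_neg hz, add_mul, one_mul]
    have hc0 := mul_nonneg (jumpCount_nonneg (z := fun i : Fin n => z i.castSucc))
      (sub_nonneg.2 hηK)
    rcases lt_or_ge t (u (Fin.last n)) with htτ | htτ
    · have := ih (z := fun i => z i.castSucc) hu.castSucc_comp hst fun r h1 h2 => by
        rw [← bufferLevel_succ_of_lt (h2.trans_lt htτ)]; exact h r h1 h2
      rw [bufferLevel_succ_of_lt htτ]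
      linarith
    · have ht := h t hst le_rfl
      rw [bufferLevel_succ_of_le htτ] at ht ⊢
      set W := max 0 (min K (bufferLevel K d n (fun i => z i.castSucc) (fun i => u i.castSucc)
        (u (Fin.last n)) + z (Fin.last n))) with hW
      have hWK : W ≤ K := max_le hK.le (min_le_left _ _)
      have hpos : 0 ≤ W + d * (t - u (Fin.last n)) := by
        by_contra! hc
        rw [max_eq_left hc.le] at ht
        linarith
      rw [max_eq_right hpos]
      rcases lt_or_ge s (u (Fin.last n)) with hsτ | hsτ
      · have h1 := bufferLevel_last_ge hd.le hu hsτ fun r h1 h2 => h r h1 (h2.le.trans htτ)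
        have h2 := ih (z := fun i => z i.castSucc) hu.castSucc_comp hsτ fun r h2 h3 => by
          rcases h3.eq_or_lt with rfl | h3
          · exact h1
          · rw [← bufferLevel_succ_of_lt h3]; exact h r h2 (h3.le.trans htτ)
        nlinarith
      · nlinarith

lemma runLength_bufferLevel_le (hK : 0 < K) (hd : d < 0) (hη : 0 < η) (hηK : η ≤ K)
    (hu : StrictMono u) :
    runLength M η (bufferLevel K d n z u) ≤ jumpCount z * (K - η) / (-d) := by
  have h0 : 0 ≤ jumpCount z * (K - η) / (-d) :=
    div_nonneg (mul_nonneg jumpCount_nonneg (sub_nonneg.2 hηK)) (by linarith)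
  refine runLength_le h0 fun s t hs hst ht hr => ?_
  have : ∀ r, s < r → r < t → r ≤ s + jumpCount z * (K - η) / (-d) := fun r h1 h2 => by
    have h3 := bufferLevel_run_le (z := z) hK hd hη hηK hu h1 fun q h4 h5 =>
      (hr q h4 (h5.trans_lt h2)).le
    have h4 := hr r h1 h2
    rw [← sub_le_iff_le_add', le_div_iff₀ (by linarith)]
    linarith
  have h1 : t ≤ s + jumpCount z * (K - η) / (-d) := by
    by_contra! hc
    obtain ⟨r, hr1, hr2⟩ := exists_between (max_lt hst hc)
    linarith [this r ((le_max_left _ _).trans_lt hr1) hr2,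
      le_max_right s (s + jumpCount z * (K - η) / (-d))]
  linarith

/-- Immediately before each jump the distance of the content to the level `η` exceeds `ε`. -/
def JumpGap (K d η ε : ℝ) : (n : ℕ) → (Fin n → ℝ) → (Fin n → ℝ) → Prop
  | 0, _, _ => True
  | n + 1, z, u => JumpGap K d η ε n (fun i => z i.castSucc) (fun i => u i.castSucc) ∧
      ε < |bufferLevel K d n (fun i => z i.castSucc) (fun i => u i.castSucc) (u (Fin.last n)) - η|

lemma JumpGap.mono {ε' : ℝ} (h : JumpGap K d η ε n z u) (hε : ε' ≤ ε) :
    JumpGap K d η ε' n z u := by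
  induction n with
  | zero => trivial
  | succ n ih => exact ⟨ih h.1, hε.trans_lt h.2⟩

lemma exists_jumpGap (h : JumpGap K d η 0 n z u) : ∃ ε, 0 < ε ∧ JumpGap K d η ε n z u := by
  induction n with
  | zero => exact ⟨1, one_pos, trivial⟩
  | succ n ih =>
    obtain ⟨ε, hε, H⟩ := ih h.1
    obtain ⟨ε', h1, h2⟩ := exists_between h.2
    exact ⟨min ε ε', lt_min hε h1, H.mono (min_le_left _ _), (min_le_right _ _).trans_lt h2⟩

/-- Once the content is at most `η + ε`, no jump can occur while it stays above `η - ε`: immediately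
before such a jump the content would lie within `ε` of `η`, against `JumpGap`. So it only flows
down, and it is not stopped at zero because `η - ε > 0`. -/
lemma bufferLevel_descend (hd : d < 0) (hu : StrictMono u) (hη : 0 < η - ε)
    (hgap : JumpGap K d η ε n z u) (h : ∀ r, s < r → r < t → η - ε < bufferLevel K d n z u r)
    {r r' : ℝ} (hsr : s < r) (hr : bufferLevel K d n z u r ≤ η + ε) (hrr' : r ≤ r')
    (hr't : r' < t) : bufferLevel K d n z u r' ≤ bufferLevel K d n z u r + d * (r' - r) := by
  have hflow : (∀ i, u i ≤ r) →
      bufferLevel K d n z u r' ≤ bufferLevel K d n z u r + d * (r' - r) := fun hur => by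
    have h1 := h r' (hsr.trans_le hrr') hr't
    rw [bufferLevel_flow hd.le hur hrr'] at h1 ⊢
    refine max_le ?_ le_rfl
    by_contra! hc
    rw [max_eq_left hc.le] at h1
    linarith
  induction n generalizing t r' with
  | zero => exact hflow fun i => i.elim0
  | succ n ih =>
    rcases le_or_gt t (u (Fin.last n)) with htτ | htτ
    · have H : ∀ q, q < t → bufferLevel K d (n + 1) z u q = _ := fun q hq =>
        bufferLevel_succ_of_lt (hq.trans_le htτ)
      rw [H r (hrr'.trans_lt hr't)] at hr ⊢
      rw [H r' hr't]
      refine ih hu.castSucc_comp hgap.1 (fun q h1 h2 => by rw [← H q h2]; exact h q h1 h2) hr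
        hrr' hr't fun hur => ?_
      have h1 := h r' (hsr.trans_le hrr') hr't
      rw [H r' hr't, bufferLevel_flow hd.le hur hrr'] at h1
      rw [bufferLevel_flow hd.le hur hrr']
      refine max_le ?_ le_rfl
      by_contra! hc
      rw [max_eq_left hc.le] at h1
      linarith
    · rcases le_or_gt (u (Fin.last n)) r with hτr | hτr
      · exact hflow fun i => (hu.monotone (Fin.le_last i)).trans hτr
      · exfalso
        have H : ∀ q, q < u (Fin.last n) → bufferLevel K d (n + 1) z u q = _ := fun q hq =>
          bufferLevel_succ_of_lt hq
        have h1 := bufferLevel_last_ge hd.le hu hτr fun q h1 h2 =>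
          (h q (hsr.trans h1) (h2.trans htτ)).le
        have h2 := bufferLevel_last_le (K := K) (z := z) (η := η + ε) hd.le hu hτr
          fun q h1 h2 => by
          have hq0 : d * (q - r) ≤ 0 := mul_nonpos_of_nonpos_of_nonneg hd.le (by linarith)
          rw [H r hτr] at hr
          rw [H q h2]
          refine (ih (r' := q) (t := u (Fin.last n)) (z := fun i => z i.castSucc)
            hu.castSucc_comp hgap.1 (fun p h3 h4 => ?_) hr h1.le h2 fun hur => ?_).trans
            (by linarith)
          · rw [← H p h4]; exact h p h3 (h4.trans htτ)
          · have h5 := h q (hsr.trans h1) (h2.trans htτ)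
            rw [H q h2, bufferLevel_flow hd.le hur h1.le] at h5
            rw [bufferLevel_flow hd.le hur h1.le]
            refine max_le ?_ le_rfl
            by_contra! hc
            rw [max_eq_left hc.le] at h5
            linarith
        have h3 := hgap.2
        rw [lt_abs] at h3
        rcases h3 with h3 | h3 <;> linarith

/-- If the content is not at the level `η` immediately before a jump, then the length of the
longest run is continuous in the level at `η`. -/
lemma runLength_le_of_jumpGap (hd : d < 0) (hu : StrictMono u) (hε : 0 ≤ ε) (hη : 0 < η - ε)
    (hgap : JumpGap K d η ε n z u) :
    runLength M (η - ε) (bufferLevel K d n z u) ≤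
      runLength M (η + ε) (bufferLevel K d n z u) + 2 * (2 * ε / (-d)) := by
  refine runLength_le_add (div_nonneg (by linarith) (by linarith))
    fun s t hs hst ht hr r h1 h2 => ?_
  -- If the content were at most `η + ε` at `r`, it would descend at rate `-d` and fall below `η -
  -- ε` after time `2ε / (-d)`, which is before the end of the run.
  by_contra! hc
  have h0 : 0 ≤ 2 * ε / (-d) := div_nonneg (by linarith) (by linarith)
  obtain ⟨r', h3, h4⟩ := exists_between (show r + 2 * ε / (-d) < t by linarith)
  have h5 := bufferLevel_descend hd hu hη hgap hr (by linarith) hc (by linarith : r ≤ r') h4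
  have h6 := hr r' (by linarith) h4
  have h7 : 2 * ε / (-d) < r' - r := by linarith
  rw [div_lt_iff₀ (by linarith)] at h7
  linarith

lemma abs_max_sub_max_left_le (a b c : ℝ) : |max c a - max c b| ≤ |a - b| := by
  rw [max_comm c a, max_comm c b]
  exact abs_max_sub_max_le_abs a b c

lemma abs_min_sub_min_left_le (a b c : ℝ) : |min c a - min c b| ≤ |a - b| := by
  simpa using abs_min_sub_min_le_max c a c b

/-- Truncation at `0` and `K` is a contraction, so errors in the sizes add up at most linearly. -/
lemma abs_bufferLevel_sub_le_sum {z' : Fin n → ℝ} :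
    |bufferLevel K d n z u t - bufferLevel K d n z' u t| ≤ ∑ i, |z i - z' i| := by
  induction n generalizing t with
  | zero => simp [bufferLevel]
  | succ n ih =>
    rw [Fin.sum_univ_castSucc]
    rcases lt_or_ge t (u (Fin.last n)) with h | h
    · rw [bufferLevel_succ_of_lt h, bufferLevel_succ_of_lt h]
      exact ih.trans (le_add_of_nonneg_right (abs_nonneg _))
    · rw [bufferLevel_succ_of_le h, bufferLevel_succ_of_le h]
      refine (abs_max_sub_max_left_le _ _ _).trans ?_
      rw [add_sub_add_right_eq_sub]
      refine (abs_max_sub_max_left_le _ _ _).trans ((abs_min_sub_min_left_le _ _ _).trans ?_)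
      rw [add_sub_add_comm]
      exact (abs_add_le _ _).trans (add_le_add ih le_rfl)

end bufferRun

end

noncomputable section

section bufferRun

variable {K d η ε M ρ : ℝ} {n : ℕ} {z u u' : Fin n → ℝ} {s t t' : ℝ}

lemma runLength_bufferLevel_le_of_dist {z' : Fin n → ℝ} (h : ∑ i, |z i - z' i| ≤ ε) :
    runLength M η (bufferLevel K d n z u) ≤ runLength M (η - ε) (bufferLevel K d n z' u) :=
  runLength_mono fun r _ _ hr => by
    have := (abs_le.1 ((abs_bufferLevel_sub_le_sum (K := K) (d := d) (z := z) (z' := z') (u := u)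
      (t := r)).trans h)).2
    linarith

/-! #### Perturbation of the jump times -/

/-- After all jumps of both paths, only the lengths of the descents between jumps differ. Each
differs by at most `2ρ`, and truncation does not enlarge the resulting error. -/
lemma abs_bufferLevel_sub_le_of_dist (hd : d ≤ 0) (hu : StrictMono u) (hu' : StrictMono u')
    (hρ : ∀ i, |u i - u' i| ≤ ρ) (ht : ∀ i, u i ≤ t) (ht' : ∀ i, u' i ≤ t')
    (htt' : |t - t'| ≤ ρ) :
    |bufferLevel K d n z u t - bufferLevel K d n z u' t'| ≤ 2 * n * (-d * ρ) := by
  induction n generalizing t t' with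
  | zero => simp [bufferLevel]
  | succ n ih =>
    have h1 := ih (z := fun i => z i.castSucc) hu.castSucc_comp hu'.castSucc_comp
      (fun i => hρ i.castSucc) (fun i => (hu (Fin.castSucc_lt_last i)).le)
      (fun i => (hu' (Fin.castSucc_lt_last i)).le) (hρ (Fin.last n))
    rw [bufferLevel_succ_of_le (ht _), bufferLevel_succ_of_le (ht' _)]
    refine (abs_max_sub_max_left_le _ _ _).trans ?_
    rw [add_sub_add_comm]
    refine (abs_add_le _ _).trans ?_
    have h2 : |d * (t - u (Fin.last n)) - d * (t' - u' (Fin.last n))| ≤ 2 * (-d * ρ) := by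
      have e : d * (t - u (Fin.last n)) - d * (t' - u' (Fin.last n)) =
          d * ((t - t') - (u (Fin.last n) - u' (Fin.last n))) := by ring
      rw [e, abs_mul, abs_of_nonpos hd]
      have h3 := (abs_sub (t - t') (u (Fin.last n) - u' (Fin.last n))).trans
        (add_le_add htt' (hρ (Fin.last n)))
      have := mul_le_mul_of_nonneg_left h3 (neg_nonneg.2 hd)
      linarith
    refine (add_le_add ((abs_max_sub_max_left_le _ _ _).trans
      ((abs_min_sub_min_left_le _ _ _).trans ?_)) h2).trans (b := 2 * n * (-d * ρ) + 2 * (-d * ρ))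
      ?_
    · rw [add_sub_add_right_eq_sub]
      exact h1
    · push_cast
      linarith

/-- Between corresponding jump times the two contents may differ by a whole jump, so only a
one-sided bound inside a shortened run is available. After the last jump of `u'` the path is
compared at the shifted time. Shortly before that jump the level from which the jump of `u` starts
is used, and `hgap` ensures that the earlier jumps of `u'` are over. At earlier times the induction
applies. -/
lemma bufferLevel_ge_of_dist (hd : d ≤ 0) (hρ0 : 0 ≤ ρ) (hu : StrictMono u) (hu' : StrictMono u')
    (hρ : ∀ i, |u i - u' i| ≤ ρ) (hgap : ∀ i j, i < j → u i + 2 * ρ < u j)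
    (h : ∀ r, s < r → r < t → η < bufferLevel K d n z u r) {r : ℝ} (hsr : s + ρ < r)
    (hrt : r < t - ρ) : η - 2 * n * (-d * ρ) ≤ bufferLevel K d n z u' r := by
  have hdρ : 0 ≤ -d * ρ := mul_nonneg (neg_nonneg.2 hd) hρ0
  induction n generalizing t with
  | zero =>
    have := h r (by linarith) (by linarith)
    simp only [bufferLevel, Nat.cast_zero] at this ⊢
    linarith
  | succ n ih =>
    have hlast := abs_le.1 (hρ (Fin.last n))
    rcases le_or_gt (u' (Fin.last n)) r with hr | hr
    · have h1 := abs_bufferLevel_sub_le_of_dist (K := K) (z := z) hd hu hu' hρ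
        (t := r - u' (Fin.last n) + u (Fin.last n)) (t' := r)
        (fun i => (hu.monotone (Fin.le_last i)).trans (by linarith))
        (fun i => (hu'.monotone (Fin.le_last i)).trans hr)
        (by rw [abs_le]; constructor <;> linarith)
      have h2 := h (r - u' (Fin.last n) + u (Fin.last n)) (by linarith) (by linarith)
      linarith [(abs_le.1 h1).2]
    · rw [bufferLevel_succ_of_lt hr]
      push_cast
      have hIH : ∀ t, t ≤ u (Fin.last n) →
          (∀ r, s < r → r < t → η < bufferLevel K d (n + 1) z u r) → r < t - ρ →
          η - 2 * n * (-d * ρ) ≤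
            bufferLevel K d n (fun i => z i.castSucc) (fun i => u' i.castSucc) r :=
        fun t ht H hrt => ih hu.castSucc_comp hu'.castSucc_comp (fun i => hρ i.castSucc)
          (fun i j hij => hgap _ _ (Fin.castSucc_lt_castSucc_iff.2 hij))
          (fun q h1 h2 => by
            rw [← bufferLevel_succ_of_lt (h2.trans_le ht)]; exact H q h1 h2) hrt
      rcases le_or_gt t (u (Fin.last n)) with htτ | htτ
      · linarith [hIH t htτ h hrt]
      · rcases lt_or_ge r (u (Fin.last n) - ρ) with hr' | hr'
        · linarith [hIH _ le_rfl (fun q h1 h2 => h q h1 (h2.trans htτ)) hr']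
        · have h1 := bufferLevel_last_ge hd hu (by linarith : s < u (Fin.last n))
            fun q h1 h2 => (h q h1 (h2.trans htτ)).le
          have h2 := abs_bufferLevel_sub_le_of_dist (K := K) (z := fun i => z i.castSucc) hd
            hu.castSucc_comp hu'.castSucc_comp (fun i => hρ i.castSucc)
            (t := u (Fin.last n)) (t' := r) (fun i => (hu (Fin.castSucc_lt_last i)).le)
            (fun i => by
              have h3 := hgap _ _ (Fin.castSucc_lt_last i)
              have h4 := (abs_le.1 (hρ i.castSucc)).1
              linarith) (by rw [abs_le]; constructor <;> linarith)
          linarith [(abs_le.1 h2).2]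

lemma runLength_le_of_dist (hd : d ≤ 0) (hρ0 : 0 ≤ ρ) (hu : StrictMono u) (hu' : StrictMono u')
    (hρ : ∀ i, |u i - u' i| ≤ ρ) (hgap : ∀ i j, i < j → u i + 2 * ρ < u j)
    (hε : 2 * n * (-d * ρ) < ε) :
    runLength M η (bufferLevel K d n z u) ≤
      runLength M (η - ε) (bufferLevel K d n z u') + 2 * ρ :=
  runLength_le_add hρ0 fun _ _ _ _ _ hr _ h1 h2 =>
    (by linarith : η - ε < η - 2 * n * (-d * ρ)).trans_le
      (bufferLevel_ge_of_dist hd hρ0 hu hu' hρ hgap hr h1 h2)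

/-! #### Measurability -/

lemma measurable_runLength_bufferLevel (hd : d ≤ 0) (hη : 0 ≤ η) :
    Measurable fun p : (Fin n → ℝ) × (Fin n → ℝ) =>
      runLength M η (bufferLevel K d n p.1 p.2) := by
  have hm : ∀ r : ℝ, Measurable fun p : (Fin n → ℝ) × (Fin n → ℝ) =>
      bufferLevel K d n p.1 p.2 r := fun r =>
    (measurable_bufferLevel K d n).comp
      (measurable_fst.prodMk (measurable_snd.prodMk measurable_const))
  refine measurable_of_Ioi fun y => ?_
  rcases lt_or_ge y 0 with hy | hy
  · convert MeasurableSet.univ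
    exact eq_univ_of_forall fun p => hy.trans_le runLength_nonneg
  have : (fun p : (Fin n → ℝ) × (Fin n → ℝ) => runLength M η (bufferLevel K d n p.1 p.2)) ⁻¹'
      Ioi y = ⋃ (a : ℚ) (b : ℚ) (_ : (0 : ℝ) ≤ a ∧ (b : ℝ) ≤ M ∧ y < (b : ℝ) - a),
        ⋂ (q : ℚ) (_ : a < q ∧ q < b), {p | η < bufferLevel K d n p.1 p.2 q} := by
    ext p
    simp only [mem_preimage, mem_Ioi, mem_iUnion, mem_iInter, mem_ofPred_eq, exists_prop,
      lt_runLength_iff hy]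
    constructor
    · rintro ⟨s, t, hs, ht, hr, hst⟩
      obtain ⟨a, ha1, ha2⟩ := exists_rat_btwn (show s < t - y by linarith)
      obtain ⟨b, hb1, hb2⟩ := exists_rat_btwn (show a + y < t by linarith)
      refine ⟨a, b, ⟨by linarith, by linarith, by linarith⟩, fun q hq => hr q ?_ ?_⟩
      · have : (a : ℝ) < q := by exact_mod_cast hq.1
        linarith
      · have : (q : ℝ) < b := by exact_mod_cast hq.2
        linarith
    · rintro ⟨a, b, ⟨h1, h2, h3⟩, h4⟩
      -- Rational times suffice: from a time with content at most `η` the path does not exceed `η`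
      -- for a short while to the right, which would give a rational time violating the condition.
      refine ⟨a, b, h1, h2, fun r har hrb => ?_, h3⟩
      by_contra! hc
      obtain ⟨c, hc1, hc2⟩ := bufferLevel_flow_right (K := K) (z := p.1) (u := p.2) hd r
      obtain ⟨q, hq1, hq2⟩ := exists_rat_btwn (show r < min c b from lt_min hc1 hrb)
      have h5 := h4 q ⟨by exact_mod_cast har.trans hq1,
        by exact_mod_cast hq2.trans_le (min_le_right _ _)⟩
      rw [hc2 q ⟨hq1.le, hq2.trans_le (min_le_left _ _)⟩] at h5
      refine h5.not_ge (max_le hη ?_)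
      linarith [mul_nonpos_of_nonpos_of_nonneg hd (sub_nonneg.2 hq1.le)]
  rw [this]
  refine MeasurableSet.iUnion fun a => MeasurableSet.iUnion fun b => MeasurableSet.iUnion fun _ =>
    MeasurableSet.iInter fun q => MeasurableSet.iInter fun _ =>
      measurableSet_lt measurable_const (hm q)

/-! #### The content is almost never at a given level immediately before a jump -/

lemma measurableSet_jumpGap (K d η ε : ℝ) (n : ℕ) :
    MeasurableSet {p : (Fin n → ℝ) × (Fin n → ℝ) | JumpGap K d η ε n p.1 p.2} := by
  induction n with
  | zero => simp [JumpGap]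
  | succ n ih =>
    have h1 : Measurable fun p : (Fin (n + 1) → ℝ) × (Fin (n + 1) → ℝ) =>
        ((fun i : Fin n => p.1 i.castSucc), (fun i : Fin n => p.2 i.castSucc)) := by fun_prop
    have h2 : Measurable fun p : (Fin (n + 1) → ℝ) × (Fin (n + 1) → ℝ) =>
        bufferLevel K d n (fun i => p.1 i.castSucc) (fun i => p.2 i.castSucc)
          (p.2 (Fin.last n)) :=
      (measurable_bufferLevel K d n).comp (f := fun p : (Fin (n + 1) → ℝ) × (Fin (n + 1) → ℝ) =>
          ((fun i : Fin n => p.1 i.castSucc), (fun i : Fin n => p.2 i.castSucc),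
            p.2 (Fin.last n))) (by fun_prop)
    exact (h1 ih).inter (measurableSet_lt measurable_const
      (continuous_abs.measurable.comp (h2.sub_const η)))

/-- With the earlier jump times fixed, the content before the last jump is a function of the time of
that jump which decreases strictly while positive. It therefore takes the value `η > 0` at most
once, and Fubini's theorem gives a null set. -/
lemma volume_not_jumpGap (hd : d < 0) (hη : 0 < η) (z : Fin n → ℝ) :
    volume {u : Fin n → ℝ | StrictMono u ∧ ¬ JumpGap K d η 0 n z u} = 0 := by
  induction n with
  | zero => simp [JumpGap]
  | succ n ih =>
    set B : Set (Fin n → ℝ) :=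
      {u | StrictMono u ∧ ¬ JumpGap K d η 0 n (fun i => z i.castSucc) u} with hB
    set E : Set (ℝ × (Fin n → ℝ)) := {p | (∀ i, p.2 i < p.1) ∧
      bufferLevel K d n (fun i => z i.castSucc) p.2 p.1 = η} with hE
    let e := MeasurableEquiv.piFinSuccAbove (fun _ : Fin (n + 1) => ℝ) (Fin.last n)
    have hmp : MeasurePreserving e volume volume :=
      volume_preserving_piFinSuccAbove (fun _ : Fin (n + 1) => ℝ) (Fin.last n)
    have hE0 : volume E = 0 := by
      have hmE : MeasurableSet E := by
        have h1 : Measurable fun p : ℝ × (Fin n → ℝ) =>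
            bufferLevel K d n (fun i => z i.castSucc) p.2 p.1 :=
          (measurable_bufferLevel K d n).comp
            (f := fun p : ℝ × (Fin n → ℝ) => ((fun i : Fin n => z i.castSucc), p.2, p.1))
            (by fun_prop)
        have h2 : MeasurableSet {p : ℝ × (Fin n → ℝ) | ∀ i, p.2 i < p.1} := by
          rw [ofPred_forall]
          exact MeasurableSet.iInter fun i => measurableSet_lt (by fun_prop) (by fun_prop)
        exact h2.inter (measurableSet_eq_fun h1 measurable_const)
      rw [Measure.volume_eq_prod, Measure.prod_apply_symm hmE, lintegral_eq_zero_of_ae_eq_zero]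
      refine Eventually.of_forall fun w => Set.Subsingleton.measure_zero ?_ _
      have key : ∀ t t', t < t' → (t, w) ∈ E → (t', w) ∈ E → False := by
        rintro t t' htt' ⟨h1, h2⟩ ⟨-, h3⟩
        dsimp only at h1 h2 h3
        rw [bufferLevel_flow hd.le (fun i => (h1 i).le) htt'.le, h2] at h3
        have := mul_neg_of_neg_of_pos hd (sub_pos.2 htt')
        have : max 0 (η + d * (t' - t)) < η := max_lt hη (by linarith)
        linarith
      intro t ht t' ht'
      rcases lt_trichotomy t t' with h | h | h
      · exact (key t t' h ht ht').elim
      · exact h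
      · exact (key t' t h ht' ht).elim
    have hB0 : volume (Prod.snd ⁻¹' B : Set (ℝ × (Fin n → ℝ))) = 0 :=
      Measure.quasiMeasurePreserving_snd.preimage_null (ih _)
    refine measure_mono_null (t := e ⁻¹' (E ∪ Prod.snd ⁻¹' B)) ?_ ?_
    · rintro u ⟨hu, hgap⟩
      have he : e u = (u (Fin.last n), fun i => u i.castSucc) := by
        refine Prod.ext rfl (funext fun i => ?_)
        change u ((Fin.last n).succAbove i) = _
        rw [Fin.succAbove_last]
      rw [mem_preimage, he]
      by_cases h : JumpGap K d η 0 n (fun i => z i.castSucc) (fun i => u i.castSucc)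
      · refine Or.inl ⟨fun i => hu (Fin.castSucc_lt_last i), ?_⟩
        by_contra hc
        exact hgap ⟨h, abs_pos.2 (sub_ne_zero.2 hc)⟩
      · exact Or.inr ⟨hu.castSucc_comp, h⟩
    · rw [hmp.measure_preimage_equiv]
      exact measure_union_null hE0 hB0

/-! #### Configurations with a long run -/

/-- Every jump of size at least `K` fills the buffer, whatever the past. -/
lemma bufferLevel_ge_of_le (hK : 0 < K) (hd : d ≤ 0) (hu : StrictMono u)
    (hz : ∀ i, K ≤ z i) (i : Fin n) (hi : u i ≤ t) :
    K + d * (t - u i) ≤ bufferLevel K d n z u t := by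
  induction n with
  | zero => exact i.elim0
  | succ n ih =>
    rcases lt_or_ge t (u (Fin.last n)) with h | h
    · rw [bufferLevel_succ_of_lt h]
      cases i using Fin.lastCases with
      | last => exact absurd hi h.not_ge
      | cast i => exact ih (z := fun i => z i.castSucc) hu.castSucc_comp (fun i => hz _) i hi
    · have h1 := hz (Fin.last n)
      have h2 : 0 ≤ bufferLevel K d n (fun i => z i.castSucc) (fun i => u i.castSucc)
        (u (Fin.last n)) := bufferLevel_nonneg
      rw [bufferLevel_succ_of_le h, min_eq_left (by linarith), max_eq_right hK.le]
      refine le_max_of_le_right ?_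
      have := mul_le_mul_of_nonpos_left (sub_le_sub_left (hu.monotone (Fin.le_last i)) t) hd
      linarith

/-- Large jumps, at distances slightly less than `b`, the time to go down from `K` to `η`. -/
lemma lt_runLength_of_large_jumps {b δ : ℝ} (hK : 0 < K) (hd : d < 0) (hη : K + d * b = η)
    (hδ : 0 < δ) (hδb : 4 * (n + 1) * δ ≤ b) (hM : (n + 1) * b ≤ M) {z u : Fin (n + 1) → ℝ}
    (hz : ∀ i, K < z i)
    (hu : ∀ i : Fin (n + 1), u i ∈ Ioo (i * (b - 2 * δ)) (i * (b - 2 * δ) + δ)) :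
    (∀ i, u i ∈ Icc 0 M) ∧ StrictMono u ∧ n * b < runLength M η (bufferLevel K d (n + 1) z u) := by
  have hn : (0 : ℝ) ≤ n := n.cast_nonneg
  have hb : 4 * δ ≤ b := by nlinarith
  have hnδ : 0 ≤ n * δ := mul_nonneg hn hδ.le
  have hmono : StrictMono u := by
    rw [Fin.strictMono_iff_lt_succ]
    intro i
    have h1 := (hu i.castSucc).2
    have h2 := (hu i.succ).1
    simp only [Fin.val_castSucc, Fin.val_succ] at h1 h2
    push_cast at h2
    linarith
  refine ⟨fun i => ⟨?_, ?_⟩, hmono, ?_⟩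
  · refine le_trans ?_ (hu i).1.le
    exact mul_nonneg (Nat.cast_nonneg _) (by linarith)
  · refine (hu i).2.le.trans ?_
    have h1 : (i : ℝ) ≤ n := by exact_mod_cast Nat.lt_succ_iff.1 i.2
    have h2 := mul_le_mul_of_nonneg_right h1 (by linarith : 0 ≤ b - 2 * δ)
    nlinarith
  have h0 := (hu 0).2
  simp only [Fin.val_zero, Nat.cast_zero, zero_mul, zero_add] at h0
  -- The run is the interval from `δ` to `n * b + 2 * δ`. The first jump comes before `δ`,
  -- consecutive jumps are less than `b - δ` apart, and the last one keeps the content above `η` up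
  -- to time `(n + 1) * b - 2 * n * δ`, which is large enough since `4 * (n + 1) * δ ≤ b`.
  have key : n * b + 2 * δ - δ ≤ runLength M η (bufferLevel K d (n + 1) z u) := by
    refine sub_le_runLength hδ.le (by nlinarith) fun r hr1 hr2 => ?_
    obtain ⟨i, hi, hib⟩ : ∃ i, u i ≤ r ∧ r - u i < b := by
      by_contra! hc
      have : ∀ k : ℕ, ∀ hk : k < n + 1, u ⟨k, hk⟩ ≤ r := by
        intro k
        induction k with
        | zero => exact fun _ => (h0.trans hr1).le
        | succ k ih =>
          intro hk
          have h1 := hc _ (ih (by omega))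
          have h2 := (hu ⟨k, by omega⟩).1
          have h3 := (hu ⟨k + 1, hk⟩).2
          simp only at h2 h3
          push_cast at h3
          linarith
      have h1 := hc _ (this n (by omega))
      have h2 := (hu ⟨n, by omega⟩).1
      simp only at h2
      nlinarith
    refine lt_of_lt_of_le ?_ (bufferLevel_ge_of_le hK hd.le hmono (fun i => (hz i).le) i hi)
    nlinarith
  linarith

end bufferRun

end

noncomputable section

/-! ### Regularly varying tails -/

section RegularVariation

variable {f : ℝ → ℝ} {α β : ℝ}

/-- Where `f` vanishes, the quotient `f t / f t` has the value `0`, but it tends to `1`. So `f` is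
positive at arbitrarily large arguments, and monotonicity gives the rest. -/
lemma RegularlyVarying.pos (hf : RegularlyVarying β f) (hanti : Antitone f) (h0 : ∀ t, 0 ≤ f t)
    (t : ℝ) : 0 < f t := by
  have h1 : Tendsto (fun t => f (t * 1) / f t) atTop (𝓝 1) := by
    simpa using hf 1 one_pos
  have h2 : ∀ᶠ s in atTop, 0 < f s := by
    filter_upwards [h1.eventually (lt_mem_nhds one_pos)] with s hs
    refine (h0 s).lt_of_ne fun h => ?_
    rw [← h, div_zero] at hs
    exact hs.false
  obtain ⟨s, hs, hts⟩ := (h2.and (eventually_ge_atTop t)).exists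
  exact hs.trans_le (hanti hts)

lemma forall_ge_of_doubling {p : ℝ → Prop} {a : ℝ} (ha : 0 < a)
    (h1 : ∀ t, a ≤ t → t ≤ 2 * a → p t) (h2 : ∀ t, a ≤ t → p t → p (2 * t)) (t : ℝ)
    (ht : a ≤ t) : p t := by
  have key : ∀ k : ℕ, ∀ t, a ≤ t → t ≤ 2 ^ (k + 1) * a → p t := by
    intro k
    induction k with
    | zero => intro t ht ht'; exact h1 t ht (by simpa using ht')
    | succ k ih =>
      intro t ht ht'
      rcases le_total t (2 * a) with h | h
      · exact h1 t ht h
      · have h3 := ih (t / 2) (by linarith) (by rw [pow_succ] at ht'; linarith)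
        have h4 := h2 (t / 2) (by linarith) h3
        rwa [mul_div_cancel₀ t two_ne_zero] at h4
  obtain ⟨k, hk⟩ := pow_unbounded_of_one_lt (t / a) (one_lt_two (α := ℝ))
  rw [div_lt_iff₀ ha] at hk
  refine key k t ht (hk.le.trans ?_)
  rw [pow_succ]
  nlinarith [pow_pos (two_pos (α := ℝ)) k]

/-- Since `f (2 * t) / f t` tends to `2 ^ (-α) < 2 ^ (-β)`, each doubling of a large `t` reduces `f`
at least by the factor `2 ^ (-β)`. Iterating this over dyadic scales gives a one-sided Potter bound,
enough for moments and for `n f(n) → 0`. -/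
lemma RegularlyVarying.exists_le_rpow (hf : RegularlyVarying (-α) f) (hanti : Antitone f)
    (h0 : ∀ t, 0 ≤ f t) (hβ : 0 < β) (hβα : β < α) :
    ∃ C a : ℝ, 0 < C ∧ 1 ≤ a ∧ ∀ t, a ≤ t → f t ≤ C * t ^ (-β) := by
  have hpos := hf.pos hanti h0
  have h2 : ((2 : ℝ) ^ (-α)) < 2 ^ (-β) :=
    Real.rpow_lt_rpow_of_exponent_lt one_lt_two (by linarith)
  obtain ⟨a, ha⟩ := eventually_atTop.1 ((hf 2 two_pos).eventually (gt_mem_nhds h2))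
  set b := max a 1 with hb
  have hb1 : 1 ≤ b := le_max_right _ _
  have hb0 : 0 < b := by linarith
  refine ⟨f b * (2 * b) ^ β, b, mul_pos (hpos b) (by positivity), hb1,
    forall_ge_of_doubling hb0 (fun t ht ht' => ?_) fun t ht hp => ?_⟩
  · have ht0 : 0 < t := hb0.trans_le ht
    rw [mul_assoc]
    refine (hanti ht).trans (le_mul_of_one_le_right (h0 b) ?_)
    rw [Real.rpow_neg ht0.le, ← div_eq_mul_inv, one_le_div (by positivity)]
    exact Real.rpow_le_rpow ht0.le ht' hβ.le
  · have ht0 : 0 < t := hb0.trans_le ht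
    have h3 := ha t ((le_max_left _ _).trans ht)
    rw [div_lt_iff₀ (hpos t), mul_comm t 2] at h3
    refine h3.le.trans ?_
    rw [Real.mul_rpow two_pos.le ht0.le]
    calc (2 : ℝ) ^ (-β) * f t ≤ 2 ^ (-β) * (f b * (2 * b) ^ β * t ^ (-β)) := by gcongr
      _ = _ := by ring

/-- The opposite Potter bound. It limits the growth of the rate to a power of `n`, so that a
polynomially small error remains negligible after multiplication by the rate. -/
lemma RegularlyVarying.exists_rpow_le (hf : RegularlyVarying (-α) f) (hanti : Antitone f)
    (h0 : ∀ t, 0 ≤ f t) (hα : 0 < α) (hβα : α < β) :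
    ∃ C a : ℝ, 0 < C ∧ 1 ≤ a ∧ ∀ t, a ≤ t → C * t ^ (-β) ≤ f t := by
  have hpos := hf.pos hanti h0
  have h2 : ((2 : ℝ) ^ (-β)) < 2 ^ (-α) :=
    Real.rpow_lt_rpow_of_exponent_lt one_lt_two (by linarith)
  obtain ⟨a, ha⟩ := eventually_atTop.1 ((hf 2 two_pos).eventually (lt_mem_nhds h2))
  set b := max a 1 with hb
  have hb1 : 1 ≤ b := le_max_right _ _
  have hb0 : 0 < b := by linarith
  refine ⟨f (2 * b) * b ^ β, b, mul_pos (hpos _) (by positivity), hb1,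
    forall_ge_of_doubling hb0 (fun t ht ht' => ?_) fun t ht hp => ?_⟩
  · have ht0 : 0 < t := hb0.trans_le ht
    rw [mul_assoc]
    refine (mul_le_of_le_one_right (h0 _) ?_).trans (hanti ht')
    rw [Real.rpow_neg ht0.le, ← div_eq_mul_inv, div_le_one (by positivity)]
    exact Real.rpow_le_rpow hb0.le ht (by linarith)
  · have ht0 : 0 < t := hb0.trans_le ht
    have h3 := ha t ((le_max_left _ _).trans ht)
    rw [lt_div_iff₀ (hpos t), mul_comm t 2] at h3
    refine le_trans ?_ h3.le
    rw [Real.mul_rpow two_pos.le ht0.le]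
    calc _ = (2 : ℝ) ^ (-β) * (f (2 * b) * b ^ β * t ^ (-β)) := by ring
      _ ≤ _ := by gcongr

lemma RegularlyVarying.tendsto_mul_self (hf : RegularlyVarying (-α) f) (hanti : Antitone f)
    (h0 : ∀ t, 0 ≤ f t) (hα : 1 < α) : Tendsto (fun n : ℕ => n * f n) atTop (𝓝 0) := by
  obtain ⟨β, hβ1, hβα⟩ := exists_between hα
  obtain ⟨C, a, hC, ha, H⟩ := hf.exists_le_rpow hanti h0 (by linarith) hβα
  have h1 : Tendsto (fun n : ℕ => C * (n : ℝ) ^ (-(β - 1))) atTop (𝓝 0) := by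
    simpa using ((tendsto_rpow_neg_atTop (by linarith : 0 < β - 1)).comp
      tendsto_natCast_atTop_atTop).const_mul C
  refine squeeze_zero' (Eventually.of_forall fun n => mul_nonneg n.cast_nonneg (h0 _)) ?_ h1
  filter_upwards [eventually_ge_atTop ⌈a⌉₊] with n hn
  have hn' : a ≤ n := Nat.ceil_le.1 hn
  have hn0 : (0 : ℝ) < n := by linarith
  calc (n : ℝ) * f n ≤ n * (C * (n : ℝ) ^ (-β)) := by gcongr; exact H n hn'
    _ = C * ((n : ℝ) ^ (1 : ℝ) * (n : ℝ) ^ (-β)) := by rw [Real.rpow_one]; ring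
    _ = _ := by rw [← Real.rpow_add hn0]; ring_nf

end RegularVariation

/-- A random variable with a tail of polynomial order `β` has moments of all orders less
than `β`. -/
lemma lintegral_rpow_lt_top_of_tail {Ω : Type*} [MeasurableSpace Ω] {P : Measure Ω}
    [IsProbabilityMeasure P] {Y : Ω → ℝ} (hY : Measurable Y) (hY0 : ∀ ω, 0 ≤ Y ω)
    {β p C a : ℝ} (hp : 0 < p) (hpβ : p < β) (ha : 1 ≤ a)
    (h : ∀ t, a ≤ t → P.real {ω | t < Y ω} ≤ C * t ^ (-β)) :
    ∫⁻ ω, ENNReal.ofReal (Y ω ^ p) ∂P < ∞ := by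
  rw [lintegral_rpow_eq_lintegral_meas_lt_mul P (Eventually.of_forall hY0) hY.aemeasurable hp]
  refine ENNReal.mul_lt_top ENNReal.ofReal_lt_top ?_
  have ha0 : 0 < a := by linarith
  rw [← Ioc_union_Ioi_eq_Ioi ha0.le]
  refine (lintegral_union_le _ _ _).trans_lt (ENNReal.add_lt_top.2 ⟨?_, ?_⟩)
  · have h1 : IntegrableOn (fun t : ℝ => t ^ (p - 1)) (Ioc 0 a) := by
      rw [← intervalIntegrable_iff_integrableOn_Ioc_of_le ha0.le]
      exact intervalIntegral.intervalIntegrable_rpow' (by linarith)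
    refine lt_of_le_of_lt ?_ h1.lintegral_lt_top
    refine lintegral_mono fun t => ?_
    calc _ ≤ 1 * ENNReal.ofReal (t ^ (p - 1)) := by gcongr; exact prob_le_one
      _ = _ := one_mul _
  · have h1 : IntegrableOn (fun t : ℝ => C * t ^ (p - 1 - β)) (Ioi a) :=
      (integrableOn_Ioi_rpow_of_lt (by linarith) ha0).const_mul C
    refine lt_of_le_of_lt ?_ h1.lintegral_lt_top
    refine setLIntegral_mono' measurableSet_Ioi fun t ht => ?_
    have ht0 : 0 < t := ha0.trans ht
    rw [← ofReal_measureReal, ← ENNReal.ofReal_mul measureReal_nonneg]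
    refine ENNReal.ofReal_le_ofReal ?_
    calc _ ≤ C * t ^ (-β) * t ^ (p - 1) := by gcongr; exact h t (le_of_lt ht)
      _ = C * (t ^ (p - 1) * t ^ (-β)) := by ring
      _ = _ := by rw [← Real.rpow_add ht0]; ring_nf

/-! ### Exponential bounds for sums of bounded variables -/

lemma exp_le_one_add_add_sq_mul (x : ℝ) : Real.exp x ≤ 1 + x + x ^ 2 * Real.exp |x| := by
  rcases le_total |x| 1 with h | h
  · have h1 := (abs_le.1 (Real.abs_exp_sub_one_sub_id_le h)).2
    have h2 : 1 ≤ Real.exp |x| := Real.one_le_exp (abs_nonneg _)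
    nlinarith [sq_nonneg x]
  · have h2 : 1 ≤ x ^ 2 := by rw [← sq_abs]; nlinarith
    rcases le_total 0 x with hx | hx
    · rw [abs_of_nonneg hx]
      nlinarith [Real.exp_pos x]
    · have h3 : Real.exp x ≤ 1 := Real.exp_le_one_iff.2 hx
      have h4 : 1 ≤ Real.exp |x| := Real.one_le_exp (abs_nonneg _)
      have h5 : x ^ 2 ≤ x ^ 2 * Real.exp |x| := le_mul_of_one_le_right (sq_nonneg x) h4
      nlinarith

/-- Chernoff's bound for sums of independent centred bounded variables. -/
lemma measureReal_sum_ge_le {Ω : Type*} [MeasurableSpace Ω] {P : Measure Ω}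
    [IsProbabilityMeasure P] {Y : ℕ → Ω → ℝ} (hY : ∀ i, Measurable (Y i)) (hind : iIndepFun Y P)
    {b v l : ℝ} (hb : ∀ i ω, |Y i ω| ≤ b) (hmean : ∀ i, ∫ ω, Y i ω ∂P = 0)
    (hvar : ∀ i, ∫ ω, Y i ω ^ 2 ∂P ≤ v) (hl : 0 ≤ l) (k : ℕ) (x : ℝ) :
    P.real {ω | x ≤ ∑ i ∈ Finset.range k, Y i ω} ≤
      Real.exp (-l * x + k * (l ^ 2 * v * Real.exp (l * b))) := by
  have hYi : ∀ i, Integrable (Y i) P := fun i =>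
    Integrable.of_bound (hY i).aestronglyMeasurable b (Eventually.of_forall (hb i))
  have hY2 : ∀ i, Integrable (fun ω => Y i ω ^ 2) P := fun i =>
    Integrable.of_bound ((hY i).pow_const 2).aestronglyMeasurable (b ^ 2)
      (Eventually.of_forall fun ω => by
        rw [Real.norm_eq_abs, abs_pow]
        exact pow_le_pow_left₀ (abs_nonneg _) (hb i ω) 2)
  have hmgf : ∀ i, mgf (Y i) P l ≤ Real.exp (l ^ 2 * v * Real.exp (l * b)) := by
    intro i
    have h1 : ∀ ω, Real.exp (l * Y i ω) ≤
        1 + l * Y i ω + l ^ 2 * Real.exp (l * b) * Y i ω ^ 2 := fun ω => by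
      refine (exp_le_one_add_add_sq_mul _).trans ?_
      have h2 : Real.exp |l * Y i ω| ≤ Real.exp (l * b) := by
        rw [Real.exp_le_exp, abs_mul, abs_of_nonneg hl]
        exact mul_le_mul_of_nonneg_left (hb i ω) hl
      have h3 := mul_le_mul_of_nonneg_left h2 (sq_nonneg (l * Y i ω))
      have h4 : (l * Y i ω) ^ 2 * Real.exp (l * b) =
        l ^ 2 * Real.exp (l * b) * Y i ω ^ 2 := by ring
      linarith
    calc mgf (Y i) P l ≤ ∫ ω, (1 + l * Y i ω + l ^ 2 * Real.exp (l * b) * Y i ω ^ 2) ∂P := by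
          refine integral_mono_of_nonneg (Eventually.of_forall fun ω => (Real.exp_pos _).le) ?_
            (Eventually.of_forall h1)
          exact ((integrable_const 1).add ((hYi i).const_mul l)).add ((hY2 i).const_mul _)
      _ = 1 + l ^ 2 * Real.exp (l * b) * ∫ ω, Y i ω ^ 2 ∂P := by
          have e1 := integral_add (μ := P) (integrable_const (1 : ℝ)) ((hYi i).const_mul l)
          have e2 := integral_add ((integrable_const (1 : ℝ)).add ((hYi i).const_mul l))
            ((hY2 i).const_mul (l ^ 2 * Real.exp (l * b)))
          simp only [Pi.add_apply] at e2
          rw [e2, e1, integral_const_mul, integral_const_mul, hmean]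
          simp
      _ ≤ 1 + l ^ 2 * v * Real.exp (l * b) := by
          have := mul_le_mul_of_nonneg_left (hvar i)
            (by positivity : 0 ≤ l ^ 2 * Real.exp (l * b))
          linarith
      _ ≤ _ := by rw [add_comm]; exact Real.add_one_le_exp _
  have hsum : mgf (∑ i ∈ Finset.range k, Y i) P l ≤
      Real.exp (k * (l ^ 2 * v * Real.exp (l * b))) := by
    rw [hind.mgf_sum hY]
    refine (Finset.prod_le_prod (fun i _ => mgf_nonneg) fun i _ => hmgf i).trans ?_
    rw [Finset.prod_const, Finset.card_range, ← Real.exp_nat_mul]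
  have hint : Integrable (fun ω => Real.exp (l * (∑ i ∈ Finset.range k, Y i) ω)) P := by
    refine Integrable.of_bound (C := Real.exp (l * (k * b))) ?_ (Eventually.of_forall fun ω => ?_)
    · refine Measurable.aestronglyMeasurable ?_
      simp only [Finset.sum_apply]
      exact ((Finset.measurable_sum _ fun i _ => hY i).const_mul l).exp
    · rw [Real.norm_eq_abs, Real.abs_exp, Real.exp_le_exp, Finset.sum_apply]
      refine mul_le_mul_of_nonneg_left ?_ hl
      refine (Finset.sum_le_card_nsmul _ _ b fun i _ => (le_abs_self _).trans (hb i ω)).trans ?_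
      simp
  have := measure_ge_le_exp_mul_mgf (μ := P) (X := ∑ i ∈ Finset.range k, Y i) x hl hint
  simp only [Finset.sum_apply] at this
  refine this.trans ?_
  rw [Real.exp_add]
  gcongr

end

noncomputable section

/-! ### Deviations of the truncated random walk -/

/-- The value `x` if it is at most `b`, and `0` otherwise. -/
def truncAt (b x : ℝ) : ℝ := if x ≤ b then x else 0

lemma measurable_truncAt (b : ℝ) : Measurable (truncAt b) :=
  Measurable.ite measurableSet_Iic measurable_id measurable_const

lemma truncAt_nonneg {b x : ℝ} (hx : 0 ≤ x) : 0 ≤ truncAt b x := by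
  unfold truncAt; split_ifs <;> simp [hx]

lemma truncAt_le {b x : ℝ} (hb : 0 ≤ b) : truncAt b x ≤ b := by
  unfold truncAt; split_ifs with h <;> simp [hb, h]

lemma truncAt_le_self {b x : ℝ} (hx : 0 ≤ x) : truncAt b x ≤ x := by
  unfold truncAt; split_ifs with h <;> simp [hx]

/-- The variance may be infinite when `α ≤ 2`. Interpolation through a moment of order `p` bounds
the second moment of the truncated variable here, and its bias in `sub_truncAt_le`. -/
lemma truncAt_sq_le {b x p : ℝ} (hb : 0 < b) (hx : 0 ≤ x) (hp2 : p ≤ 2) :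
    truncAt b x ^ 2 ≤ b ^ (2 - p) * x ^ p := by
  unfold truncAt
  split_ifs with h
  · rcases hx.eq_or_lt with rfl | hx
    · simp; positivity
    · calc x ^ 2 = x ^ (2 - p) * x ^ p := by
            rw [← Real.rpow_add hx]; norm_num
        _ ≤ _ := by
            gcongr
  · simp; positivity

lemma sub_truncAt_le {b x p : ℝ} (hb : 0 < b) (hx : 0 ≤ x) (hp : 1 ≤ p) :
    x - truncAt b x ≤ b ^ (1 - p) * x ^ p := by
  unfold truncAt
  split_ifs with h
  · rw [sub_self]; positivity
  · have hx : 0 < x := hb.trans (not_le.1 h)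
    calc x - 0 = x ^ (1 - p) * x ^ p := by rw [← Real.rpow_add hx]; norm_num
      _ ≤ _ := by
        gcongr ?_ * _
        exact Real.rpow_le_rpow_of_nonpos hb (not_le.1 h).le (by linarith)

section

variable {Ω : Type*} [MeasurableSpace Ω] {P : Measure Ω} [IsProbabilityMeasure P] {Y : Ω → ℝ}
  {b p : ℝ}

lemma integrable_truncAt (hY : Measurable Y) (hY0 : ∀ ω, 0 ≤ Y ω) (hb : 0 ≤ b) :
    Integrable (fun ω => truncAt b (Y ω)) P :=
  Integrable.of_bound ((measurable_truncAt b).comp hY).aestronglyMeasurable b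
    (Eventually.of_forall fun ω => by
      rw [Real.norm_eq_abs, abs_of_nonneg (truncAt_nonneg (hY0 ω))]; exact truncAt_le hb)

lemma integrable_of_integrable_rpow (hY : Measurable Y) (hY0 : ∀ ω, 0 ≤ Y ω) (hp : 1 ≤ p)
    (hint : Integrable (fun ω => Y ω ^ p) P) : Integrable Y P := by
  refine Integrable.mono' ((integrable_const (1 : ℝ)).add hint) hY.aestronglyMeasurable
    (Eventually.of_forall fun ω => ?_)
  rw [Real.norm_eq_abs, abs_of_nonneg (hY0 ω)]
  have h1 := sub_truncAt_le one_pos (hY0 ω) hp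
  have h2 := truncAt_le (x := Y ω) zero_le_one
  rw [Real.one_rpow, one_mul] at h1
  simp only [Pi.add_apply]
  linarith

lemma integral_truncAt_sq_le (hY : Measurable Y) (hY0 : ∀ ω, 0 ≤ Y ω) (hb : 0 < b) (hp2 : p ≤ 2)
    (hint : Integrable (fun ω => Y ω ^ p) P) :
    ∫ ω, (truncAt b (Y ω) - ∫ ω', truncAt b (Y ω') ∂P) ^ 2 ∂P ≤
      b ^ (2 - p) * ∫ ω, Y ω ^ p ∂P := by
  have hm : AEMeasurable (fun ω => truncAt b (Y ω)) P :=
    ((measurable_truncAt b).comp hY).aemeasurable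
  have h1 := variance_le_expectation_sq (μ := P) hm.aestronglyMeasurable
  rw [variance_eq_integral hm] at h1
  refine h1.trans ?_
  rw [← integral_const_mul]
  refine integral_mono_of_nonneg (Eventually.of_forall fun ω => sq_nonneg _) (hint.const_mul _)
    (Eventually.of_forall fun ω => truncAt_sq_le hb (hY0 ω) hp2)

lemma integral_sub_integral_truncAt_mem (hY : Measurable Y) (hY0 : ∀ ω, 0 ≤ Y ω) (hb : 0 < b)
    (hp : 1 ≤ p) (hint : Integrable (fun ω => Y ω ^ p) P) :
    ∫ ω, Y ω ∂P - ∫ ω, truncAt b (Y ω) ∂P ∈ Icc 0 (b ^ (1 - p) * ∫ ω, Y ω ^ p ∂P) := by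
  have hi := integrable_of_integrable_rpow hY hY0 hp hint
  have hi' := integrable_truncAt (P := P) hY hY0 hb.le
  rw [← integral_sub hi hi', ← integral_const_mul]
  exact ⟨integral_nonneg fun ω => sub_nonneg.2 (truncAt_le_self (hY0 ω)),
    integral_mono (hi.sub hi') (hint.const_mul _) fun ω => sub_truncAt_le hb (hY0 ω) hp⟩

end

lemma tendsto_log_sq_mul_rpow_neg {s : ℝ} (hs : 0 < s) :
    Tendsto (fun n : ℕ => Real.log n ^ 2 * (n : ℝ) ^ (-s)) atTop (𝓝 0) := by
  have h := (isLittleO_log_rpow_rpow_atTop 2 hs).tendsto_div_nhds_zero.comp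
    tendsto_natCast_atTop_atTop
  refine h.congr' ?_
  filter_upwards with n
  simp [Real.rpow_neg, div_eq_mul_inv]

/-- Truncated at a small multiple of `n`, the random walk deviates from its mean by a fixed
multiple of `n` only with a probability of small polynomial order. -/
lemma exists_truncation_level {Ω : Type*} [MeasurableSpace Ω] {P : Measure Ω}
    [IsProbabilityMeasure P] {A : ℕ → Ω → ℝ} (hA : ∀ i, Measurable (A i)) (hA0 : ∀ i ω, 0 ≤ A i ω)
    (hind : iIndepFun A P) (hident : ∀ i, IdentDistrib (A i) (A 0) P P) {p : ℝ} (hp : 1 < p)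
    (hp2 : p ≤ 2) (hint : Integrable (fun ω => A 0 ω ^ p) P) {M ε : ℝ} (hM : 0 < M) (hε : 0 < ε)
    (q : ℕ) : ∃ δ₀ > 0, ∀ δ, 0 < δ → δ ≤ δ₀ → ∀ᶠ n : ℕ in atTop,
      P.real {ω | ∃ k ≤ ⌊n * M⌋₊, n * ε <
        |∑ i ∈ Finset.range k, (truncAt (n * δ) (A i ω) - ∫ ω', A 0 ω' ∂P)|} ≤
        ((n : ℝ) ^ q)⁻¹ := by
  -- Of the two additional powers, one pays for the union over about `n * M` partial sums and the
  -- other for the constants.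
  set Q : ℝ := q + 2 with hQ
  have hQ0 : 0 < Q := by positivity
  -- For `δ` up to this value the factor `exp (l * b)` in Chernoff's bound, with `l` as chosen
  -- below, is at most `n ^ ((p - 1) / 2)`.
  refine ⟨ε * (p - 1) / (4 * Q), by have : 0 < p - 1 := by linarith
                                    positivity, fun δ hδ hδ' => ?_⟩
  set V := ∫ ω, A 0 ω ^ p ∂P with hV
  have hV0 : 0 ≤ V := integral_nonneg fun ω => Real.rpow_nonneg (hA0 0 ω) p
  have e1 : ∀ᶠ n : ℕ in atTop, M * (2 * Q / ε) ^ 2 * δ ^ (2 - p) * V *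
      (Real.log n ^ 2 * (n : ℝ) ^ (-((p - 1) / 2))) ≤ 1 := by
    have := (tendsto_log_sq_mul_rpow_neg (by linarith : 0 < (p - 1) / 2)).const_mul
      (M * (2 * Q / ε) ^ 2 * δ ^ (2 - p) * V)
    rw [mul_zero] at this
    exact this.eventually (ge_mem_nhds one_pos)
  have e2 : ∀ᶠ n : ℕ in atTop, M * (δ ^ (1 - p) * V) * (n : ℝ) ^ (-(p - 1)) ≤ ε / 2 := by
    have := ((tendsto_rpow_neg_atTop (by linarith : 0 < p - 1)).comp
      tendsto_natCast_atTop_atTop).const_mul (M * (δ ^ (1 - p) * V))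
    rw [mul_zero] at this
    exact this.eventually (ge_mem_nhds (by linarith))
  have e3 : ∀ᶠ n : ℕ in atTop, (M + 1) * 2 * Real.exp 1 ≤ n :=
    tendsto_natCast_atTop_atTop.eventually_ge_atTop _
  filter_upwards [e1, e2, e3, eventually_ge_atTop 1] with n h1 h2 h3 hn
  have hn1 : (1 : ℝ) ≤ n := by exact_mod_cast hn
  have hn0 : (0 : ℝ) < n := by linarith
  set b := n * δ with hb
  have hb0 : 0 < b := by positivity
  set c := ∫ ω, truncAt b (A 0 ω) ∂P with hc
  have hcb : c ∈ Icc 0 b := by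
    refine ⟨integral_nonneg fun ω => truncAt_nonneg (hA0 0 ω), ?_⟩
    calc c ≤ ∫ _, b ∂P := integral_mono (integrable_truncAt (hA 0) (hA0 0) hb0.le)
          (integrable_const b) fun ω => truncAt_le hb0.le
      _ = b := by simp
  let Y : ℕ → Ω → ℝ := fun i ω => truncAt b (A i ω) - c
  have hYm : ∀ i, Measurable (Y i) := fun i => ((measurable_truncAt b).comp (hA i)).sub_const c
  have hYind : iIndepFun Y P :=
    hind.comp (fun _ x => truncAt b x - c) fun _ => (measurable_truncAt b).sub_const c
  have hYb : ∀ i ω, |Y i ω| ≤ b := fun i ω => by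
    have h4 := truncAt_nonneg (b := b) (hA0 i ω)
    have h5 := truncAt_le (x := A i ω) hb0.le
    rw [abs_le]
    constructor <;> simp only [Y] <;> linarith [hcb.1, hcb.2]
  have hid : ∀ (g : ℝ → ℝ), Measurable g → ∀ i, ∫ ω, g (A i ω) ∂P = ∫ ω, g (A 0 ω) ∂P :=
    fun g hg i => ((hident i).comp hg).integral_eq
  have hYmean : ∀ i, ∫ ω, Y i ω ∂P = 0 := fun i => by
    simp only [Y]
    rw [integral_sub (integrable_truncAt (hA i) (hA0 i) hb0.le) (integrable_const c),
      hid _ (measurable_truncAt b) i]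
    simp [← hc]
  have hYvar : ∀ i, ∫ ω, Y i ω ^ 2 ∂P ≤ b ^ (2 - p) * V := fun i => by
    refine le_trans (le_of_eq ?_) (integral_truncAt_sq_le (hA 0) (hA0 0) hb0 hp2 hint)
    exact hid (fun x => (truncAt b x - c) ^ 2) (((measurable_truncAt b).sub_const c).pow_const 2) i
  -- With this choice `exp (-l * (n * ε / 2))` equals `n ^ (-Q)`. The variance term has order `log n
  -- ^ 2 * n ^ (-(p - 1) / 2)` and is at most `1` for large `n`.
  set l := 2 * Q * Real.log n / (n * ε) with hl
  have hlog : 0 ≤ Real.log n := Real.log_nonneg hn1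
  have hl0 : 0 ≤ l := by positivity
  have hlb : Real.exp (l * b) ≤ (n : ℝ) ^ ((p - 1) / 2) := by
    rw [Real.rpow_def_of_pos hn0, Real.exp_le_exp]
    have h4 : l * b = 2 * Q / ε * δ * Real.log n := by
      rw [hl, hb]; field_simp
    have h5 : 2 * Q / ε * δ ≤ (p - 1) / 2 := by
      calc 2 * Q / ε * δ ≤ 2 * Q / ε * (ε * (p - 1) / (4 * Q)) := by gcongr
        _ = _ := by field_simp; ring
    rw [h4, mul_comm]
    exact mul_le_mul_of_nonneg_left h5 hlog
  have hN : (⌊n * M⌋₊ : ℝ) ≤ n * M := Nat.floor_le (by positivity)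
  have hexp : ∀ k ≤ ⌊n * M⌋₊, Real.exp (-l * (n * ε / 2) +
      k * (l ^ 2 * (b ^ (2 - p) * V) * Real.exp (l * b))) ≤ Real.exp 1 * (n : ℝ) ^ (-Q) := by
    intro k hk
    have hk' : (k : ℝ) ≤ n * M := le_trans (by exact_mod_cast hk) hN
    rw [Real.rpow_def_of_pos hn0, ← Real.exp_add, Real.exp_le_exp]
    have h4 : -l * (n * ε / 2) = Real.log n * -Q := by rw [hl]; field_simp
    have h5 : k * (l ^ 2 * (b ^ (2 - p) * V) * Real.exp (l * b)) ≤ 1 := by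
      refine le_trans ?_ h1
      calc k * (l ^ 2 * (b ^ (2 - p) * V) * Real.exp (l * b))
          ≤ (n * M) * (l ^ 2 * (b ^ (2 - p) * V) * (n : ℝ) ^ ((p - 1) / 2)) := by gcongr
        _ = M * (2 * Q / ε) ^ 2 * δ ^ (2 - p) * V * (Real.log n ^ 2 *
            ((n : ℝ) ^ (1 : ℝ) * (n : ℝ) ^ (-2 : ℝ) * (n : ℝ) ^ (2 - p) *
              (n : ℝ) ^ ((p - 1) / 2))) := by
          rw [hb, Real.mul_rpow hn0.le hδ.le, hl, Real.rpow_one, Real.rpow_neg hn0.le,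
            Real.rpow_two]
          field_simp
        _ = _ := by
          rw [← Real.rpow_add hn0, ← Real.rpow_add hn0, ← Real.rpow_add hn0]
          ring_nf
    linarith
  have hup : ∀ k ≤ ⌊n * M⌋₊, P.real {ω | n * ε / 2 ≤ ∑ i ∈ Finset.range k, Y i ω} ≤
      Real.exp 1 * (n : ℝ) ^ (-Q) := fun k hk =>
    (measureReal_sum_ge_le hYm hYind hYb hYmean hYvar hl0 k _).trans (hexp k hk)
  have hlow : ∀ k ≤ ⌊n * M⌋₊, P.real {ω | n * ε / 2 ≤ ∑ i ∈ Finset.range k, -Y i ω} ≤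
      Real.exp 1 * (n : ℝ) ^ (-Q) := fun k hk =>
    (measureReal_sum_ge_le (Y := fun i ω => -Y i ω) (fun i => (hYm i).neg)
      (hYind.comp (fun _ x => -x) fun _ => measurable_neg)
      (fun i ω => by rw [abs_neg]; exact hYb i ω)
      (fun i => by rw [integral_neg, hYmean, neg_zero]) (fun i => by simpa using hYvar i)
      hl0 k _).trans (hexp k hk)
  have hsub : {ω | ∃ k ≤ ⌊n * M⌋₊, n * ε <
        |∑ i ∈ Finset.range k, (truncAt b (A i ω) - ∫ ω', A 0 ω' ∂P)|} ⊆
      ⋃ k ∈ Finset.range (⌊n * M⌋₊ + 1), ({ω | n * ε / 2 ≤ ∑ i ∈ Finset.range k, Y i ω} ∪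
        {ω | n * ε / 2 ≤ ∑ i ∈ Finset.range k, -Y i ω}) := by
    rintro ω ⟨k, hk, hlt⟩
    refine mem_iUnion₂.2 ⟨k, Finset.mem_range.2 (by omega), ?_⟩
    have hk' : (k : ℝ) ≤ n * M := le_trans (by exact_mod_cast hk) hN
    obtain ⟨h4, h5⟩ := integral_sub_integral_truncAt_mem (P := P) (hA 0) (hA0 0) hb0 hp.le hint
    rw [← hc, ← hV] at h5
    rw [← hc] at h4
    set m := ∫ ω', A 0 ω' ∂P
    have h6 : ∑ i ∈ Finset.range k, (truncAt b (A i ω) - m) =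
        ∑ i ∈ Finset.range k, Y i ω - k * (m - c) := by
      rw [eq_sub_iff_add_eq, ← nsmul_eq_mul, ← Finset.card_range k, ← Finset.sum_const,
        Finset.card_range, ← Finset.sum_add_distrib]
      exact Finset.sum_congr rfl fun i _ => by simp only [Y]; ring
    -- The shift of the mean caused by truncation uses up half of the allowed deviation; the
    -- fluctuations have the other half.
    have h7 : k * (m - c) ≤ n * (ε / 2) := by
      calc k * (m - c) ≤ (n * M) * (b ^ (1 - p) * V) := by gcongr
        _ = n * (M * (δ ^ (1 - p) * V) * (n : ℝ) ^ (-(p - 1))) := by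
          rw [hb, Real.mul_rpow hn0.le hδ.le, neg_sub]; ring
        _ ≤ _ := by gcongr
    have h8 : 0 ≤ k * (m - c) := by positivity
    rw [h6, lt_abs] at hlt
    rcases hlt with hlt | hlt
    · left; rw [mem_ofPred_eq]; nlinarith
    · right; rw [mem_ofPred_eq, Finset.sum_neg_distrib]; linarith
  calc _ ≤ P.real (⋃ k ∈ Finset.range (⌊n * M⌋₊ + 1),
        ({ω | n * ε / 2 ≤ ∑ i ∈ Finset.range k, Y i ω} ∪
        {ω | n * ε / 2 ≤ ∑ i ∈ Finset.range k, -Y i ω})) :=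
          measureReal_mono hsub (measure_ne_top _ _)
    _ ≤ ∑ k ∈ Finset.range (⌊n * M⌋₊ + 1), (Real.exp 1 * (n : ℝ) ^ (-Q) +
        Real.exp 1 * (n : ℝ) ^ (-Q)) := by
      refine (measureReal_biUnion_finset_le _ _).trans (Finset.sum_le_sum fun k hk => ?_)
      have hk' : k ≤ ⌊n * M⌋₊ := by have := Finset.mem_range.1 hk; omega
      exact (measureReal_union_le _ _).trans (add_le_add (hup k hk') (hlow k hk'))
    _ = (⌊n * M⌋₊ + 1) * (2 * Real.exp 1 * (n : ℝ) ^ (-Q)) := by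
      rw [Finset.sum_const, Finset.card_range, nsmul_eq_mul]; push_cast; ring
    _ ≤ (n * (M + 1)) * (2 * Real.exp 1 * (n : ℝ) ^ (-Q)) := by
      gcongr; linarith
    _ = ((M + 1) * 2 * Real.exp 1) * n * (n : ℝ) ^ (-Q) := by ring
    _ ≤ n * n * (n : ℝ) ^ (-Q) := by gcongr
    _ = ((n : ℝ) ^ q)⁻¹ := by
      rw [hQ, neg_add, Real.rpow_add hn0, Real.rpow_neg hn0.le, Real.rpow_neg hn0.le,
        Real.rpow_natCast, Real.rpow_two]
      field_simp

end

noncomputable section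

/-! ### Convergence of the normalized law of a large jump -/

lemma nuMeasure_Ioi {α x : ℝ} (hα : 0 < α) (hx : 0 < x) :
    nuMeasure α (Ioi x) = ENNReal.ofReal (x ^ (-α)) := by
  rw [nuMeasure, withDensity_apply _ measurableSet_Ioi,
    Measure.restrict_restrict measurableSet_Ioi,
    inter_eq_left.2 (Ioi_subset_Ioi hx.le), ← ofReal_integral_eq_lintegral_ofReal]
  · rw [integral_const_mul, integral_Ioi_rpow_of_lt (by linarith) hx]
    congr 1
    rw [show -α - 1 + 1 = -α by ring]
    field_simp
  · exact (integrableOn_Ioi_rpow_of_lt (by linarith) hx).const_mul α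
  · filter_upwards [self_mem_ae_restrict measurableSet_Ioi] with t ht
    have : 0 < t := hx.trans ht
    change 0 ≤ α * t ^ (-α - 1)
    positivity

lemma nuMeasure_Iic_zero (α : ℝ) : nuMeasure α (Iic 0) = 0 := by
  rw [nuMeasure, withDensity_apply _ measurableSet_Iic,
    Measure.restrict_restrict measurableSet_Iic, Iic_inter_Ioi, Ioc_self]
  simp

instance (α : ℝ) : SigmaFinite (nuMeasure α) := by
  unfold nuMeasure; exact SigmaFinite.withDensity_ofReal _

/-- The law of the scaled jump `A / n`, restricted to jumps larger than `δ`. -/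
def bigJumpLaw (ρ : Measure ℝ) (δ : ℝ) (n : ℕ) : Measure ℝ :=
  (ρ.map fun x : ℝ => x / (n : ℝ)).restrict (Ioi δ)

instance (ρ : Measure ℝ) [IsFiniteMeasure ρ] (δ : ℝ) (n : ℕ) :
    IsFiniteMeasure (bigJumpLaw ρ δ n) := by unfold bigJumpLaw; infer_instance

lemma bigJumpLaw_Ioi {ρ : Measure ℝ} {δ : ℝ} {n : ℕ} (hn : 1 ≤ n) (a : ℝ) :
    bigJumpLaw ρ δ n (Ioi a) = ρ (Ioi (n * max a δ)) := by
  have hn0 : (0 : ℝ) < n := by exact_mod_cast hn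
  rw [bigJumpLaw, Measure.restrict_apply measurableSet_Ioi, Ioi_inter_Ioi,
    Measure.map_apply (by fun_prop) measurableSet_Ioi]
  congr 1
  ext x
  simp only [mem_preimage, mem_Ioi]
  rw [lt_div_iff₀ hn0, mul_comm]

section

variable {ρ : Measure ℝ} {α δ : ℝ}

lemma tendsto_tail_ratio (hRV : RegularlyVarying (-α) fun t => ρ.real (Ioi t)) {x : ℝ}
    (hx : 0 < x) : Tendsto (fun n : ℕ => ρ.real (Ioi (n * x)) / ρ.real (Ioi (n : ℝ))) atTop
      (𝓝 (x ^ (-α))) :=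
  (hRV x hx).comp tendsto_natCast_atTop_atTop

variable [IsProbabilityMeasure ρ]

lemma tail_antitone : Antitone fun t => ρ.real (Ioi t) := fun _ _ h =>
  measureReal_mono (Ioi_subset_Ioi h)

lemma tail_pos (hRV : RegularlyVarying (-α) fun t => ρ.real (Ioi t)) (t : ℝ) :
    0 < ρ.real (Ioi t) :=
  hRV.pos tail_antitone (fun _ => measureReal_nonneg) t

lemma pi_smul_const {ι : Type*} [Fintype ι] (μ : Measure ℝ) [SigmaFinite μ] (c : ℝ≥0∞)
    (hc : c ≠ ∞) :
    Measure.pi (fun _ : ι => c • μ) = c ^ Fintype.card ι • Measure.pi fun _ : ι => μ := by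
  have : SigmaFinite (c • μ) := by
    lift c to NNReal using hc
    exact inferInstanceAs (SigmaFinite (c • μ))
  refine Measure.pi_eq fun s hs => ?_
  simp [Measure.pi_pi, Finset.prod_mul_distrib]

/-- The conditional laws of a scaled large jump converge weakly to a Pareto distribution. -/
lemma tendsto_bigJumpLaw (hα : 0 < α) (hRV : RegularlyVarying (-α) fun t => ρ.real (Ioi t))
    (hδ : 0 < δ) {π : ℕ → ProbabilityMeasure ℝ} {π' : ProbabilityMeasure ℝ}
    (hπ : ∀ n, 1 ≤ n → (π n : Measure ℝ) =
      (ENNReal.ofReal (ρ.real (Ioi (n * δ))))⁻¹ • bigJumpLaw ρ δ n)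
    (hπ' : (π' : Measure ℝ) =
      (ENNReal.ofReal (δ ^ (-α)))⁻¹ • (nuMeasure α).restrict (Ioi δ)) :
    Tendsto π atTop (𝓝 π') := by
  have hIoi : ∀ a, Tendsto (fun n => (π n : Measure ℝ).real (Ioi a)) atTop
      (𝓝 ((π' : Measure ℝ).real (Ioi a))) := by
    intro a
    have hm : 0 < max a δ := hδ.trans_le (le_max_right _ _)
    have h1 : (π' : Measure ℝ).real (Ioi a) = (max a δ) ^ (-α) / δ ^ (-α) := by
      rw [measureReal_def, hπ', Measure.smul_apply, Measure.restrict_apply measurableSet_Ioi,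
        Ioi_inter_Ioi, smul_eq_mul, ENNReal.toReal_mul, ENNReal.toReal_inv]
      change _ * ((nuMeasure α) (Ioi (max a δ))).toReal = _
      rw [nuMeasure_Ioi hα hm, ENNReal.toReal_ofReal (by positivity),
        ENNReal.toReal_ofReal (by positivity)]
      field_simp
    rw [h1]
    have h2 := (tendsto_tail_ratio hRV hm).div (tendsto_tail_ratio hRV hδ) (by positivity)
    refine h2.congr' ?_
    filter_upwards [eventually_ge_atTop 1] with n hn
    rw [measureReal_def, hπ n hn, Measure.smul_apply, bigJumpLaw_Ioi hn, smul_eq_mul,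
      ENNReal.toReal_mul, ENNReal.toReal_inv, ENNReal.toReal_ofReal measureReal_nonneg,
      ← measureReal_def]
    have h3 := tail_pos hRV (n : ℝ)
    have h4 := tail_pos hRV (n * δ)
    simp only [Pi.div_apply]
    field_simp
  refine (isPiSystem_Ioc (id : ℝ → ℝ) id).tendsto_probabilityMeasure_of_tendsto_of_mem ?_ ?_ ?_
  · rintro s ⟨a, b, -, rfl⟩
    exact measurableSet_Ioc
  · intro u hu x hx
    obtain ⟨ε, hε, h⟩ := Metric.isOpen_iff.1 hu x hx
    refine ⟨Ioc (x - ε / 2) (x + ε / 2), ⟨_, _, by simp only [id]; linarith, rfl⟩,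
      Ioc_mem_nhds (by linarith) (by linarith), fun y hy => h ?_⟩
    rw [Metric.mem_ball, Real.dist_eq, abs_lt]
    constructor <;> linarith [hy.1, hy.2]
  · rintro s ⟨a, b, hab, rfl⟩
    simp only [id] at hab ⊢
    have h1 : ∀ μ : ProbabilityMeasure ℝ, ((μ (Ioc a b) : NNReal) : ℝ) =
        (μ : Measure ℝ).real (Ioi a) - (μ : Measure ℝ).real (Ioi b) := fun μ => by
      rw [← measureReal_sdiff (Ioi_subset_Ioi hab.le) measurableSet_Ioi, Ioi_sdiff_Ioi]
      rfl
    rw [← NNReal.tendsto_coe]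
    simp only [h1]
    exact (hIoi a).sub (hIoi b)

/-- Portmanteau bounds for the product of the normalized laws of large jumps. -/
lemma bigJumpLaw_pi_bounds (hα : 0 < α)
    (hRV : RegularlyVarying (-α) fun t => ρ.real (Ioi t)) (hδ : 0 < δ) (j : ℕ) :
    (∀ F : Set (Fin j → ℝ), IsClosed F →
      limsup (fun n : ℕ => (ENNReal.ofReal (ρ.real (Ioi (n : ℝ))))⁻¹ ^ j *
        Measure.pi (fun _ : Fin j => bigJumpLaw ρ δ n) F) atTop ≤
        Measure.pi (fun _ : Fin j => (nuMeasure α).restrict (Ioi δ)) F) ∧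
    (∀ G : Set (Fin j → ℝ), IsOpen G →
      Measure.pi (fun _ : Fin j => (nuMeasure α).restrict (Ioi δ)) G ≤
      liminf (fun n : ℕ => (ENNReal.ofReal (ρ.real (Ioi (n : ℝ))))⁻¹ ^ j *
        Measure.pi (fun _ : Fin j => bigJumpLaw ρ δ n) G) atTop) := by
  set f : ℕ → ℝ≥0∞ := fun n => ENNReal.ofReal (ρ.real (Ioi (n : ℝ))) with hf
  set fδ : ℕ → ℝ≥0∞ := fun n => ENNReal.ofReal (ρ.real (Ioi ((n : ℝ) * δ))) with hfδ
  set c : ℝ≥0∞ := ENNReal.ofReal (δ ^ (-α)) with hc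
  have hf0 : ∀ n, f n ≠ 0 := fun n =>
    (ENNReal.ofReal_pos.2 (tail_pos hRV _)).ne'
  have hfδ0 : ∀ n, fδ n ≠ 0 := fun n =>
    (ENNReal.ofReal_pos.2 (tail_pos hRV _)).ne'
  have hfT : ∀ n, f n ≠ ∞ := fun n => ENNReal.ofReal_ne_top
  have hfδT : ∀ n, fδ n ≠ ∞ := fun n => ENNReal.ofReal_ne_top
  have hc0 : c ≠ 0 := by simp only [hc, ne_eq, ENNReal.ofReal_eq_zero, not_le]; positivity
  have hcT : c ≠ ∞ := ENNReal.ofReal_ne_top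
  have hprob : ∀ n : ℕ, IsProbabilityMeasure ((fδ (n + 1))⁻¹ • bigJumpLaw ρ δ (n + 1)) := by
    intro n
    refine ⟨?_⟩
    rw [Measure.smul_apply, bigJumpLaw, Measure.restrict_apply_univ, smul_eq_mul]
    have := bigJumpLaw_Ioi (ρ := ρ) (δ := δ) (n := n + 1) (by omega) δ
    rw [bigJumpLaw, Measure.restrict_apply measurableSet_Ioi, inter_self, max_self] at this
    rw [this, ← ofReal_measureReal (measure_ne_top _ _)]
    exact ENNReal.inv_mul_cancel (hfδ0 (n + 1)) (hfδT (n + 1))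
  have hprob' : IsProbabilityMeasure (c⁻¹ • (nuMeasure α).restrict (Ioi δ)) := by
    refine ⟨?_⟩
    rw [Measure.smul_apply, Measure.restrict_apply_univ, nuMeasure_Ioi hα hδ, smul_eq_mul]
    exact ENNReal.inv_mul_cancel hc0 hcT
  let π' : ProbabilityMeasure ℝ := ⟨_, hprob'⟩
  let π : ℕ → ProbabilityMeasure ℝ := fun n => match n with
    | 0 => π'
    | n + 1 => ⟨_, hprob n⟩
  have hπ : ∀ n, 1 ≤ n → (π n : Measure ℝ) = (fδ n)⁻¹ • bigJumpLaw ρ δ n := by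
    intro n hn
    obtain ⟨k, rfl⟩ := Nat.exists_eq_add_of_le' hn
    rfl
  have hlim : Tendsto π atTop (𝓝 π') := tendsto_bigJumpLaw hα hRV hδ hπ rfl
  have hlimpi : Tendsto (fun n => ProbabilityMeasure.pi fun _ : Fin j => π n) atTop
      (𝓝 (ProbabilityMeasure.pi fun _ : Fin j => π')) :=
    (ProbabilityMeasure.continuous_pi.tendsto (fun _ : Fin j => π')).comp
      (tendsto_pi_nhds.2 fun _ => hlim)
  have hfin : IsFiniteMeasure ((nuMeasure α).restrict (Ioi δ)) :=
    ⟨by rw [Measure.restrict_apply_univ, nuMeasure_Ioi hα hδ]; exact ENNReal.ofReal_lt_top⟩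
  have e1 : ∀ n, 1 ≤ n → ∀ S : Set (Fin j → ℝ), (f n)⁻¹ ^ j *
      Measure.pi (fun _ : Fin j => bigJumpLaw ρ δ n) S =
      ((f n)⁻¹ * fδ n) ^ j *
        (ProbabilityMeasure.pi fun _ : Fin j => π n : ProbabilityMeasure _).toMeasure S := by
    intro n hn S
    rw [ProbabilityMeasure.toMeasure_pi]
    simp only [hπ n hn]
    rw [pi_smul_const _ _ (ENNReal.inv_ne_top.2 (hfδ0 n)), Measure.smul_apply, Fintype.card_fin,
      smul_eq_mul, ← mul_assoc, mul_pow, mul_assoc (_ ^ j), ← mul_pow,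
      ENNReal.mul_inv_cancel (hfδ0 n) (hfδT n), one_pow, mul_one]
  have e2 : ∀ S : Set (Fin j → ℝ),
      Measure.pi (fun _ : Fin j => (nuMeasure α).restrict (Ioi δ)) S =
      c ^ j * (ProbabilityMeasure.pi fun _ : Fin j => π' : ProbabilityMeasure _).toMeasure S := by
    intro S
    rw [ProbabilityMeasure.toMeasure_pi]
    change _ = c ^ j * Measure.pi (fun _ : Fin j => c⁻¹ • (nuMeasure α).restrict (Ioi δ)) S
    rw [pi_smul_const _ _ (ENNReal.inv_ne_top.2 hc0), Measure.smul_apply, Fintype.card_fin,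
      smul_eq_mul, ← mul_assoc, ← mul_pow, ENNReal.mul_inv_cancel hc0 hcT, one_pow, one_mul]
  -- Weak convergence concerns laws normalized by the tail at `nδ`; this limit converts to the tail
  -- at `n` that occurs in the rate.
  have hratio : Tendsto (fun n => ((f n)⁻¹ * fδ n) ^ j) atTop (𝓝 (c ^ j)) := by
    refine ENNReal.Tendsto.pow ?_
    have := ENNReal.tendsto_ofReal (tendsto_tail_ratio hRV hδ)
    refine this.congr fun n => ?_
    rw [ENNReal.ofReal_div_of_pos (tail_pos hRV _), div_eq_mul_inv, mul_comm]
  have hcj : c ^ j ≠ 0 := pow_ne_zero _ hc0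
  have hcjT : c ^ j ≠ ∞ := ENNReal.pow_ne_top hcT
  constructor
  · intro F hF
    have h1 := ProbabilityMeasure.limsup_measure_closed_le_of_tendsto hlimpi hF
    rw [e2]
    calc _ = limsup (fun n => ((f n)⁻¹ * fδ n) ^ j * (ProbabilityMeasure.pi
            fun _ : Fin j => π n : ProbabilityMeasure _).toMeasure F) atTop :=
          limsup_congr (by filter_upwards [eventually_ge_atTop 1] with n hn using e1 n hn F)
      _ ≤ limsup (fun n => ((f n)⁻¹ * fδ n) ^ j) atTop * limsup (fun n =>
            (ProbabilityMeasure.pi fun _ : Fin j => π n : ProbabilityMeasure _).toMeasure F)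
              atTop := ENNReal.limsup_mul_le' (by rw [hratio.limsup_eq]; exact Or.inl hcj)
                (by rw [hratio.limsup_eq]; exact Or.inl hcjT)
      _ ≤ _ := by rw [hratio.limsup_eq]; gcongr
  · intro G hG
    have h1 := ProbabilityMeasure.le_liminf_measure_open_of_tendsto hlimpi hG
    rw [e2]
    calc _ ≤ liminf (fun n => ((f n)⁻¹ * fδ n) ^ j) atTop * liminf (fun n =>
            (ProbabilityMeasure.pi fun _ : Fin j => π n : ProbabilityMeasure _).toMeasure G)
              atTop := by rw [hratio.liminf_eq]; gcongr
      _ ≤ liminf (fun n => ((f n)⁻¹ * fδ n) ^ j * (ProbabilityMeasure.pi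
            fun _ : Fin j => π n : ProbabilityMeasure _).toMeasure G) atTop :=
          ENNReal.le_liminf_mul
      _ = _ := liminf_congr (by
          filter_upwards [eventually_ge_atTop 1] with n hn using (e1 n hn G).symm)

end

end

noncomputable section

/-! ### Lattice sums over ordered times -/

/-- The cell of side `1 / n` whose upper corner is `(g k + 1) / n`. -/
def latticeCell (n : ℕ) {j N : ℕ} (g : Fin j → Fin N) : Set (Fin j → ℝ) :=
  univ.pi fun k => Ioc ((g k : ℝ) / n) (((g k : ℝ) + 1) / n)

/-- The point `(g k + 1) / n`. -/
def latticePoint (n : ℕ) {j N : ℕ} (g : Fin j → Fin N) : Fin j → ℝ := fun k => ((g k : ℝ) + 1) / n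

open Classical in
/-- The strictly increasing maps. -/
def strictMonoMaps (j N : ℕ) : Finset (Fin j → Fin N) := Finset.univ.filter StrictMono

section lattice

variable {n j N : ℕ} {M : ℝ}

lemma mem_strictMonoMaps {g : Fin j → Fin N} : g ∈ strictMonoMaps j N ↔ StrictMono g := by
  simp [strictMonoMaps]

lemma card_strictMonoMaps_le : (strictMonoMaps j N).card ≤ N ^ j := by
  refine (Finset.card_le_univ _).trans ?_
  simp

lemma measurableSet_latticeCell (g : Fin j → Fin N) : MeasurableSet (latticeCell n g) :=
  MeasurableSet.univ_pi fun _ => measurableSet_Ioc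

lemma volume_latticeCell (hn : 1 ≤ n) (g : Fin j → Fin N) :
    volume (latticeCell n g) = ((n : ℝ≥0∞) ^ j)⁻¹ := by
  rw [latticeCell, volume_pi_pi]
  have : ∀ k, volume (Ioc ((g k : ℝ) / n) (((g k : ℝ) + 1) / n)) = (n : ℝ≥0∞)⁻¹ := fun k => by
    rw [Real.volume_Ioc, ← sub_div, add_sub_cancel_left, one_div]
    rw [ENNReal.ofReal_inv_of_pos (by exact_mod_cast hn), ENNReal.ofReal_natCast]
  simp only [this, Finset.prod_const, Finset.card_univ, Fintype.card_fin, ENNReal.inv_pow]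

lemma strictMono_latticePoint (hn : 1 ≤ n) {g : Fin j → Fin N} (hg : StrictMono g) :
    StrictMono (latticePoint n g) := fun a b hab => by
  have hn0 : (0 : ℝ) < n := by exact_mod_cast hn
  have : (g a : ℝ) < g b := by exact_mod_cast hg hab
  unfold latticePoint
  gcongr

lemma latticeCell_subset (hn : 1 ≤ n) (hM : 0 ≤ M) {g : Fin j → Fin ⌊n * M⌋₊}
    (hg : StrictMono g) : latticeCell n g ⊆ orderedTimes M j := by
  have hn0 : (0 : ℝ) < n := by exact_mod_cast hn
  intro u hu
  have hu' : ∀ k, u k ∈ Ioc ((g k : ℝ) / n) (((g k : ℝ) + 1) / n) := fun k => hu k (mem_univ k)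
  refine ⟨fun k => ⟨le_trans (by positivity) (hu' k).1.le, (hu' k).2.trans ?_⟩, fun a b hab => ?_⟩
  · rw [div_le_iff₀ hn0, mul_comm M]
    refine le_trans ?_ (Nat.floor_le (by positivity))
    exact_mod_cast (g k).2
  · refine (hu' a).2.trans_lt (lt_of_le_of_lt ?_ (hu' b).1)
    have : (g a : ℝ) + 1 ≤ g b := by exact_mod_cast hg hab
    gcongr

lemma abs_sub_latticePoint_le {g : Fin j → Fin N} {u : Fin j → ℝ} (hu : u ∈ latticeCell n g)
    (k : Fin j) : |u k - latticePoint n g k| ≤ 1 / n := by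
  have h := hu k (mem_univ k)
  rw [mem_Ioc, add_div] at h
  rw [latticePoint, add_div, abs_le]
  constructor <;> linarith [h.1, h.2, one_div_nonneg.2 (Nat.cast_nonneg (α := ℝ) n)]

lemma eq_of_mem_latticeCell (hn : 1 ≤ n) {g g' : Fin j → Fin N} {u : Fin j → ℝ}
    (hu : u ∈ latticeCell n g) (hu' : u ∈ latticeCell n g') : g = g' := by
  have hn0 : (0 : ℝ) < n := by exact_mod_cast hn
  funext k
  have h := hu k (mem_univ k)
  have h' := hu' k (mem_univ k)
  have h1 : (g k : ℝ) < g' k + 1 := (div_lt_div_iff_of_pos_right hn0).1 (h.1.trans_le h'.2)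
  have h2 : (g' k : ℝ) < g k + 1 := (div_lt_div_iff_of_pos_right hn0).1 (h'.1.trans_le h.2)
  have h3 : (g k : ℕ) < g' k + 1 := by exact_mod_cast h1
  have h4 : (g' k : ℕ) < g k + 1 := by exact_mod_cast h2
  exact Fin.ext (by omega)

lemma exists_mem_latticeCell {u : Fin j → ℝ} (hu : StrictMono u) (h0 : ∀ k, 0 < u k)
    (hM : ∀ k, u k < M) :
    ∀ᶠ n : ℕ in atTop, ∃ g ∈ strictMonoMaps j ⌊n * M⌋₊, u ∈ latticeCell n g := by
  have e1 : ∀ᶠ n : ℕ in atTop, ∀ k, u k * n + 1 < n * M := by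
    refine eventually_all.2 fun k => ?_
    have : Tendsto (fun n : ℕ => (M - u k) * (n : ℝ)) atTop atTop :=
      tendsto_natCast_atTop_atTop.const_mul_atTop (sub_pos.2 (hM k))
    filter_upwards [this.eventually_gt_atTop 1] with n hn
    linarith
  have e2 : ∀ᶠ n : ℕ in atTop, ∀ a b, a < b → u a * n + 1 < u b * n := by
    refine eventually_all.2 fun a => eventually_all.2 fun b => ?_
    by_cases hab : a < b
    · have : Tendsto (fun n : ℕ => (u b - u a) * (n : ℝ)) atTop atTop :=
        tendsto_natCast_atTop_atTop.const_mul_atTop (sub_pos.2 (hu hab))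
      filter_upwards [this.eventually_gt_atTop 1] with n hn _
      linarith
    · exact Eventually.of_forall fun _ h => absurd h hab
  filter_upwards [e1, e2, eventually_ge_atTop 1] with n h1 h2 hn
  have hn0 : (0 : ℝ) < n := by exact_mod_cast hn
  have hpos : ∀ k, 0 < u k * n := fun k => mul_pos (h0 k) hn0
  have hc1 : ∀ k, 1 ≤ ⌈u k * n⌉₊ := fun k => Nat.one_le_ceil_iff.2 (hpos k)
  have hlt : ∀ k, ⌈u k * n⌉₊ - 1 < ⌊n * M⌋₊ := fun k => by
    have : ⌈u k * n⌉₊ ≤ ⌊n * M⌋₊ := by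
      refine Nat.le_floor ?_
      exact (Nat.ceil_lt_add_one (hpos k).le).le.trans (h1 k).le
    have := hc1 k
    omega
  have hcast : ∀ k, (((⌈u k * n⌉₊ - 1 : ℕ) : ℝ)) = ⌈u k * n⌉₊ - 1 := fun k => by
    rw [Nat.cast_sub (hc1 k), Nat.cast_one]
  -- The cells are open on the left and closed on the right, so the index of the cell of `u k` is
  -- the ceiling minus one.
  refine ⟨fun k => ⟨⌈u k * n⌉₊ - 1, hlt k⟩, mem_strictMonoMaps.2 fun a b hab => ?_, fun k _ => ?_⟩
  · have h3 : ⌈u a * n⌉₊ < ⌈u b * n⌉₊ := by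
      have := (Nat.ceil_lt_add_one (hpos a).le).trans ((h2 a b hab).trans_le (Nat.le_ceil _))
      exact_mod_cast this
    have := hc1 a
    simp only [Fin.lt_def]
    omega
  · simp only [mem_Ioc, hcast, sub_add_cancel]
    rw [div_lt_iff₀ hn0, le_div_iff₀ hn0]
    exact ⟨by linarith [Nat.ceil_lt_add_one (hpos k).le], Nat.le_ceil _⟩

lemma measurableSet_orderedTimes (M : ℝ) (j : ℕ) : MeasurableSet (orderedTimes M j) := by
  have : orderedTimes M j = (univ.pi fun _ => Icc 0 M) ∩
      ⋂ (a : Fin j) (b : Fin j) (_ : a < b), {u | u a < u b} := by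
    ext u
    simp only [orderedTimes, mem_ofPred_eq, mem_inter_iff, mem_univ_pi, mem_iInter]
    rfl
  rw [this]
  refine (MeasurableSet.univ_pi fun _ => measurableSet_Icc).inter ?_
  exact MeasurableSet.iInter fun a => MeasurableSet.iInter fun b => MeasurableSet.iInter fun _ =>
    measurableSet_lt (measurable_pi_apply a) (measurable_pi_apply b)

lemma volume_orderedTimes_lt_top : volume (orderedTimes M j) < ∞ := by
  refine (measure_mono (t := univ.pi fun _ => Icc 0 M) fun u hu => mem_univ_pi.2 hu.1).trans_lt ?_
  rw [volume_pi_pi]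
  exact ENNReal.prod_lt_top fun _ _ => by simp

/-- The step function with value `φ (latticePoint n g)` on the cell of `g`. -/
def latticeStep (n j N : ℕ) (φ : (Fin j → ℝ) → ℝ≥0∞) (u : Fin j → ℝ) : ℝ≥0∞ :=
  ∑ g ∈ strictMonoMaps j N, (latticeCell n g).indicator (fun _ => φ (latticePoint n g)) u

lemma measurable_latticeStep (φ : (Fin j → ℝ) → ℝ≥0∞) : Measurable (latticeStep n j N φ) :=
  Finset.measurable_sum _ fun g _ => measurable_const.indicator (measurableSet_latticeCell g)

lemma setLIntegral_latticeStep (hn : 1 ≤ n) (hM : 0 ≤ M) (φ : (Fin j → ℝ) → ℝ≥0∞) :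
    ∫⁻ u in orderedTimes M j, latticeStep n j ⌊n * M⌋₊ φ u =
      ((n : ℝ≥0∞) ^ j)⁻¹ * ∑ g ∈ strictMonoMaps j ⌊n * M⌋₊, φ (latticePoint n g) := by
  unfold latticeStep
  rw [lintegral_finsetSum _ fun g _ =>
    measurable_const.indicator (measurableSet_latticeCell g), Finset.mul_sum]
  refine Finset.sum_congr rfl fun g hg => ?_
  rw [lintegral_indicator_const (measurableSet_latticeCell g),
    Measure.restrict_apply (measurableSet_latticeCell g),
    inter_eq_left.2 (latticeCell_subset hn hM (mem_strictMonoMaps.1 hg)),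
    volume_latticeCell hn, mul_comm]

lemma latticeStep_le (hn : 1 ≤ n) {φ : (Fin j → ℝ) → ℝ≥0∞} {u : Fin j → ℝ} {B : ℝ≥0∞}
    (h : ∀ u', (∀ k, |u k - u' k| ≤ 1 / n) → φ u' ≤ B) : latticeStep n j N φ u ≤ B := by
  unfold latticeStep
  by_cases hu : ∃ g ∈ strictMonoMaps j N, u ∈ latticeCell n g
  · obtain ⟨g, hg, hug⟩ := hu
    rw [Finset.sum_eq_single_of_mem g hg fun g' _ hne => indicator_of_notMem (fun hug' =>
      hne (eq_of_mem_latticeCell hn hug' hug)) _, indicator_of_mem hug]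
    exact h _ (abs_sub_latticePoint_le hug)
  · push Not at hu
    rw [Finset.sum_eq_zero fun g hg => indicator_of_notMem (hu g hg) _]
    exact bot_le

lemma le_latticeStep {φ : (Fin j → ℝ) → ℝ≥0∞} {u : Fin j → ℝ} {B : ℝ≥0∞}
    (hu : ∃ g ∈ strictMonoMaps j N, u ∈ latticeCell n g)
    (h : ∀ u', (∀ k, |u k - u' k| ≤ 1 / n) → B ≤ φ u') : B ≤ latticeStep n j N φ u := by
  obtain ⟨g, hg, hug⟩ := hu
  refine (h _ (abs_sub_latticePoint_le hug)).trans ?_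
  refine le_trans ?_ (Finset.single_le_sum (f := fun g => (latticeCell n g).indicator
    (fun _ => φ (latticePoint n g)) u) (fun _ _ => bot_le) hg)
  rw [indicator_of_mem hug]

/-- Lattice sums are asymptotically bounded by the integral over ordered times. -/
lemma limsup_lattice_sum_le (hM : 0 ≤ M) {φ : ℕ → (Fin j → ℝ) → ℝ≥0∞} {ψ : (Fin j → ℝ) → ℝ≥0∞}
    {C : ℝ≥0∞} (hC : C ≠ ∞) (hbound : ∀ᶠ n in atTop, ∀ u, φ n u ≤ C)
    (h : ∀ u ∈ orderedTimes M j, ∃ χ : ℕ → ℝ≥0∞, limsup χ atTop ≤ ψ u ∧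
      ∀ᶠ n : ℕ in atTop, ∀ u', (∀ k, |u k - u' k| ≤ 1 / n) → φ n u' ≤ χ n) :
    limsup (fun n : ℕ => ((n : ℝ≥0∞) ^ j)⁻¹ *
      ∑ g ∈ strictMonoMaps j ⌊n * M⌋₊, φ n (latticePoint n g)) atTop ≤
      ∫⁻ u in orderedTimes M j, ψ u := by
  obtain ⟨n₀, hn₀⟩ := eventually_atTop.1 hbound
  -- After this shift the domination by `C` and the condition `1 ≤ n` hold for every index, as the
  -- reverse Fatou lemma requires.
  set k := max n₀ 1
  rw [← limsup_nat_add _ k]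
  have e : ∀ n : ℕ, (((n + k : ℕ) : ℝ≥0∞) ^ j)⁻¹ *
      ∑ g ∈ strictMonoMaps j ⌊(n + k : ℕ) * M⌋₊, φ (n + k) (latticePoint (n + k) g) =
      ∫⁻ u in orderedTimes M j, latticeStep (n + k) j ⌊(n + k : ℕ) * M⌋₊ (φ (n + k)) u := fun n =>
    (setLIntegral_latticeStep (le_add_left (le_max_right _ _)) hM _).symm
  simp only [e]
  refine (limsup_lintegral_le (fun _ => C) (fun n => measurable_latticeStep _) (fun n =>
    Eventually.of_forall fun u => latticeStep_le (le_add_left (le_max_right _ _)) fun u' _ =>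
      hn₀ _ (le_add_left (le_max_left _ _)) u') ?_).trans ?_
  · rw [setLIntegral_const]
    exact ENNReal.mul_ne_top hC volume_orderedTimes_lt_top.ne
  · refine setLIntegral_mono' (measurableSet_orderedTimes M j) fun u hu => ?_
    obtain ⟨χ, hχ, H⟩ := h u hu
    refine le_trans ?_ hχ
    rw [limsup_nat_add (fun n => latticeStep n j ⌊(n : ℕ) * M⌋₊ (φ n) u) k]
    refine limsup_le_limsup ?_
    filter_upwards [H, eventually_ge_atTop 1] with n hn hn1 using latticeStep_le hn1 hn

/-- Lattice sums are asymptotically bounded from below by the integral over ordered times. -/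
lemma le_liminf_lattice_sum (hM : 0 ≤ M) {φ : ℕ → (Fin j → ℝ) → ℝ≥0∞}
    {ψ : (Fin j → ℝ) → ℝ≥0∞}
    (h : ∀ u ∈ orderedTimes M j, ∃ χ : ℕ → ℝ≥0∞, ψ u ≤ liminf χ atTop ∧
      ∀ᶠ n : ℕ in atTop, ∀ u', (∀ k, |u k - u' k| ≤ 1 / n) → χ n ≤ φ n u') :
    ∫⁻ u in orderedTimes M j, ψ u ≤ liminf (fun n : ℕ => ((n : ℝ≥0∞) ^ j)⁻¹ *
      ∑ g ∈ strictMonoMaps j ⌊n * M⌋₊, φ n (latticePoint n g)) atTop := by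
  have e : (fun n : ℕ => ((n : ℝ≥0∞) ^ j)⁻¹ *
      ∑ g ∈ strictMonoMaps j ⌊n * M⌋₊, φ n (latticePoint n g)) =ᶠ[atTop]
      fun n => ∫⁻ u in orderedTimes M j, latticeStep n j ⌊n * M⌋₊ (φ n) u := by
    filter_upwards [eventually_ge_atTop 1] with n hn
    exact (setLIntegral_latticeStep hn hM _).symm
  rw [liminf_congr e]
  refine le_trans ?_ (lintegral_liminf_le fun n => measurable_latticeStep _)
  -- Points with a coordinate `0` or `M` need not lie in any cell; discarding them costs nothing.
  have hnull : ∀ᵐ u ∂(volume.restrict (orderedTimes M j)), ∀ k, u k ≠ 0 ∧ u k ≠ M := by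
    refine ae_restrict_of_ae (eventually_all.2 fun k => ?_)
    have h1 := Measure.pi_hyperplane (fun _ : Fin j => (volume : Measure ℝ)) k 0
    have h2 := Measure.pi_hyperplane (fun _ : Fin j => (volume : Measure ℝ)) k M
    rw [← volume_pi] at h1 h2
    refine (show ∀ᵐ u : Fin j → ℝ, u k ≠ 0 from ?_).and (show ∀ᵐ u : Fin j → ℝ, u k ≠ M from ?_)
    · rw [ae_iff]; simpa using h1
    · rw [ae_iff]; simpa using h2
  refine lintegral_mono_ae ?_
  filter_upwards [hnull, ae_restrict_mem (measurableSet_orderedTimes M j)] with u hu huo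
  obtain ⟨χ, hχ, H⟩ := h u huo
  refine hχ.trans (liminf_le_liminf ?_)
  filter_upwards [H, exists_mem_latticeCell huo.2 (fun k => (huo.1 k).1.lt_of_ne' (hu k).1)
    fun k => (huo.1 k).2.lt_of_ne (hu k).2] with n hn hn'
  exact le_latticeStep hn' hn

end lattice

end

noncomputable section

/-! ### Jump configurations whose longest runs nearly hit a set -/

/-- The configurations of jump sizes and jump times for which a point of `F` lies between the run
lengths at the levels `η + e` and `η - e`, up to `e`. -/
def hitSet (M K d η : ℝ) (j : ℕ) (F : Set (Icc (0 : ℝ) M)) (e : ℝ) :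
    Set ((Fin j → ℝ) × (Fin j → ℝ)) :=
  {p | ∃ x ∈ F, runLength M (η + e) (bufferLevel K d j p.1 p.2) - e ≤ (x : ℝ) ∧
    (x : ℝ) ≤ runLength M (η - e) (bufferLevel K d j p.1 p.2) + e}

section hitSet

variable {M K d η e ε : ℝ} {j : ℕ} {F : Set (Icc (0 : ℝ) M)}

/-- A change of the sizes moves the content by at most `ε`, which a shift of the level by `ε`
absorbs. -/
lemma hitSet_of_dist {z z' u : Fin j → ℝ} (h : (z, u) ∈ hitSet M K d η j F e)
    (hε : ∑ i, |z i - z' i| ≤ ε) : (z', u) ∈ hitSet M K d η j F (e + ε) := by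
  have hε0 : 0 ≤ ε := (Finset.sum_nonneg fun i _ => abs_nonneg _).trans hε
  obtain ⟨x, hx, h1, h2⟩ := h
  refine ⟨x, hx, ?_, ?_⟩
  · have := runLength_bufferLevel_le_of_dist (M := M) (K := K) (d := d) (η := η + (e + ε)) (u := u)
      (z := z') (z' := z) (ε := ε) (by simpa only [abs_sub_comm] using hε)
    rw [show η + (e + ε) - ε = η + e by ring] at this
    linarith
  · have := runLength_bufferLevel_le_of_dist (M := M) (K := K) (d := d) (η := η - e) (u := u) hε
    rw [show η - e - ε = η - (e + ε) by ring] at this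
    linarith

lemma hitSet_mono {e' : ℝ} (h : e ≤ e') : hitSet M K d η j F e ⊆ hitSet M K d η j F e' := by
  rintro ⟨z, u⟩ hp
  simpa using hitSet_of_dist hp (z' := z) (ε := e' - e) (by simpa using h)

lemma hitSet_of_dist_time {z u u' : Fin j → ℝ} {ρ : ℝ} (hd : d ≤ 0) (hρ0 : 0 ≤ ρ)
    (hu : StrictMono u) (hu' : StrictMono u') (hρ : ∀ i, |u i - u' i| ≤ ρ)
    (hgap : ∀ a b, a < b → u a + 4 * ρ < u b) (hε : 2 * j * (-d * ρ) < ε) (hρε : 2 * ρ ≤ ε) :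
    ((z, u) ∈ hitSet M K d η j F e → (z, u') ∈ hitSet M K d η j F (e + ε)) ∧
    ((z, u') ∈ hitSet M K d η j F e → (z, u) ∈ hitSet M K d η j F (e + ε)) := by
  have hρ' : ∀ i, |u' i - u i| ≤ ρ := fun i => by rw [abs_sub_comm]; exact hρ i
  have hgap1 : ∀ a b, a < b → u a + 2 * ρ < u b := fun a b hab => by linarith [hgap a b hab]
  have hgap2 : ∀ a b, a < b → u' a + 2 * ρ < u' b := fun a b hab => by
    linarith [hgap a b hab, abs_le.1 (hρ a), abs_le.1 (hρ b), (abs_le.1 (hρ a)).1,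
      (abs_le.1 (hρ b)).2]
  have A := fun η => runLength_le_of_dist (M := M) (K := K) (η := η) (z := z) hd hρ0 hu hu' hρ
    hgap1 hε
  have B := fun η => runLength_le_of_dist (M := M) (K := K) (η := η) (z := z) hd hρ0 hu' hu hρ'
    hgap2 hε
  have e1 : η + (e + ε) - ε = η + e := by ring
  have e2 : η - e - ε = η - (e + ε) := by ring
  constructor
  · rintro ⟨x, hx, h1, h2⟩
    refine ⟨x, hx, ?_, ?_⟩
    · have := B (η + (e + ε))
      rw [e1] at this
      linarith
    · have := A (η - e)
      rw [e2] at this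
      linarith
  · rintro ⟨x, hx, h1, h2⟩
    refine ⟨x, hx, ?_, ?_⟩
    · have := A (η + (e + ε))
      rw [e1] at this
      linarith
    · have := B (η - e)
      rw [e2] at this
      linarith

/-- The Portmanteau bounds can be applied to the closure of a hit set at the price of a larger
tolerance, so no semicontinuity of the run length is needed. -/
lemma closure_hitSet_subset (hε : 0 < ε) (u : Fin j → ℝ) :
    closure {z | (z, u) ∈ hitSet M K d η j F e} ⊆ {z | (z, u) ∈ hitSet M K d η j F (e + ε)} := by
  intro z hz
  have ho : IsOpen {z' : Fin j → ℝ | ∑ i, |z' i - z i| < ε} :=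
    isOpen_lt (by fun_prop) continuous_const
  obtain ⟨z', h1, h2⟩ := mem_closure_iff.1 hz _ ho (by simpa using hε)
  exact hitSet_of_dist h2 (le_of_lt h1)

/-- Near ordered jump times, the hit sets at close jump times are comparable. -/
lemma eventually_hitSet_of_dist_time {u : Fin j → ℝ} (hd : d ≤ 0) (hu : StrictMono u)
    (hε : 0 < ε) : ∀ᶠ n : ℕ in atTop, ∀ u' : Fin j → ℝ, (∀ k, |u k - u' k| ≤ 1 / n) → ∀ z e,
      ((z, u) ∈ hitSet M K d η j F e → (z, u') ∈ hitSet M K d η j F (e + ε)) ∧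
      ((z, u') ∈ hitSet M K d η j F e → (z, u) ∈ hitSet M K d η j F (e + ε)) := by
  have h0 : Tendsto (fun n : ℕ => 1 / (n : ℝ)) atTop (𝓝 0) := tendsto_one_div_atTop_nhds_zero_nat
  have e1 : ∀ᶠ n : ℕ in atTop, ∀ a b, a < b → u a + 4 * (1 / (n : ℝ)) < u b := by
    refine eventually_all.2 fun a => eventually_all.2 fun b => ?_
    by_cases hab : a < b
    · have : Tendsto (fun n : ℕ => u a + 4 * (1 / (n : ℝ))) atTop (𝓝 (u a + 4 * 0)) :=
        (h0.const_mul 4).const_add _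
      filter_upwards [this.eventually_lt_const (show u a + 4 * 0 < u b by linarith [hu hab])]
        with n hn _ using hn
    · exact Eventually.of_forall fun _ h => absurd h hab
  have e2 : ∀ᶠ n : ℕ in atTop, 2 * j * (-d * (1 / (n : ℝ))) < ε :=
    ((h0.const_mul (-d)).const_mul (2 * (j : ℝ))).eventually_lt_const (by simpa using hε)
  have e3 : ∀ᶠ n : ℕ in atTop, 2 * (1 / (n : ℝ)) < ε :=
    (h0.const_mul 2).eventually_lt_const (by simpa using hε)
  filter_upwards [e1, e2, e3] with n h1 h2 h3 u' hu' z e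
  refine hitSet_of_dist_time hd (by positivity) hu (fun a b hab => ?_) hu' h1 h2 h3.le
  have := one_div_nonneg.2 (Nat.cast_nonneg (α := ℝ) n)
  linarith [h1 a b hab, (abs_le.1 (hu' a)).1, (abs_le.1 (hu' b)).2]

lemma measurableSet_hitSet (hd : d ≤ 0) (he : |e| ≤ η) (hF : IsClosed F) :
    MeasurableSet (hitSet M K d η j F e) := by
  -- The quantifier over `F` is a projection along the compact space `[0, M]`, and such projections
  -- are closed maps.
  have hc : IsClosed {q : ℝ × ℝ | ∃ x ∈ F, q.1 ≤ (x : ℝ) ∧ (x : ℝ) ≤ q.2} := by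
    have h1 : IsClosed {y : Icc (0 : ℝ) M × (ℝ × ℝ) | y.1 ∈ F ∧ y.2.1 ≤ (y.1 : ℝ) ∧
        (y.1 : ℝ) ≤ y.2.2} :=
      (hF.preimage continuous_fst).inter ((isClosed_le (continuous_fst.comp continuous_snd)
        (continuous_subtype_val.comp continuous_fst)).inter (isClosed_le
        (continuous_subtype_val.comp continuous_fst) (continuous_snd.comp continuous_snd)))
    convert isClosedMap_snd_of_compactSpace _ h1 using 1
    ext q
    simp only [mem_image, Prod.exists, exists_eq_right]
    rfl
  have hm : Measurable fun p : (Fin j → ℝ) × (Fin j → ℝ) =>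
      (runLength M (η + e) (bufferLevel K d j p.1 p.2) - e,
        runLength M (η - e) (bufferLevel K d j p.1 p.2) + e) :=
    ((measurable_runLength_bufferLevel hd (by linarith [(abs_le.1 he).1])).sub_const e).prodMk
      ((measurable_runLength_bufferLevel hd (by linarith [(abs_le.1 he).2])).add_const e)
  exact hm hc.measurableSet

/-- If the level is nowhere critical, configurations in all small hit sets hit the set. -/
lemma mem_of_forall_hitSet (hM : 0 ≤ M) (hd : d < 0) (hη : 0 < η) (hF : IsClosed F)
    {z u : Fin j → ℝ} (hu : StrictMono u) (hgap : JumpGap K d η 0 j z u)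
    {es : ℕ → ℝ} (hes : Tendsto es atTop (𝓝 0)) (hpos : ∀ k, 0 ≤ es k)
    (h : ∃ᶠ k in atTop, (z, u) ∈ hitSet M K d η j F (es k)) :
    (⟨runLength M η (bufferLevel K d j z u), runLength_nonneg, runLength_le_self hM⟩ :
      Icc (0 : ℝ) M) ∈ F := by
  obtain ⟨ε, hε, hgap⟩ := exists_jumpGap hgap
  set y : Icc (0 : ℝ) M :=
    ⟨runLength M η (bufferLevel K d j z u), runLength_nonneg, runLength_le_self hM⟩
  refine hF.closure_subset (Metric.mem_closure_iff.2 fun r hr => ?_)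
  have h0 : Tendsto (fun k => es k + 2 * (2 * es k / (-d))) atTop (𝓝 0) := by
    simpa using hes.add (((hes.const_mul 2).div_const (-d)).const_mul 2)
  obtain ⟨k, ⟨x, hx, h1, h2⟩, h3, h4, h5⟩ := (h.and_eventually ((hes.eventually_lt_const hε).and
    ((hes.eventually_lt_const hη).and (h0.eventually_lt_const hr)))).exists
  refine ⟨x, hx, ?_⟩
  have h6 := runLength_le_of_jumpGap (M := M) hd hu (hpos k) (by linarith) (hgap.mono h3.le)
  have h7 := runLength_anti (M := M) (v := bufferLevel K d j z u)
    (show η ≤ η + es k by linarith [hpos k])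
  have h8 := runLength_anti (M := M) (v := bufferLevel K d j z u)
    (show η - es k ≤ η by linarith [hpos k])
  rw [Subtype.dist_eq, Real.dist_eq]
  refine lt_of_le_of_lt (abs_le.2 ⟨?_, ?_⟩) h5
  · change _ ≤ runLength M η (bufferLevel K d j z u) - x
    linarith
  · change runLength M η (bufferLevel K d j z u) - x ≤ _
    linarith

end hitSet

/-! ### Lattice sums of the large jump laws -/

section latticeHit

variable {M K d η e δ α : ℝ} {j : ℕ} {F : Set (Icc (0 : ℝ) M)} {ρ : Measure ℝ}

lemma pi_restrict_le (μ : Measure ℝ) [SigmaFinite μ] (s : Set ℝ) (t : Set (Fin j → ℝ)) :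
    Measure.pi (fun _ : Fin j => μ.restrict s) t ≤ Measure.pi (fun _ : Fin j => μ) t := by
  rw [← Measure.restrict_pi_pi]
  exact Measure.restrict_apply_le _ _

/-- The tolerance grows from `e` to `2e` when the lattice point is replaced by a nearby time `u`,
and to `3e` when the section is replaced by its closure for the Portmanteau bound. -/
lemma limsup_lattice_hitSet_le [IsProbabilityMeasure ρ] (hα : 0 < α)
    (hRV : RegularlyVarying (-α) fun t => ρ.real (Ioi t)) (hδ : 0 < δ) (hM : 0 ≤ M) (hd : d ≤ 0)
    (he : 0 < e) (heη : 3 * e ≤ η) (hF : IsClosed F) :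
    limsup (fun n : ℕ => ((n : ℝ≥0∞) ^ j)⁻¹ * ∑ g ∈ strictMonoMaps j ⌊n * M⌋₊,
      (ENNReal.ofReal (ρ.real (Ioi (n : ℝ))))⁻¹ ^ j * Measure.pi (fun _ : Fin j => bigJumpLaw ρ δ n)
        {z | (z, latticePoint n g) ∈ hitSet M K d η j F e}) atTop ≤
      ((Measure.pi fun _ : Fin j => nuMeasure α).prod (volume.restrict (orderedTimes M j)))
        (hitSet M K d η j F (3 * e)) := by
  obtain ⟨hcl, -⟩ := bigJumpLaw_pi_bounds hα hRV hδ j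
  have hm : MeasurableSet (hitSet M K d η j F (3 * e)) :=
    measurableSet_hitSet hd (by rwa [abs_of_pos (by linarith)]) hF
  rw [Measure.prod_apply_symm hm]
  set B := Measure.pi (fun _ : Fin j => (nuMeasure α).restrict (Ioi δ)) univ
    with hBdef
  have hB : B < ∞ := by
    rw [hBdef, Measure.pi_univ]
    refine ENNReal.prod_lt_top fun _ _ => ?_
    rw [Measure.restrict_apply_univ, nuMeasure_Ioi (by linarith) hδ]
    exact ENNReal.ofReal_lt_top
  have hbd : ∀ᶠ n : ℕ in atTop, (ENNReal.ofReal (ρ.real (Ioi (n : ℝ))))⁻¹ ^ j *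
      Measure.pi (fun _ : Fin j => bigJumpLaw ρ δ n) univ < B + 1 :=
    eventually_lt_of_limsup_lt ((hcl univ isClosed_univ).trans_lt
      (ENNReal.lt_add_right hB.ne one_ne_zero))
  refine limsup_lattice_sum_le (φ := fun n u => (ENNReal.ofReal (ρ.real (Ioi (n : ℝ))))⁻¹ ^ j *
    Measure.pi (fun _ : Fin j => bigJumpLaw ρ δ n) {z | (z, u) ∈ hitSet M K d η j F e}) hM
    (C := B + 1) (by finiteness) ?_ ?_
  · filter_upwards [hbd] with n hn u
    refine le_trans ?_ hn.le
    gcongr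
    exact subset_univ _
  · intro u hu
    refine ⟨_, (hcl _ (isClosed_closure (s := {z | (z, u) ∈ hitSet M K d η j F (2 * e)}))).trans
      ((pi_restrict_le _ _ _).trans (measure_mono ?_)), ?_⟩
    · have := closure_hitSet_subset (M := M) (K := K) (d := d) (η := η) (F := F) (e := 2 * e) he u
      rwa [show 2 * e + e = 3 * e by ring] at this
    · filter_upwards [eventually_hitSet_of_dist_time (M := M) (K := K) (η := η) (F := F) hd hu.2 he]
        with n hn u' hu'
      gcongr
      refine fun z hz => subset_closure ?_
      have := (hn u' hu' z e).2 hz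
      rwa [show e + e = 2 * e by ring] at this

/-- Dual to the upper bound, with complements of hit sets in the role of open sets. The restriction
to sizes above `δ` now stays in the limit, since dropping it would enlarge the lower bound. -/
lemma le_liminf_lattice_hitSet [IsProbabilityMeasure ρ] (hα : 0 < α)
    (hRV : RegularlyVarying (-α) fun t => ρ.real (Ioi t)) (hδ : 0 < δ) (hM : 0 ≤ M) (hd : d ≤ 0)
    (he : 0 < e) (heη : 3 * e ≤ η) (hF : IsClosed F) :
    ((Measure.pi fun _ : Fin j => (nuMeasure α).restrict (Ioi δ)).prod
      (volume.restrict (orderedTimes M j))) (hitSet M K d η j F (3 * e))ᶜ ≤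
    liminf (fun n : ℕ => ((n : ℝ≥0∞) ^ j)⁻¹ * ∑ g ∈ strictMonoMaps j ⌊n * M⌋₊,
      (ENNReal.ofReal (ρ.real (Ioi (n : ℝ))))⁻¹ ^ j * Measure.pi (fun _ : Fin j => bigJumpLaw ρ δ n)
        {z | (z, latticePoint n g) ∈ (hitSet M K d η j F e)ᶜ}) atTop := by
  obtain ⟨-, hop⟩ := bigJumpLaw_pi_bounds hα hRV hδ j
  have hm : MeasurableSet (hitSet M K d η j F (3 * e)) :=
    measurableSet_hitSet hd (by rwa [abs_of_pos (by linarith)]) hF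
  rw [Measure.prod_apply_symm hm.compl]
  refine le_liminf_lattice_sum (φ := fun n u => (ENNReal.ofReal (ρ.real (Ioi (n : ℝ))))⁻¹ ^ j *
    Measure.pi (fun _ : Fin j => bigJumpLaw ρ δ n) {z | (z, u) ∈ (hitSet M K d η j F e)ᶜ}) hM ?_
  intro u hu
  refine ⟨_, (measure_mono ?_).trans (hop _ (isClosed_closure
    (s := {z | (z, u) ∈ hitSet M K d η j F (2 * e)})).isOpen_compl), ?_⟩
  · have := closure_hitSet_subset (M := M) (K := K) (d := d) (η := η) (F := F) (e := 2 * e) he u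
    rw [show 2 * e + e = 3 * e by ring] at this
    exact compl_subset_compl.2 this
  · filter_upwards [eventually_hitSet_of_dist_time (M := M) (K := K) (η := η) (F := F) hd hu.2 he]
      with n hn u' hu'
    gcongr
    refine fun z hz hz' => hz (subset_closure ?_)
    have := (hn u' hu' z e).2 hz'
    rwa [show e + e = 2 * e by ring] at this

end latticeHit

end

noncomputable section

/-! ### The scaled queue and its large jumps -/

/-- The longest run of the scaled queue with arrivals `a` above `η`. -/
def queueRun (M K c η : ℝ) (n : ℕ) (a : ℕ → ℝ) : ℝ :=
  runLength M η (bufferLevel K 0 ⌊n * M⌋₊ (fun i => (a i - c) / n) (latticePoint n id))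

section scaledQueue

variable {M K c m η e δ ε : ℝ} {n j : ℕ} {a : ℕ → ℝ}

lemma intenseLength_scaledQueue (hn : 1 ≤ n) (hM : 0 ≤ M) (hK : 0 < K) :
    (intenseLength hM η (scaledQueue M K c n a) : ℝ) = queueRun M K c η n a := by
  have hn0 : (0 : ℝ) < n := by exact_mod_cast hn
  refine intenseLength_eq_runLength hM fun t => ?_
  change (reflect (n * K) (netInput (n * M) c a) (scaleTime n t)) / n = _
  rw [netInput, reflect_stepPath (mul_pos hn0 hK) le_rfl (fun i k hik => by simpa using hik)
    (fun i => by positivity)]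
  exact bufferLevel_scale hn0

lemma measurable_queueRun {Ω : Type*} [MeasurableSpace Ω] {A : ℕ → Ω → ℝ}
    (hA : ∀ i, Measurable (A i)) (hη : 0 ≤ η) :
    Measurable fun ω => queueRun M K c η n fun i => A i ω := by
  have h : Measurable fun ω => ((fun i : Fin ⌊n * M⌋₊ => (A i ω - c) / n),
      (latticePoint n id : Fin ⌊n * M⌋₊ → ℝ)) :=
    (measurable_pi_lambda _ fun i : Fin _ => ((hA i).sub_const c).div_const (n : ℝ)).prodMk
      measurable_const
  exact (measurable_runLength_bufferLevel le_rfl hη).comp h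

/-- The arrival with index `i`, counted from `0`, occurs at the scaled time `(i + 1) / n`, so
exactly the indices below `⌊n * t⌋₊` have occurred by time `t`. -/
lemma sum_latticePoint_id (hn : 1 ≤ n) {t : ℝ} (ht0 : 0 ≤ t) (ht : t ≤ M) (w : ℕ → ℝ) :
    (∑ i : Fin ⌊n * M⌋₊, if latticePoint n id i ≤ t then w i else 0) =
      ∑ i ∈ Finset.range ⌊n * t⌋₊, w i := by
  have hn0 : (0 : ℝ) < n := by exact_mod_cast hn
  have h1 : ∀ i : ℕ, ((i : ℝ) + 1) / n ≤ t ↔ i < ⌊n * t⌋₊ := fun i => by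
    rw [div_le_iff₀' hn0, ← Nat.succ_le_iff, Nat.le_floor_iff (by positivity)]
    simp
  have h2 : ⌊n * t⌋₊ ≤ ⌊n * M⌋₊ := Nat.floor_mono (by gcongr)
  simp only [latticePoint, id, h1]
  rw [Fin.sum_univ_eq_sum_range (fun i => if i < ⌊n * t⌋₊ then w i else 0) ⌊n * M⌋₊,
    ← Finset.sum_filter]
  refine Finset.sum_congr ?_ fun _ _ => rfl
  ext i
  simp only [Finset.mem_filter, Finset.mem_range]
  omega

/-- If the truncated arrivals follow their mean, then the longest run of the scaled queue is close
to that of the queue fed by the large jumps. -/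
lemma runLength_largeJumps (hn : 1 ≤ n) (hK : 0 < K) (hmc : m < c) (hε : 0 ≤ ε)
    (hcn : (c - m) / n ≤ ε) (hεe : 4 * ε ≤ e)
    (hgood : ∀ k ≤ ⌊n * M⌋₊, |∑ i ∈ Finset.range k, (truncAt (n * δ) (a i) - m)| ≤ n * ε)
    {g : Fin j → Fin ⌊n * M⌋₊} (hg : StrictMono g) (hbig : ∀ i, i ∈ range g ↔ n * δ < a i) :
    runLength M (η + e) (bufferLevel K (m - c) j (fun k => a (g k) / n) (latticePoint n g)) ≤
      queueRun M K c η n a ∧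
    queueRun M K c η n a ≤
      runLength M (η - e) (bufferLevel K (m - c) j (fun k => a (g k) / n) (latticePoint n g)) := by
  have hn0 : (0 : ℝ) < n := by exact_mod_cast hn
  have hpos : ∀ {l : ℕ} (g : Fin l → Fin ⌊n * M⌋₊) i, 0 ≤ latticePoint n g i := fun g i => by
    unfold latticePoint; positivity
  have key : ∀ t, 0 ≤ t → t ≤ M →
      |bufferLevel K 0 ⌊n * M⌋₊ (fun i => (a i - c) / n) (latticePoint n id) t -
      bufferLevel K (m - c) j (fun k => a (g k) / n) (latticePoint n g) t| ≤ 2 * (2 * ε) := by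
    refine fun t ht0 htM => abs_bufferLevel_sub_le (T := M) hK le_rfl (by linarith)
      (strictMono_latticePoint hn strictMono_id) (hpos _) (strictMono_latticePoint hn hg) (hpos _)
      (by linarith) (fun t ht0 htM => ?_) ht0 htM
    set q := ⌊n * t⌋₊ with hq
    have hqN : q ≤ ⌊n * M⌋₊ := Nat.floor_mono (by gcongr)
    rw [sum_latticePoint_id hn ht0 htM fun i => (a i - c) / n]
    have e1 : (∑ k, if latticePoint n g k ≤ t then a (g k) / n else 0) =
        ∑ i ∈ Finset.range q, (a i - truncAt (n * δ) (a i)) / n := by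
      rw [← sum_latticePoint_id hn ht0 htM fun i => (a i - truncAt (n * δ) (a i)) / n]
      refine Fintype.sum_of_injective g hg.injective _ _ (fun i hi => ?_) fun k => ?_
      · have := not_lt.1 (mt (hbig i).2 hi)
        simp [truncAt, this]
      · have := not_le.2 ((hbig (g k)).1 (mem_range_self k))
        simp only [truncAt, this, if_false, sub_zero]
        rfl
    rw [e1]
    -- The inputs differ by the centred truncated sum and by the discretization of the drift, each
    -- at most `ε`. Reflection doubles the total `2ε`, whence the condition `4 * ε ≤ e`.
    have e2 : (∑ i ∈ Finset.range q, (a i - c) / n + 0 * t) -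
        (∑ i ∈ Finset.range q, (a i - truncAt (n * δ) (a i)) / n + (m - c) * t) =
        (∑ i ∈ Finset.range q, (truncAt (n * δ) (a i) - m)) / n + (c - m) * (t - q / n) := by
      simp only [← Finset.sum_div, Finset.sum_sub_distrib, Finset.sum_const, Finset.card_range,
        nsmul_eq_mul]
      field_simp
      ring
    rw [e2]
    have h1 : |(∑ i ∈ Finset.range q, (truncAt (n * δ) (a i) - m)) / n| ≤ ε := by
      rw [abs_div, abs_of_pos hn0, div_le_iff₀' hn0]
      exact hgood q hqN
    have h2 : (q : ℝ) / n ≤ t := by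
      rw [div_le_iff₀' hn0]; exact Nat.floor_le (by positivity)
    have h3 : t - q / n ≤ 1 / n := by
      rw [sub_le_iff_le_add, ← add_div, le_div_iff₀' hn0]
      linarith [Nat.lt_floor_add_one (n * t)]
    have h4 : (c - m) * (t - q / n) ≤ ε := by
      refine le_trans ?_ hcn
      rw [div_eq_mul_one_div (c - m)]
      exact mul_le_mul_of_nonneg_left h3 (by linarith)
    have h5 : 0 ≤ (c - m) * (t - q / n) := mul_nonneg (by linarith) (by linarith)
    rw [abs_le] at h1 ⊢
    constructor <;> linarith [h1.1, h1.2]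
  constructor
  · refine runLength_mono fun t ht0 htM h => ?_
    linarith [(abs_le.1 (key t ht0 htM)).1]
  · refine runLength_mono fun t ht0 htM h => ?_
    linarith [(abs_le.1 (key t ht0 htM)).2]

lemma jumpCount_le (z : Fin j → ℝ) : jumpCount z ≤ j := by
  unfold jumpCount
  refine (Finset.sum_le_card_nsmul _ _ 1 fun i _ => ?_).trans (by simp)
  split_ifs <;> norm_num

lemma runLength_bufferLevel_le_card {d : ℝ} (hK : 0 < K) (hd : d < 0) (hη : 0 < η) (hηK : η ≤ K)
    {z u : Fin j → ℝ} (hu : StrictMono u) :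
    runLength M η (bufferLevel K d j z u) ≤ j * (K - η) / (-d) := by
  refine (runLength_bufferLevel_le hK hd hη hηK hu).trans ?_
  have h1 : 0 ≤ -d := by linarith
  have h2 : 0 ≤ K - η := by linarith
  have h3 := jumpCount_le z
  gcongr

end scaledQueue

/-! ### Independence of the large jumps -/

section independence

variable {Ω : Type*} [MeasurableSpace Ω] {P : Measure Ω} [IsProbabilityMeasure P] {A : ℕ → Ω → ℝ}
  {ρ : Measure ℝ} {δ : ℝ} {n j N : ℕ}

/-- The event that the arrivals indexed by `g` are large and that, scaled, they lie in `S`. -/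
def largeJumpEvent (A : ℕ → Ω → ℝ) (δ : ℝ) (n : ℕ) (g : Fin j → Fin N) (S : Set (Fin j → ℝ)) :
    Set Ω :=
  {ω | (∀ k, n * δ < A (g k) ω) ∧ (fun k => A (g k) ω / n) ∈ S}

lemma measure_largeJumpEvent (hA : ∀ i, Measurable (A i)) (hind : iIndepFun A P)
    (hρ : ∀ i, P.map (A i) = ρ) (hn : 1 ≤ n) {g : Fin j → Fin N} (hg : Function.Injective g)
    {S : Set (Fin j → ℝ)} (hS : MeasurableSet S) :
    P (largeJumpEvent A δ n g S) = Measure.pi (fun _ : Fin j => bigJumpLaw ρ δ n) S := by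
  have hn0 : (0 : ℝ) < n := by exact_mod_cast hn
  have : IsProbabilityMeasure ρ := hρ 0 ▸ Measure.isProbabilityMeasure_map (hA 0).aemeasurable
  have hmeas : ∀ k, Measurable fun ω => A (g k) ω / n := fun k => (hA _).div_const _
  have h1 : iIndepFun (fun (k : Fin j) ω => A (g k) ω / n) P :=
    (hind.precomp (g := fun k => (g k : ℕ)) (Fin.val_injective.comp hg)).comp
      (fun _ x => x / n) fun _ => measurable_id.div_const _
  have h2 := h1.map_fun_eq_pi_map fun k => (hmeas k).aemeasurable
  have h3 : ∀ k, P.map (fun ω => A (g k) ω / n) = ρ.map fun x : ℝ => x / (n : ℝ) := fun k => by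
    rw [← hρ (g k), Measure.map_map (by fun_prop) (hA _)]
    rfl
  simp only [h3] at h2
  have : IsProbabilityMeasure (ρ.map fun x : ℝ => x / (n : ℝ)) :=
    Measure.isProbabilityMeasure_map (measurable_id.div_const _).aemeasurable
  unfold bigJumpLaw
  rw [← Measure.restrict_pi_pi, Measure.restrict_apply hS, ← h2,
    Measure.map_apply (measurable_pi_lambda _ hmeas)
      (hS.inter (MeasurableSet.univ_pi fun _ => measurableSet_Ioi))]
  congr 1
  ext ω
  simp only [largeJumpEvent, mem_ofPred_eq, mem_preimage, mem_inter_iff, mem_univ_pi, mem_Ioi,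
    lt_div_iff₀' hn0]
  exact and_comm

lemma measure_largeJumps (hA : ∀ i, Measurable (A i)) (hind : iIndepFun A P)
    (hρ : ∀ i, P.map (A i) = ρ) (hn : 1 ≤ n) {g : Fin j → Fin N} (hg : Function.Injective g) :
    P {ω | ∀ k, n * δ < A (g k) ω} = ρ (Ioi (n * δ)) ^ j := by
  have : IsProbabilityMeasure ρ := hρ 0 ▸ Measure.isProbabilityMeasure_map (hA 0).aemeasurable
  have h := measure_largeJumpEvent (δ := δ) hA hind hρ hn hg MeasurableSet.univ
  have h1 : bigJumpLaw ρ δ n univ = ρ (Ioi (n * δ)) := by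
    have := bigJumpLaw_Ioi (ρ := ρ) (δ := δ) hn δ
    rw [max_self] at this
    rw [← this, bigJumpLaw, Measure.restrict_apply_univ, Measure.restrict_apply measurableSet_Ioi,
      inter_self]
  rw [Measure.pi_univ, Finset.prod_const, h1] at h
  simpa [largeJumpEvent] using h

lemma measurableSet_largeJumpEvent (hA : ∀ i, Measurable (A i)) {g : Fin j → Fin N}
    {S : Set (Fin j → ℝ)} (hS : MeasurableSet S) : MeasurableSet (largeJumpEvent A δ n g S) := by
  have h1 : MeasurableSet {ω | ∀ k, n * δ < A (g k) ω} := by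
    rw [ofPred_forall]
    exact MeasurableSet.iInter fun k => measurableSet_lt measurable_const (hA _)
  exact h1.inter (measurable_pi_lambda _ (fun k => (hA (g k)).div_const _) hS)

end independence

/-! ### Comparison of the scaled queue with lattice sums -/

section comparison

variable {Ω : Type*} [MeasurableSpace Ω] {P : Measure Ω} [IsProbabilityMeasure P] {A : ℕ → Ω → ℝ}
  {ρ : Measure ℝ} {M K c m η e ε δ : ℝ} {n j : ℕ}

/-- The event that a truncated partial sum up to `n * M` is off its mean by more than `n * ε`. -/
def deviationEvent (A : ℕ → Ω → ℝ) (M m δ ε : ℝ) (n : ℕ) : Set Ω :=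
  {ω | ∃ k ≤ ⌊n * M⌋₊, n * ε < |∑ i ∈ Finset.range k, (truncAt (n * δ) (A i ω) - m)|}

lemma exists_strictMono_range {N : ℕ} (s : Finset (Fin N)) :
    ∃ (l : ℕ) (g : Fin l → Fin N), StrictMono g ∧ range g = s :=
  ⟨s.card, s.orderEmbOfFin rfl, (s.orderEmbOfFin rfl).strictMono, s.range_orderEmbOfFin rfl⟩

/-- Off the deviation event the number of large arrivals decides. Fewer than `j` of them give runs
too short for `F`. Exactly `j` give a configuration in the hit set. More than `j` include `j + 1`
large ones, handled by a union bound. -/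
lemma measure_queueRun_mem_le (hA : ∀ i, Measurable (A i)) (hind : iIndepFun A P)
    (hρ : ∀ i, P.map (A i) = ρ) (hn : 1 ≤ n) (hK : 0 < K) (hmc : m < c) (hε : 0 ≤ ε)
    (hcn : (c - m) / n ≤ ε) (hεe : 4 * ε ≤ e) (heη : e < η) (hηK : η ≤ K)
    {F : Set (Icc (0 : ℝ) M)} (hF : IsClosed F) {r : ℝ} (hFr : ∀ x ∈ F, r ≤ (x : ℝ))
    (hr : ((j : ℝ) - 1) * (K - η + e) / (c - m) < r) {L : Ω → Icc (0 : ℝ) M}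
    (hL : ∀ ω, (L ω : ℝ) = queueRun M K c η n fun i => A i ω) :
    P {ω | L ω ∈ F} ≤ P (deviationEvent A M m δ ε n) +
      (⌊n * M⌋₊ : ℝ≥0∞) ^ (j + 1) * ρ (Ioi (n * δ)) ^ (j + 1) +
      ∑ g ∈ strictMonoMaps j ⌊n * M⌋₊, Measure.pi (fun _ : Fin j => bigJumpLaw ρ δ n)
        {z | (z, latticePoint n g) ∈ hitSet M K (m - c) η j F e} := by
  have he : 0 ≤ e := by linarith
  set N := ⌊n * M⌋₊
  set B : (Fin (j + 1) → Fin N) → Set Ω := fun g => {ω | ∀ k, n * δ < A (g k) ω} with hB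
  set E : (Fin j → Fin N) → Set Ω := fun g => largeJumpEvent A δ n g
    {z | (z, latticePoint n g) ∈ hitSet M K (m - c) η j F e} with hE
  have hsub : {ω | L ω ∈ F} ⊆ deviationEvent A M m δ ε n ∪
      (⋃ g ∈ strictMonoMaps (j + 1) N, B g) ∪ ⋃ g ∈ strictMonoMaps j N, E g := by
    intro ω hω
    by_cases hgood : ω ∈ deviationEvent A M m δ ε n
    · exact Or.inl (Or.inl hgood)
    simp only [deviationEvent, mem_ofPred_eq, not_exists, not_and, not_lt] at hgood
    obtain ⟨l, g, hg, hgs⟩ := exists_strictMono_range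
      (Finset.univ.filter fun i : Fin N => n * δ < A i ω)
    have hbig : ∀ i, i ∈ range g ↔ n * δ < A i ω := fun i => by rw [hgs]; simp
    obtain ⟨h1, h2⟩ := runLength_largeJumps (η := η) hn hK hmc hε hcn hεe hgood hg hbig
    rw [← hL] at h1 h2
    rcases lt_trichotomy l j with hl | hl | hl
    · exfalso
      have h3 := runLength_bufferLevel_le_card (M := M) (η := η - e) (z := fun k => A (g k) ω / n)
        hK (show m - c < 0 by linarith) (by linarith) (by linarith) (strictMono_latticePoint hn hg)
      have h4 : (l : ℝ) * (K - (η - e)) / (-(m - c)) ≤ ((j : ℝ) - 1) * (K - η + e) / (c - m) := by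
        have h5 : (l : ℝ) ≤ (j : ℝ) - 1 := by
          have : (l : ℝ) + 1 ≤ j := by exact_mod_cast hl
          linarith
        rw [neg_sub, show K - (η - e) = K - η + e by ring]
        have h6 : 0 ≤ K - η + e := by linarith
        have h7 : 0 ≤ c - m := by linarith
        gcongr
      linarith [hFr _ hω]
    · refine Or.inr ?_
      subst hl
      refine mem_biUnion (mem_strictMonoMaps.2 hg) ⟨fun k => (hbig _).1 (mem_range_self k), ?_⟩
      exact ⟨L ω, hω, by linarith, by linarith⟩
    · refine Or.inl (Or.inr ?_)
      refine mem_biUnion (x := g ∘ Fin.castLE hl)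
        (mem_strictMonoMaps.2 (hg.comp (Fin.strictMono_castLE hl)))
        fun k => (hbig _).1 (mem_range_self _)
  refine (measure_mono hsub).trans ((measure_union_le _ _).trans (add_le_add
    ((measure_union_le _ _).trans (add_le_add le_rfl ?_)) ?_))
  · refine (measure_biUnion_finset_le _ _).trans ?_
    rw [Finset.sum_congr rfl fun g hg => measure_largeJumps (δ := δ) hA hind hρ hn
      (mem_strictMonoMaps.1 hg).injective, Finset.sum_const, nsmul_eq_mul]
    gcongr
    exact_mod_cast card_strictMonoMaps_le
  · refine (measure_biUnion_finset_le _ _).trans (le_of_eq (Finset.sum_congr rfl fun g hg => ?_))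
    exact measure_largeJumpEvent hA hind hρ hn (mem_strictMonoMaps.1 hg).injective
      (measurable_prodMk_right (measurableSet_hitSet (by linarith)
        (by rw [abs_of_nonneg he]; exact heη.le) hF))

/-- From the event for each `g` the deviation event and the presence of any further large arrival
are removed. What remains determines `g` as the set of large arrivals, so these events are disjoint;
they lie in `{L ∈ G}`, and their probabilities may be added. -/
lemma sum_le_measure_queueRun_mem (hA : ∀ i, Measurable (A i)) (hind : iIndepFun A P)
    (hρ : ∀ i, P.map (A i) = ρ) (hn : 1 ≤ n) (hK : 0 < K) (hmc : m < c) (hε : 0 ≤ ε)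
    (hcn : (c - m) / n ≤ ε) (hεe : 4 * ε ≤ e) (heη : e < η)
    {G : Set (Icc (0 : ℝ) M)} (hG : IsOpen G) {L : Ω → Icc (0 : ℝ) M}
    (hL : ∀ ω, (L ω : ℝ) = queueRun M K c η n fun i => A i ω) :
    ∑ g ∈ strictMonoMaps j ⌊n * M⌋₊, Measure.pi (fun _ : Fin j => bigJumpLaw ρ δ n)
        {z | (z, latticePoint n g) ∈ (hitSet M K (m - c) η j Gᶜ e)ᶜ} ≤
      P {ω | L ω ∈ G} + (⌊n * M⌋₊ : ℝ≥0∞) ^ j * (P (deviationEvent A M m δ ε n) +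
        (⌊n * M⌋₊ : ℝ≥0∞) * ρ (Ioi (n * δ)) ^ (j + 1)) := by
  have he : 0 ≤ e := by linarith
  set N := ⌊n * M⌋₊
  set bad := deviationEvent A M m δ ε n with hbad
  set E : (Fin j → Fin N) → Set Ω := fun g => largeJumpEvent A δ n g
    {z | (z, latticePoint n g) ∈ (hitSet M K (m - c) η j Gᶜ e)ᶜ} with hE
  have hS : ∀ g : Fin j → Fin N, MeasurableSet
      {z | (z, latticePoint n g) ∈ (hitSet M K (m - c) η j Gᶜ e)ᶜ} := fun g =>
    measurable_prodMk_right (measurableSet_hitSet (by linarith)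
        (by rw [abs_of_nonneg he]; exact heη.le) hG.isClosed_compl).compl
  -- Index `i` is large in addition to those of `g`. The extended index map need not be monotone;
  -- injectivity suffices for independence.
  set Z : (Fin j → Fin N) → Fin N → Set Ω := fun g i =>
    {ω | ∀ k, n * δ < A ((Fin.cons i g : Fin (j + 1) → Fin N) k) ω} with hZ
  have hZm : ∀ g i, MeasurableSet (Z g i) := fun g i => by
    rw [hZ]
    simp only [ofPred_forall]
    exact MeasurableSet.iInter fun k => measurableSet_lt measurable_const (hA _)
  have hbadm : MeasurableSet bad := by
    rw [hbad, deviationEvent]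
    simp only [← exists_prop, ofPred_exists]
    exact MeasurableSet.iUnion fun k => MeasurableSet.iUnion fun _ =>
      measurableSet_lt measurable_const (Finset.measurable_sum _ fun i _ =>
        ((measurable_truncAt _).comp (hA i)).sub_const m).abs
  set D : (Fin j → Fin N) → Set Ω := fun g =>
    E g \ (bad ∪ ⋃ i ∈ Finset.univ.filter fun i => i ∉ range g, Z g i) with hD
  have hDbig : ∀ g, ∀ ω ∈ D g, ∀ i, i ∈ range g ↔ n * δ < A i ω := by
    rintro g ω ⟨h1, h2⟩ i
    refine ⟨by rintro ⟨k, rfl⟩; exact h1.1 k, fun hi => ?_⟩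
    by_contra hc
    refine h2 (Or.inr (mem_biUnion (x := i) (by simpa using hc) fun k => ?_))
    refine Fin.cases ?_ (fun k => ?_) k
    · simpa using hi
    · simpa using h1.1 k
  have hDsub : ∀ g ∈ strictMonoMaps j N, D g ⊆ {ω | L ω ∈ G} := by
    intro g hg ω hω
    have hg := mem_strictMonoMaps.1 hg
    have hgood : ω ∉ bad := fun h => hω.2 (Or.inl h)
    simp only [hbad, deviationEvent, mem_ofPred_eq, not_exists, not_and, not_lt] at hgood
    obtain ⟨h1, h2⟩ := runLength_largeJumps (η := η) hn hK hmc hε hcn hεe hgood hg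
      (hDbig g ω hω)
    rw [← hL] at h1 h2
    by_contra hc
    exact hω.1.2 ⟨L ω, hc, by linarith, by linarith⟩
  have hdisj : PairwiseDisjoint (strictMonoMaps j N : Set (Fin j → Fin N)) D := by
    intro g hg g' hg' hne
    refine disjoint_left.2 fun ω h h' => hne ?_
    refine (StrictMono.range_inj (mem_strictMonoMaps.1 hg) (mem_strictMonoMaps.1 hg')).1 ?_
    ext i
    rw [hDbig g ω h i, hDbig g' ω h' i]
  have hDm : ∀ g, MeasurableSet (D g) := fun g =>
    (measurableSet_largeJumpEvent hA (hS g)).diff (hbadm.union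
      (Finset.measurableSet_biUnion _ fun i _ => hZm g i))
  have hE' : ∀ g ∈ strictMonoMaps j N, P (E g) ≤ P (D g) + (P bad +
      (N : ℝ≥0∞) * ρ (Ioi (n * δ)) ^ (j + 1)) := by
    intro g hg
    have hg := mem_strictMonoMaps.1 hg
    calc P (E g) ≤ P (D g ∪ (bad ∪ ⋃ i ∈ Finset.univ.filter fun i => i ∉ range g, Z g i)) := by
          refine measure_mono fun ω hω => ?_
          by_cases h : ω ∈ bad ∪ ⋃ i ∈ Finset.univ.filter fun i => i ∉ range g, Z g i
          · exact Or.inr h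
          · exact Or.inl ⟨hω, h⟩
      _ ≤ _ := by
          refine (measure_union_le _ _).trans (add_le_add le_rfl
            ((measure_union_le _ _).trans (add_le_add le_rfl ?_)))
          refine (measure_biUnion_finset_le _ _).trans ?_
          rw [Finset.sum_congr rfl fun i hi => measure_largeJumps (δ := δ) hA hind hρ hn
            (Fin.cons_injective_iff.2 ⟨(Finset.mem_filter.1 hi).2, hg.injective⟩),
            Finset.sum_const, nsmul_eq_mul]
          gcongr
          exact (Finset.card_le_univ _).trans (by simp)
  calc ∑ g ∈ strictMonoMaps j N, Measure.pi (fun _ : Fin j => bigJumpLaw ρ δ n)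
        {z | (z, latticePoint n g) ∈ (hitSet M K (m - c) η j Gᶜ e)ᶜ}
      = ∑ g ∈ strictMonoMaps j N, P (E g) := Finset.sum_congr rfl fun g hg =>
        (measure_largeJumpEvent hA hind hρ hn (mem_strictMonoMaps.1 hg).injective (hS g)).symm
    _ ≤ ∑ g ∈ strictMonoMaps j N, (P (D g) + (P bad +
        (N : ℝ≥0∞) * ρ (Ioi (n * δ)) ^ (j + 1))) := Finset.sum_le_sum hE'
    _ ≤ _ := by
      rw [Finset.sum_add_distrib, ← measure_biUnion_finset hdisj fun g _ => hDm g,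
        Finset.sum_const, nsmul_eq_mul]
      gcongr
      · exact iUnion₂_subset hDsub
      · exact_mod_cast card_strictMonoMaps_le

end comparison

end

noncomputable section

/-! ### The limit measure -/

/-- The law of jump sizes and ordered jump times. -/
def configMeasure (α M : ℝ) (j : ℕ) : Measure ((Fin j → ℝ) × (Fin j → ℝ)) :=
  (Measure.pi fun _ : Fin j => nuMeasure α).prod (volume.restrict (orderedTimes M j))

/-- The longest run above `η` as a function of jump sizes and jump times, with values in
`[0, M]`. -/
def configRun {M : ℝ} (hM : 0 ≤ M) (K d η : ℝ) (j : ℕ) (p : (Fin j → ℝ) × (Fin j → ℝ)) :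
    Icc (0 : ℝ) M :=
  ⟨runLength M η (bufferLevel K d j p.1 p.2), runLength_nonneg, runLength_le_self hM⟩

/-- Almost all of `S` lies in the increasing union of the tail intersections of `T`. Neither
monotonicity of `T` nor finiteness of `Λ` is needed, which suits the lower bound for open sets. -/
lemma measure_le_of_eventually_mem {X : Type*} [MeasurableSpace X] {Λ : Measure X} {S : Set X}
    {T : ℕ → Set X} {B : ℝ≥0∞} (hS : ∀ᵐ p ∂Λ, p ∈ S → ∀ᶠ k in atTop, p ∈ T k)
    (hB : ∀ k, Λ (T k) ≤ B) : Λ S ≤ B := by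
  have hm : Monotone fun k => ⋂ l ≥ k, T l := fun k k' hk =>
    biInter_mono (fun l (hl : k' ≤ l) => hk.trans hl) fun _ _ => Subset.rfl
  calc Λ S ≤ Λ (⋃ k, ⋂ l ≥ k, T l) := by
        refine measure_mono_ae ?_
        filter_upwards [hS] with p hp hpS
        obtain ⟨k, hk⟩ := eventually_atTop.1 (hp hpS)
        exact mem_iUnion.2 ⟨k, mem_iInter₂.2 hk⟩
    _ = ⨆ k, Λ (⋂ l ≥ k, T l) := hm.measure_iUnion
    _ ≤ B := iSup_le fun k => (measure_mono (biInter_subset_of_mem (le_refl k))).trans (hB k)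

section configMeasure

variable {M K d η α e δ r : ℝ} {j : ℕ}

lemma configMeasure_eq (α M : ℝ) (j : ℕ) : configMeasure α M j =
    ((Measure.pi fun _ : Fin j => nuMeasure α).prod volume).restrict
      (univ ×ˢ orderedTimes M j) := by
  rw [configMeasure, ← Measure.prod_restrict, Measure.restrict_univ]

lemma ae_mem_orderedTimes (α M : ℝ) (j : ℕ) :
    ∀ᵐ p ∂(configMeasure α M j), p.2 ∈ orderedTimes M j := by
  rw [configMeasure_eq]
  filter_upwards [ae_restrict_mem (MeasurableSet.univ.prod (measurableSet_orderedTimes M j))]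
    with p hp using hp.2

lemma ae_pos_configMeasure (α M : ℝ) (j : ℕ) : ∀ᵐ p ∂(configMeasure α M j), ∀ k, 0 < p.1 k := by
  have h : ∀ᵐ z ∂(Measure.pi fun _ : Fin j => nuMeasure α), ∀ k, 0 < z k := by
    refine eventually_all.2 fun k => ?_
    have h1 : ∀ᵐ x ∂(nuMeasure α), 0 < x := by
      rw [ae_iff]
      simp only [not_lt]
      exact nuMeasure_Iic_zero α
    exact Measure.tendsto_eval_ae_ae.eventually h1
  exact Measure.quasiMeasurePreserving_fst.ae h

lemma ae_jumpGap_configMeasure (hd : d < 0) (hη : 0 < η) :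
    ∀ᵐ p ∂(configMeasure α M j), JumpGap K d η 0 j p.1 p.2 := by
  have hm := measurableSet_jumpGap K d η 0 j
  refine (Measure.ae_prod_iff_ae_ae hm).2 (Eventually.of_forall fun z => ?_)
  filter_upwards [ae_restrict_of_ae (measure_eq_zero_iff_ae_notMem.1
    (volume_not_jumpGap (K := K) hd hη z)), ae_restrict_mem (measurableSet_orderedTimes M j)]
    with u h1 h2
  by_contra hc
  exact h1 ⟨h2.2, hc⟩

lemma measurable_configRun (hM : 0 ≤ M) (hd : d ≤ 0) (hη : 0 ≤ η) :
    Measurable (configRun hM K d η j) :=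
  (measurable_runLength_bufferLevel hd hη).subtype_mk

/-- The explicit solution is available only at ordered non-negative times. These carry
`configMeasure`, so the two push-forwards agree, and measurability is needed for `configRun` only.
-/
lemma limitMeasure_apply (hM : 0 ≤ M) (hK : 0 < K) (hd : d ≤ 0) (hη : 0 ≤ η)
    {C S : Set (Icc (0 : ℝ) M)} (hS : MeasurableSet S) (hC : MeasurableSet C) :
    limitMeasure hM α d K η C j S = configMeasure α M j (configRun hM K d η j ⁻¹' (S ∩ Cᶜ)) := by
  have h : (fun p : (Fin j → ℝ) × (Fin j → ℝ) =>
      intenseLength hM η (reflect K (stepPath M d p.1 p.2))) =ᵐ[configMeasure α M j]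
      configRun hM K d η j := by
    filter_upwards [ae_mem_orderedTimes α M j] with p hp
    exact Subtype.ext (intenseLength_eq_runLength hM fun t =>
      reflect_stepPath hK hd hp.2 (fun i => (hp.1 i).1) t)
  unfold limitMeasure
  rw [← configMeasure, Measure.map_congr h, Measure.restrict_apply hS,
    Measure.map_apply (measurable_configRun hM hd hη) (hS.inter hC.compl)]

/-- Long runs need `j` jumps that are bounded away from zero. -/
lemma lt_of_mem_hitSet (hK : 0 < K) (hd : d < 0) (he : 0 ≤ e) (hηe : e + δ < η) (hηK : η ≤ K)
    {F : Set (Icc (0 : ℝ) M)} (hF : ∀ x ∈ F, r ≤ (x : ℝ)) (hδ : 0 ≤ δ)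
    (hr : ((j : ℝ) - 1) * (K - η + e + δ) / (-d) + e < r) {z u : Fin j → ℝ} (hu : StrictMono u)
    (hz : ∀ k, 0 ≤ z k) (h : (z, u) ∈ hitSet M K d η j F e) (k : Fin j) : δ < z k := by
  by_contra! hk
  obtain ⟨x, hx, -, h2⟩ := h
  -- If the jump `k` were at most `δ`, setting it to zero would lower the content by at most `δ` and
  -- leave at most `j - 1` non-zero jumps, which cannot produce a run of the required length.
  have h1 : ∑ i, |z i - Function.update z k 0 i| ≤ δ := by
    rw [Finset.sum_eq_single k (fun i _ hi => by simp [hi]) (by simp)]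
    simpa [abs_of_nonneg (hz k)] using hk
  have h3 := runLength_bufferLevel_le_of_dist (M := M) (K := K) (d := d) (η := η - e) (u := u) h1
  have h4 := runLength_bufferLevel_le (M := M) (η := η - e - δ) (z := Function.update z k 0) hK hd
    (by linarith) (by linarith) hu
  have h5 : jumpCount (Function.update z k 0) ≤ (j : ℝ) - 1 := by
    unfold jumpCount
    rw [← Finset.add_sum_erase _ _ (Finset.mem_univ k)]
    simp only [Function.update_self, if_true, zero_add]
    refine (Finset.sum_le_card_nsmul _ _ 1 fun i _ => ?_).trans (le_of_eq ?_)
    · split_ifs <;> norm_num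
    · rw [Finset.card_erase_of_mem (Finset.mem_univ k), Finset.card_univ, Fintype.card_fin]
      have : 1 ≤ j := by have := k.2; omega
      simp [Nat.cast_sub this]
  have h6 : jumpCount (Function.update z k 0) * (K - (η - e - δ)) / (-d) ≤
      ((j : ℝ) - 1) * (K - η + e + δ) / (-d) := by
    rw [show K - (η - e - δ) = K - η + e + δ by ring]
    have h7 : 0 ≤ K - η + e + δ := by linarith
    have h8 : 0 ≤ -d := by linarith
    gcongr
  linarith [hF x hx]

/-- The mass of `nuMeasure α` is infinite only near zero, and all `j` jumps of a configuration in
the hit set exceed `δ`. -/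
lemma configMeasure_hitSet_lt_top (hα : 0 < α) (hK : 0 < K) (hd : d < 0) (he : 0 ≤ e)
    (hηe : e + δ < η) (hηK : η ≤ K) {F : Set (Icc (0 : ℝ) M)} (hF : ∀ x ∈ F, r ≤ (x : ℝ))
    (hδ : 0 < δ) (hr : ((j : ℝ) - 1) * (K - η + e + δ) / (-d) + e < r) :
    configMeasure α M j (hitSet M K d η j F e) < ∞ := by
  calc configMeasure α M j (hitSet M K d η j F e)
      ≤ configMeasure α M j ((univ.pi fun _ => Ioi δ) ×ˢ univ) := by
        refine measure_mono_ae ?_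
        filter_upwards [ae_mem_orderedTimes α M j, ae_pos_configMeasure α M j] with p h1 h2 h3
        exact ⟨fun k _ => lt_of_mem_hitSet hK hd he hηe hηK hF hδ.le hr h1.2 (fun k => (h2 k).le)
          h3 k, mem_univ _⟩
    _ < ∞ := by
        rw [configMeasure, Measure.prod_prod, Measure.pi_pi, Measure.restrict_apply_univ]
        simp only [nuMeasure_Ioi hα hδ]
        exact ENNReal.mul_lt_top (ENNReal.prod_lt_top fun _ _ => ENNReal.ofReal_lt_top)
          volume_orderedTimes_lt_top

lemma preimage_subset_hitSet (hM : 0 ≤ M) (F : Set (Icc (0 : ℝ) M)) :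
    configRun hM K d η j ⁻¹' F ⊆ hitSet M K d η j F 0 := fun p hp =>
  ⟨_, hp, by simp [configRun], by simp [configRun]⟩

/-- As the tolerance vanishes, the measure of the hit sets tends to that of the configurations
whose longest run lies in the closed set. -/
lemma le_configMeasure_of_forall_le (hM : 0 ≤ M) (hd : d < 0) (hη : 0 < η)
    {F : Set (Icc (0 : ℝ) M)} (hF : IsClosed F) {e₀ : ℝ} (he₀ : 0 < e₀) (he₀η : e₀ ≤ η)
    (hfin : configMeasure α M j (hitSet M K d η j F e₀) < ∞) {B : ℝ≥0∞}
    (hB : ∀ e, 0 < e → e ≤ e₀ → B ≤ configMeasure α M j (hitSet M K d η j F e)) :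
    B ≤ configMeasure α M j (configRun hM K d η j ⁻¹' F) := by
  set es : ℕ → ℝ := fun k => e₀ * (1 / ((k : ℝ) + 1)) with hes
  have hpos : ∀ k, 0 < es k := fun k => by positivity
  have hle : ∀ k, es k ≤ e₀ := fun k => by
    refine mul_le_of_le_one_right he₀.le ?_
    rw [div_le_one (by positivity)]
    linarith [Nat.cast_nonneg (α := ℝ) k]
  have hlim : Tendsto es atTop (𝓝 0) := by
    simpa [hes] using tendsto_one_div_add_atTop_nhds_zero_nat.const_mul e₀
  have hanti : Antitone es := fun k k' hk => by
    simp only [hes]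
    gcongr
  have ht := tendsto_measure_iInter_atTop (μ := configMeasure α M j)
    (s := fun k => hitSet M K d η j F (es k))
    (fun k => (measurableSet_hitSet hd.le (by rw [abs_of_pos (hpos k)]; exact (hle k).trans he₀η)
      hF).nullMeasurableSet) (fun k k' hk => hitSet_mono (hanti hk))
    ⟨0, ((measure_mono (hitSet_mono (hle 0))).trans_lt hfin).ne⟩
  refine (ge_of_tendsto' ht fun k => hB _ (hpos k) (hle k)).trans (measure_mono_ae ?_)
  filter_upwards [ae_mem_orderedTimes α M j, ae_jumpGap_configMeasure (α := α) (M := M) (K := K)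
    (j := j) hd hη] with p h1 h2 h3
  exact mem_of_forall_hitSet hM hd hη hF h1.2 h2 hlim (fun k => (hpos k).le)
    (Eventually.of_forall fun k => mem_iInter.1 h3 k).frequently

/-- Almost every configuration whose run length lies in `G` leaves the hit sets of `Gᶜ` as the
tolerance vanishes, and each of its finitely many positive jumps eventually exceeds `δ`. -/
lemma configMeasure_le_of_forall_le (hM : 0 ≤ M) (hd : d < 0) (hη : 0 < η)
    {G : Set (Icc (0 : ℝ) M)} (hG : IsOpen G) {B : ℝ≥0∞}
    (hB : ∀ e, 0 < e → 3 * e ≤ η → ∃ δ, 0 < δ ∧ δ ≤ e ∧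
      ((Measure.pi fun _ : Fin j => (nuMeasure α).restrict (Ioi δ)).prod
        (volume.restrict (orderedTimes M j))) (hitSet M K d η j Gᶜ (3 * e))ᶜ ≤ B) :
    configMeasure α M j (configRun hM K d η j ⁻¹' G) ≤ B := by
  set es : ℕ → ℝ := fun k => η / 3 * (1 / ((k : ℝ) + 1)) with hes
  have hpos : ∀ k, 0 < es k := fun k => by positivity
  have hle : ∀ k, 3 * es k ≤ η := fun k => by
    have : 1 / ((k : ℝ) + 1) ≤ 1 := by
      rw [div_le_one (by positivity)]
      linarith [Nat.cast_nonneg (α := ℝ) k]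
    simp only [hes]
    nlinarith
  have hlim : Tendsto es atTop (𝓝 0) := by
    simpa [hes] using tendsto_one_div_add_atTop_nhds_zero_nat.const_mul (η / 3)
  choose δ hδ0 hδe hδ using fun k => hB (es k) (hpos k) (hle k)
  refine measure_le_of_eventually_mem (T := fun k => (hitSet M K d η j Gᶜ (3 * es k))ᶜ ∩
    ((univ.pi fun _ => Ioi (δ k)) ×ˢ univ)) ?_ fun k => le_trans (le_of_eq ?_) (hδ k)
  · filter_upwards [ae_mem_orderedTimes α M j, ae_pos_configMeasure α M j,
      ae_jumpGap_configMeasure (α := α) (M := M) (K := K) (j := j) hd hη] with p h1 h2 h3 h4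
    have e1 : ∀ᶠ k in atTop, p ∉ hitSet M K d η j Gᶜ (3 * es k) := by
      by_contra hc
      refine mem_of_forall_hitSet hM hd hη hG.isClosed_compl h1.2 h3 (es := fun k => 3 * es k)
        (by simpa using hlim.const_mul 3) (fun k => by linarith [hpos k]) ?_ h4
      simpa only [not_eventually, not_not] using hc
    have e2 : ∀ᶠ k in atTop, ∀ i, δ k < p.1 i := by
      refine eventually_all.2 fun i => ?_
      filter_upwards [hlim.eventually_lt_const (h2 i)] with k hk using (hδe k).trans_lt hk
    filter_upwards [e1, e2] with k hk1 hk2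
    exact ⟨hk1, fun i _ => hk2 i, mem_univ _⟩
  · have hm : MeasurableSet ((univ.pi fun _ : Fin j => Ioi (δ k)) ×ˢ
        (univ : Set (Fin j → ℝ))) :=
      (MeasurableSet.univ_pi fun _ => measurableSet_Ioi).prod MeasurableSet.univ
    rw [← Measure.restrict_apply' hm, configMeasure, ← Measure.prod_restrict,
      Measure.restrict_univ, Measure.restrict_pi_pi]

/-! #### Mass, finiteness and support of the limit measure -/

lemma isClosed_initialSegment (M r : ℝ) : IsClosed (initialSegment M r) :=
  isClosed_le continuous_subtype_val continuous_const

lemma measurableSet_initialSegment (M r : ℝ) : MeasurableSet (initialSegment M r) :=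
  (isClosed_initialSegment M r).measurableSet

/-- Of the two summands `e` in the numerator, one is for the tolerance in the level and the other
for the threshold on jump sizes. -/
lemma exists_margin (hη : 0 < η) (hr : ((j : ℝ) - 1) * ((K - η) / (-d)) < r) :
    ∃ e₀ > 0, ∀ e, 0 ≤ e → e ≤ e₀ → 2 * e < η ∧
      ((j : ℝ) - 1) * (K - η + e + e) / (-d) + e < r := by
  have h1 : Tendsto (fun e : ℝ => ((j : ℝ) - 1) * (K - η + e + e) / (-d) + e) (𝓝 0)
      (𝓝 (((j : ℝ) - 1) * (K - η + 0 + 0) / (-d) + 0)) :=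
    Continuous.tendsto (by fun_prop) 0
  have h2 : Tendsto (fun e : ℝ => 2 * e) (𝓝 0) (𝓝 (2 * 0)) := Continuous.tendsto (by fun_prop) 0
  obtain ⟨ε, hε, H⟩ := Metric.eventually_nhds_iff.1
    ((h2.eventually_lt_const (by simpa using hη)).and
    (h1.eventually_lt_const (by simpa [mul_div_assoc] using hr)))
  refine ⟨ε / 2, by linarith, fun e he he' => H ?_⟩
  rw [Real.dist_eq, sub_zero, abs_of_nonneg he]
  linarith

lemma exists_le_of_boundedAway {s : ℝ} (hs : 0 ≤ s) (hsM : s ≤ M) {A : Set (Icc (0 : ℝ) M)}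
    (hA : BoundedAway (initialSegment M s) A) : ∃ r, s < r ∧ ∀ x ∈ A, r ≤ (x : ℝ) := by
  obtain ⟨ε, hε, H⟩ := hA
  refine ⟨s + ε, by linarith, fun x hx => ?_⟩
  rcases le_or_gt (x : ℝ) s with h | h
  · linarith [H x h x hx, dist_self x]
  · have := H ⟨s, hs, hsM⟩ (show s ≤ s from le_rfl) x hx
    rw [Subtype.dist_eq, Real.dist_eq, abs_of_neg (sub_neg.2 h)] at this
    linarith

lemma isMMeasure_limitMeasure (hM : 0 ≤ M) (hα : 0 < α) (hK : 0 < K) (hd : d < 0) (hη : 0 < η)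
    (hηK : η ≤ K) (hj : 0 ≤ ((j : ℝ) - 1) * ((K - η) / (-d)))
    (hjM : ((j : ℝ) - 1) * ((K - η) / (-d)) ≤ M) :
    IsMMeasure (initialSegment M (((j : ℝ) - 1) * ((K - η) / (-d))))
      (limitMeasure hM α d K η (initialSegment M (((j : ℝ) - 1) * ((K - η) / (-d)))) j) := by
  refine ⟨?_, fun A hA hAC => ?_⟩
  · rw [limitMeasure_apply hM hK hd.le hη.le (measurableSet_initialSegment _ _)
      (measurableSet_initialSegment _ _), inter_compl_self, preimage_empty, measure_empty]
  · obtain ⟨r, hr, hAr⟩ := exists_le_of_boundedAway hj hjM hAC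
    obtain ⟨e, he, H⟩ := exists_margin (η := η) hη hr
    rw [limitMeasure_apply hM hK hd.le hη.le hA (measurableSet_initialSegment _ _)]
    obtain ⟨h1, h2⟩ := H e he.le le_rfl
    exact (measure_mono ((preimage_mono inter_subset_left).trans
      ((preimage_subset_hitSet hM A).trans (hitSet_mono he.le)))).trans_lt
      (configMeasure_hitSet_lt_top hα hK hd he.le (by linarith) hηK hAr he h2)

/-- Jumps exceeding `K`, spaced slightly closer than the descent time `b`, give runs longer than `(j
- 1) * b`. They fill a product set of positive measure. -/
lemma limitMeasure_ne_zero (hM : 0 ≤ M) (hα : 0 < α) (hK : 0 < K) (hd : d < 0) (hη : 0 ≤ η)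
    (hηK : η < K) (hj : 1 ≤ j) (hjM : j * ((K - η) / (-d)) ≤ M) :
    limitMeasure hM α d K η (initialSegment M (((j : ℝ) - 1) * ((K - η) / (-d)))) j ≠ 0 := by
  obtain ⟨n, rfl⟩ := Nat.exists_eq_add_of_le' hj
  set b := (K - η) / (-d) with hb
  have hb0 : 0 < b := div_pos (by linarith) (by linarith)
  have hKb : K + d * b = η := by
    rw [hb]
    have : d ≠ 0 := hd.ne
    field_simp
    ring
  set δ := b / (4 * (n + 1)) with hδ
  have hδ0 : 0 < δ := by positivity
  have hδb : 4 * (n + 1) * δ ≤ b := le_of_eq (by rw [hδ]; field_simp)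
  set Z : Set (Fin (n + 1) → ℝ) := univ.pi fun _ => Ioi K
  set U : Set (Fin (n + 1) → ℝ) :=
    univ.pi fun i => Ioo ((i : ℝ) * (b - 2 * δ)) ((i : ℝ) * (b - 2 * δ) + δ)
  have hUm : MeasurableSet U := MeasurableSet.univ_pi fun _ => measurableSet_Ioo
  have key : ∀ z ∈ Z, ∀ u ∈ U, (∀ i, u i ∈ Icc 0 M) ∧ StrictMono u ∧
      n * b < runLength M η (bufferLevel K d (n + 1) z u) := fun z hz u hu =>
    lt_runLength_of_large_jumps hK hd hKb hδ0 hδb (by exact_mod_cast hjM)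
      (fun i => hz i (mem_univ i)) fun i => hu i (mem_univ i)
  have hUsub : U ⊆ orderedTimes M (n + 1) := fun u hu => by
    have h := key (fun _ => K + 1) (fun i _ => by simp) u hu
    exact ⟨h.1, h.2.1⟩
  have hpos : 0 < configMeasure α M (n + 1) (Z ×ˢ U) := by
    rw [configMeasure, Measure.prod_prod, Measure.pi_pi, Measure.restrict_apply hUm,
      inter_eq_left.2 hUsub, volume_pi_pi]
    simp only [nuMeasure_Ioi hα hK, Real.volume_Ioo, add_sub_cancel_left]
    refine ENNReal.mul_pos (Finset.prod_ne_zero_iff.2 fun _ _ => ?_)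
      (Finset.prod_ne_zero_iff.2 fun _ _ => ?_)
    · exact (ENNReal.ofReal_pos.2 (Real.rpow_pos_of_pos hK _)).ne'
    · exact (ENNReal.ofReal_pos.2 hδ0).ne'
  intro h0
  have h1 := limitMeasure_apply (α := α) (j := n + 1) hM hK hd.le hη MeasurableSet.univ
    (measurableSet_initialSegment M (((n + 1 : ℕ) - 1 : ℝ) * b))
  rw [h0, Measure.coe_zero, Pi.zero_apply, univ_inter] at h1
  refine hpos.not_ge (h1 ▸ measure_mono ?_)
  rintro ⟨z, u⟩ ⟨hz, hu⟩
  have := (key z hz u hu).2.2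
  simp only [mem_preimage, mem_compl_iff, initialSegment, mem_ofPred_eq, not_le, configRun]
  push_cast
  linarith

lemma limitMeasure_concentrated (hM : 0 ≤ M) (hK : 0 < K) (hd : d < 0) (hη : 0 < η)
    (hηK : η ≤ K) :
    limitMeasure hM α d K η (initialSegment M (((j : ℝ) - 1) * ((K - η) / (-d)))) j
      {y | ¬ ((y : ℝ) ∈ Ioc (((j : ℝ) - 1) * ((K - η) / (-d))) (j * ((K - η) / (-d))))} = 0 := by
  rw [limitMeasure_apply hM hK hd.le hη.le ?_ (measurableSet_initialSegment _ _)]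
  · rw [measure_eq_zero_iff_ae_notMem]
    filter_upwards [ae_mem_orderedTimes α M j] with p hp h
    refine h.1 ⟨not_le.1 h.2, ?_⟩
    rw [← mul_div_assoc]
    exact runLength_bufferLevel_le_card hK hd hη hηK hp.2
  · exact (measurable_subtype_coe measurableSet_Ioc).compl

end configMeasure

end

noncomputable section

/-! ### The error terms -/

/-- The rate splits into the volume of a lattice cell and the normalization of the `j` jump laws. -/
lemma ofReal_rate {ρ : Measure ℝ} (hρ : ∀ t, 0 < ρ.real (Ioi t)) {n : ℕ} (hn : 1 ≤ n) (j : ℕ) :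
    ENNReal.ofReal (((n * ρ.real (Ioi (n : ℝ))) ^ j)⁻¹) =
      ((n : ℝ≥0∞) ^ j)⁻¹ * (ENNReal.ofReal (ρ.real (Ioi (n : ℝ))))⁻¹ ^ j := by
  have hn0 : (0 : ℝ) < n := by exact_mod_cast hn
  have h := hρ n
  rw [ENNReal.ofReal_inv_of_pos (by positivity), ENNReal.ofReal_pow (by positivity),
    ENNReal.ofReal_mul hn0.le, ENNReal.ofReal_natCast, mul_pow, ← ENNReal.inv_pow, ENNReal.mul_inv]
  · exact Or.inl (pow_ne_zero _ (by exact_mod_cast hn0.ne'))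
  · exact Or.inl (by finiteness)

section errors

variable {ρ : Measure ℝ} [IsProbabilityMeasure ρ] {α : ℝ}

/-- The exponent `q` is fixed before `δ`, because the truncation level depends on it. With an
integer `β > α` the tail is at least of order `n ^ (-β)`, so `q = β * j + 1` makes the deviation
term of order `1 / n`. The term for one additional large jump is of order `n P(A > n)`, which
vanishes since `α > 1`. -/
lemma exists_tendsto_rate_mul_error (hα : 1 < α)
    (hRV : RegularlyVarying (-α) fun t => ρ.real (Ioi t)) (M : ℝ) (j : ℕ) :
    ∃ q : ℕ, ∀ δ > 0, ∀ pb : ℕ → ℝ, (∀ n, 0 ≤ pb n) → (∀ᶠ n : ℕ in atTop, pb n ≤ ((n : ℝ) ^ q)⁻¹) →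
      Tendsto (fun n : ℕ => ((n * ρ.real (Ioi (n : ℝ))) ^ j)⁻¹ *
        ((n * M) ^ j * (pb n + n * M * ρ.real (Ioi (n * δ)) ^ (j + 1)))) atTop (𝓝 0) := by
  obtain ⟨β, hβ⟩ := exists_nat_gt α
  obtain ⟨C, a, hC, ha, hlow⟩ := hRV.exists_rpow_le tail_antitone (fun _ => measureReal_nonneg)
    (by linarith) hβ
  have hpos := tail_pos hRV
  refine ⟨β * j + 1, fun δ hδ pb hpb0 hpb => ?_⟩
  set f : ℝ → ℝ := fun t => ρ.real (Ioi t) with hf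
  have h1 : Tendsto (fun n : ℕ => M ^ j * (pb n / f n ^ j)) atTop (𝓝 0) := by
    have h2 : Tendsto (fun n : ℕ => (C ^ j)⁻¹ * (1 / (n : ℝ))) atTop (𝓝 0) := by
      simpa using tendsto_one_div_atTop_nhds_zero_nat.const_mul (C ^ j)⁻¹
    have h3 : Tendsto (fun n : ℕ => pb n / f n ^ j) atTop (𝓝 0) := by
      refine squeeze_zero' (Eventually.of_forall fun n => div_nonneg (hpb0 n)
        (pow_nonneg (hpos _).le _)) ?_ h2
      filter_upwards [hpb, eventually_ge_atTop 1, eventually_ge_atTop ⌈a⌉₊] with n hn hn1 hna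
      have hn0 : (0 : ℝ) < n := by exact_mod_cast hn1
      have h4 := hlow n (Nat.ceil_le.1 hna)
      rw [Real.rpow_neg hn0.le, Real.rpow_natCast] at h4
      have h5 : (C * ((n : ℝ) ^ β)⁻¹) ^ j ≤ f n ^ j := by gcongr
      calc pb n / f n ^ j ≤ ((n : ℝ) ^ (β * j + 1))⁻¹ / (C * ((n : ℝ) ^ β)⁻¹) ^ j := by
            gcongr
        _ = (C ^ j)⁻¹ * (1 / (n : ℝ)) := by
            rw [mul_pow, inv_pow, ← pow_mul, pow_succ]
            field_simp
    simpa using h3.const_mul (M ^ j)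
  have hr : Tendsto (fun n : ℕ => f (n * δ) / f n) atTop (𝓝 (δ ^ (-α))) := tendsto_tail_ratio hRV hδ
  have h6 : Tendsto (fun n : ℕ => (n : ℝ) * f n) atTop (𝓝 0) :=
    hRV.tendsto_mul_self tail_antitone (fun _ => measureReal_nonneg) hα
  have h7 := ((hr.pow (j + 1)).mul h6).const_mul (M ^ (j + 1))
  have h8 := h1.add h7
  simp only [mul_zero, add_zero] at h8
  refine h8.congr' ?_
  filter_upwards [eventually_ge_atTop 1] with n hn
  have hn0 : (0 : ℝ) < n := by exact_mod_cast hn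
  have h9 : f n ≠ 0 := (hpos _).ne'
  change _ = ((n * f n) ^ j)⁻¹ * ((n * M) ^ j * (pb n + n * M * f (n * δ) ^ (j + 1)))
  rw [mul_pow, mul_pow, div_pow]
  field_simp
  ring

end errors

/-! ### Large deviation bounds -/

section bounds

variable {Ω : Type*} [MeasurableSpace Ω] {P : Measure Ω} [IsProbabilityMeasure P] {A : ℕ → Ω → ℝ}
  {M K c m η α p : ℝ} {j : ℕ} {L : ℕ → Ω → Icc (0 : ℝ) M}

/-- The deviations of the truncated sums and the additional large jumps are negligible. -/
lemma exists_tendsto_error (hA : ∀ i, Measurable (A i)) (hA0 : ∀ i ω, 0 ≤ A i ω)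
    (hind : iIndepFun A P) (hident : ∀ i, IdentDistrib (A i) (A 0) P P) (hp : 1 < p) (hp2 : p ≤ 2)
    (hint : Integrable (fun ω => A 0 ω ^ p) P) (hα : 1 < α)
    (hRV : RegularlyVarying (-α) fun t => (P.map (A 0)).real (Ioi t))
    (hm : m = ∫ ω, A 0 ω ∂P) (hM : 0 < M) {ε : ℝ} (hε : 0 < ε) (j : ℕ) :
    ∃ δ, 0 < δ ∧ δ ≤ ε ∧ Tendsto (fun n : ℕ =>
      ENNReal.ofReal (((n * (P.map (A 0)).real (Ioi (n : ℝ))) ^ j)⁻¹) *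
        ((⌊n * M⌋₊ : ℝ≥0∞) ^ j * (P (deviationEvent A M m δ ε n) +
          (⌊n * M⌋₊ : ℝ≥0∞) * P.map (A 0) (Ioi (n * δ)) ^ (j + 1)))) atTop (𝓝 0) := by
  have hρ : IsProbabilityMeasure (P.map (A 0)) :=
    Measure.isProbabilityMeasure_map (hA 0).aemeasurable
  obtain ⟨q, hq⟩ := exists_tendsto_rate_mul_error hα hRV M j
  obtain ⟨δ₀, hδ₀, H⟩ := exists_truncation_level hA hA0 hind hident hp hp2 hint hM hε q
  subst hm
  set m := ∫ ω, A 0 ω ∂P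
  set δ := min δ₀ ε with hδ
  have hδ0 : 0 < δ := lt_min hδ₀ hε
  refine ⟨δ, hδ0, min_le_right _ _, ?_⟩
  have h1 := hq δ hδ0 (fun n => P.real (deviationEvent A M m δ ε n))
    (fun n => measureReal_nonneg) (H δ hδ0 (min_le_left _ _))
  have h2 := ENNReal.tendsto_ofReal h1
  rw [ENNReal.ofReal_zero] at h2
  refine tendsto_of_tendsto_of_tendsto_of_le_of_le tendsto_const_nhds h2 (fun _ => bot_le)
    fun n => ?_
  have hN : (⌊n * M⌋₊ : ℝ≥0∞) ≤ ENNReal.ofReal (n * M) := by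
    rw [← ENNReal.ofReal_natCast]
    exact ENNReal.ofReal_le_ofReal (Nat.floor_le (by positivity))
  simp only
  rw [ENNReal.ofReal_mul (by positivity), ENNReal.ofReal_mul (by positivity),
    ENNReal.ofReal_pow (by positivity), ENNReal.ofReal_add (by positivity) (by positivity),
    ENNReal.ofReal_mul (show (0 : ℝ) ≤ n * M by positivity), ENNReal.ofReal_pow measureReal_nonneg,
    ofReal_measureReal, ofReal_measureReal]
  gcongr

lemma rate_mul_sum {ρ : Measure ℝ} (hρ : ∀ t, 0 < ρ.real (Ioi t)) {n : ℕ} (hn : 1 ≤ n) (j N : ℕ)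
    (φ : (Fin j → Fin N) → ℝ≥0∞) :
    ENNReal.ofReal (((n * ρ.real (Ioi (n : ℝ))) ^ j)⁻¹) * ∑ g ∈ strictMonoMaps j N, φ g =
      ((n : ℝ≥0∞) ^ j)⁻¹ * ∑ g ∈ strictMonoMaps j N,
        (ENNReal.ofReal (ρ.real (Ioi (n : ℝ))))⁻¹ ^ j * φ g := by
  rw [ofReal_rate hρ hn, mul_assoc, Finset.mul_sum]

/-- For each small `e` the queue is compared with hit sets of tolerance `e / 3`, and the passage to
the limit enlarges this to `e`. Letting `e` vanish needs continuity from above, hence the finiteness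
coming from the distance `r`. -/
lemma limsup_rate_mul_measure_le (hA : ∀ i, Measurable (A i)) (hA0 : ∀ i ω, 0 ≤ A i ω)
    (hind : iIndepFun A P) (hident : ∀ i, IdentDistrib (A i) (A 0) P P) (hp : 1 < p) (hp2 : p ≤ 2)
    (hint : Integrable (fun ω => A 0 ω ^ p) P) (hα : 1 < α)
    (hRV : RegularlyVarying (-α) fun t => (P.map (A 0)).real (Ioi t))
    (hm : m = ∫ ω, A 0 ω ∂P) (hmc : m < c) (hM : 0 < M) (hK : 0 < K) (hη : 0 < η) (hηK : η ≤ K)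
    (hj : 1 ≤ j)
    (hL : ∀ n, 1 ≤ n → ∀ ω, (L n ω : ℝ) = queueRun M K c η n fun i => A i ω)
    {F : Set (Icc (0 : ℝ) M)} (hF : IsClosed F) {r : ℝ} (hFr : ∀ x ∈ F, r ≤ (x : ℝ))
    (hr : ((j : ℝ) - 1) * ((K - η) / (c - m)) < r) :
    limsup (fun n : ℕ => ENNReal.ofReal (((n * (P.map (A 0)).real (Ioi (n : ℝ))) ^ j)⁻¹) *
      P {ω | L n ω ∈ F}) atTop ≤ configMeasure α M j (configRun hM.le K (m - c) η j ⁻¹' F) := by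
  have hρ : IsProbabilityMeasure (P.map (A 0)) :=
    Measure.isProbabilityMeasure_map (hA 0).aemeasurable
  have hd : m - c < 0 := by linarith
  rw [← neg_sub m c] at hr
  obtain ⟨e₀, he₀, H⟩ := exists_margin hη hr
  refine le_configMeasure_of_forall_le hM.le hd hη hF he₀
    (by linarith [(H e₀ he₀.le le_rfl).1]) ?_ fun e he hee => ?_
  · exact configMeasure_hitSet_lt_top (δ := e₀) (by linarith) hK hd he₀.le
      (by linarith [(H e₀ he₀.le le_rfl).1]) hηK hFr he₀ (H e₀ he₀.le le_rfl).2
  obtain ⟨h1, h2⟩ := H (e / 3) (by linarith) (by linarith)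
  have h3 := (H e he.le hee).1
  obtain ⟨δ, hδ, -, herr⟩ := exists_tendsto_error hA hA0 hind hident hp hp2 hint hα hRV hm hM
    (show 0 < e / 3 / 4 by linarith) j
  have hlim := limsup_lattice_hitSet_le (M := M) (K := K) (d := m - c) (η := η) (e := e / 3)
    (j := j) (F := F) (by linarith : 0 < α) hRV hδ hM.le hd.le (by linarith) (by linarith) hF
  rw [show 3 * (e / 3) = e by ring, ← configMeasure] at hlim
  refine le_trans (limsup_le_limsup ?_)
    ((ENNReal.limsup_add_of_left_tendsto_zero herr _).le.trans hlim)
  have hcn : ∀ᶠ n : ℕ in atTop, (c - m) / n < e / 3 / 4 :=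
    (tendsto_const_div_atTop_nhds_zero_nat _).eventually_lt_const (by linarith)
  have hN : ∀ᶠ n : ℕ in atTop, 1 ≤ n * M :=
    (tendsto_natCast_atTop_atTop.atTop_mul_const hM).eventually_ge_atTop 1
  filter_upwards [hcn, hN, eventually_ge_atTop 1] with n hn1 hn2 hn
  rw [Pi.add_apply, ← rate_mul_sum (tail_pos hRV) hn, ← mul_add]
  gcongr
  -- With at least one arrival in the window, the deviation probability is bounded by its multiple
  -- with the factor `⌊n * M⌋₊ ^ j`, so upper and lower bound share one error term.
  have hfl : (1 : ℝ≥0∞) ≤ ⌊n * M⌋₊ := by exact_mod_cast Nat.le_floor (by simpa using hn2)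
  refine (measure_queueRun_mem_le (j := j) (δ := δ) (e := e / 3) hA hind
    (fun i => (hident i).map_eq) hn hK hmc (by linarith) hn1.le
      (by linarith) (by linarith) hηK hF hFr ?_ (hL n hn)).trans ?_
  · rw [neg_sub] at h2
    have h4 : ((j : ℝ) - 1) * (K - η + e / 3) / (c - m) ≤
        ((j : ℝ) - 1) * (K - η + e / 3 + e / 3) / (c - m) + e / 3 := by
      have h5 : 0 ≤ (j : ℝ) - 1 := sub_nonneg.2 (by exact_mod_cast hj)
      have h6 : 0 ≤ c - m := by linarith
      refine le_add_of_le_of_nonneg ?_ (by linarith)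
      gcongr
      linarith
    linarith
  · gcongr
    rw [mul_add, ← mul_assoc, ← pow_succ]
    gcongr
    exact le_mul_of_one_le_left bot_le (one_le_pow₀ hfl)

lemma le_liminf_rate_mul_measure (hA : ∀ i, Measurable (A i)) (hA0 : ∀ i ω, 0 ≤ A i ω)
    (hind : iIndepFun A P) (hident : ∀ i, IdentDistrib (A i) (A 0) P P) (hp : 1 < p) (hp2 : p ≤ 2)
    (hint : Integrable (fun ω => A 0 ω ^ p) P) (hα : 1 < α)
    (hRV : RegularlyVarying (-α) fun t => (P.map (A 0)).real (Ioi t))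
    (hm : m = ∫ ω, A 0 ω ∂P) (hmc : m < c) (hM : 0 < M) (hK : 0 < K) (hη : 0 < η)
    (hL : ∀ n, 1 ≤ n → ∀ ω, (L n ω : ℝ) = queueRun M K c η n fun i => A i ω)
    {G : Set (Icc (0 : ℝ) M)} (hG : IsOpen G) :
    configMeasure α M j (configRun hM.le K (m - c) η j ⁻¹' G) ≤
      liminf (fun n : ℕ => ENNReal.ofReal (((n * (P.map (A 0)).real (Ioi (n : ℝ))) ^ j)⁻¹) *
        P {ω | L n ω ∈ G}) atTop := by
  have hρ : IsProbabilityMeasure (P.map (A 0)) :=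
    Measure.isProbabilityMeasure_map (hA 0).aemeasurable
  have hd : m - c < 0 := by linarith
  refine configMeasure_le_of_forall_le hM.le hd hη hG fun e he hee => ?_
  obtain ⟨δ, hδ, hδe, herr⟩ := exists_tendsto_error hA hA0 hind hident hp hp2 hint hα hRV hm hM
    (show 0 < e / 4 by linarith) j
  refine ⟨δ, hδ, by linarith, (le_liminf_lattice_hitSet (by linarith) hRV hδ hM.le hd.le he hee
    hG.isClosed_compl).trans ?_⟩
  rw [← ENNReal.liminf_add_of_right_tendsto_zero herr fun n : ℕ => ENNReal.ofReal
    (((n * (P.map (A 0)).real (Ioi (n : ℝ))) ^ j)⁻¹) * P {ω | L n ω ∈ G}]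
  refine liminf_le_liminf ?_
  have hcn : ∀ᶠ n : ℕ in atTop, (c - m) / n < e / 4 :=
    (tendsto_const_div_atTop_nhds_zero_nat _).eventually_lt_const (by linarith)
  filter_upwards [hcn, eventually_ge_atTop 1] with n hn1 hn
  rw [Pi.add_apply, ← rate_mul_sum (tail_pos hRV) hn, ← mul_add]
  gcongr
  exact sum_le_measure_queueRun_mem (e := e) hA hind (fun i => (hident i).map_eq) hn hK hmc
    (by linarith) hn1.le (by linarith) (by linarith) hG (hL n hn)

end bounds

end

noncomputable section

/-! ### The large deviation principle -/

section rate

variable {Ω : Type*} [MeasurableSpace Ω] {P : Measure Ω} [IsProbabilityMeasure P] {Y : Ω → ℝ}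
  {α : ℝ}

lemma antitone_measureReal_lt : Antitone fun t => P.real {ω | t < Y ω} := fun _ _ h =>
  measureReal_mono (fun _ h' => h.trans_lt h') (measure_ne_top _ _)

lemma mul_tail_pos (hRV : RegularlyVarying (-α) fun t => P.real {ω | t < Y ω})
    {n : ℕ} (hn : 1 ≤ n) : 0 < n * P.real {ω | (n : ℝ) < Y ω} :=
  mul_pos (by exact_mod_cast hn)
    (hRV.pos antitone_measureReal_lt (fun _ => measureReal_nonneg) n)

lemma tendsto_inv_mul_tail (hα : 1 < α)
    (hRV : RegularlyVarying (-α) fun t => P.real {ω | t < Y ω}) :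
    Tendsto (fun n : ℕ => (n * P.real {ω | (n : ℝ) < Y ω})⁻¹) atTop atTop :=
  (tendsto_nhdsWithin_iff.2 ⟨hRV.tendsto_mul_self antitone_measureReal_lt
    (fun _ => measureReal_nonneg) hα, (eventually_ge_atTop 1).mono fun _ hn =>
    mul_tail_pos hRV hn⟩).inv_tendsto_nhdsGT_zero

lemma tendsto_ldpRate (hα : 1 < α) (hRV : RegularlyVarying (-α) fun t => P.real {ω | t < Y ω})
    {j : ℕ} (hj : 1 ≤ j) : Tendsto (ldpRate P Y j) atTop atTop := by
  have h := (tendsto_pow_atTop (α := ℝ) (n := j) (by omega)).comp (tendsto_inv_mul_tail hα hRV)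
  refine h.congr fun n => ?_
  exact inv_pow _ _

lemma tendsto_ldpRate_div (hα : 1 < α)
    (hRV : RegularlyVarying (-α) fun t => P.real {ω | t < Y ω}) (j : ℕ) :
    Tendsto (fun n => ldpRate P Y (j + 1) n / ldpRate P Y j n) atTop atTop := by
  refine (tendsto_inv_mul_tail hα hRV).congr' ?_
  filter_upwards [eventually_ge_atTop 1] with n hn
  have h := mul_tail_pos hRV hn
  rw [ldpRate, ldpRate]
  set x := n * P.real {ω | (n : ℝ) < Y ω}
  rw [pow_succ]
  field_simp

/-- With `p < β < α`, the Potter bound of order `β` gives a finite moment of order `p`. The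
restriction `p ≤ 2` serves the variance estimate for the truncated variables. -/
lemma exists_integrable_rpow (hα : 1 < α)
    (hRV : RegularlyVarying (-α) fun t => P.real {ω | t < Y ω}) (hY : Measurable Y)
    (hY0 : ∀ ω, 0 ≤ Y ω) :
    ∃ p : ℝ, 1 < p ∧ p ≤ 2 ∧ Integrable (fun ω => Y ω ^ p) P := by
  obtain ⟨p, hp1, hp⟩ := exists_between (lt_min hα one_lt_two)
  obtain ⟨hpα, hp2⟩ := lt_min_iff.1 hp
  obtain ⟨β, hpβ, hβα⟩ := exists_between hpα
  obtain ⟨C, a, -, ha, H⟩ := hRV.exists_le_rpow antitone_measureReal_lt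
    (fun _ => measureReal_nonneg) (by linarith) hβα
  refine ⟨p, hp1, hp2.le, ?_⟩
  refine (lintegral_ofReal_ne_top_iff_integrable (hY.pow_const p).aestronglyMeasurable
    (Eventually.of_forall fun ω => Real.rpow_nonneg (hY0 ω) p)).1 ?_
  exact (lintegral_rpow_lt_top_of_tail hY hY0 (by linarith) hpβ ha H).ne

end rate

section ldp

variable {Ω : Type*} [MeasurableSpace Ω] {P : Measure Ω} {A : ℕ → Ω → ℝ} {M K c m η α : ℝ} {j : ℕ}

lemma IsLDP.congr {S : Type*} [MetricSpace S] [MeasurableSpace S] {X X' : ℕ → Ω → S} {γ : ℕ → ℝ}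
    {μ : Measure S} {C : Set S} (h : IsLDP P X γ μ C) (hX : ∀ n, X n =ᵐ[P] X' n) :
    IsLDP P X' γ μ C where
  isClosed := h.isClosed
  aemeasurable n hn := (h.aemeasurable n hn).congr (hX n)
  rate_pos := h.rate_pos
  rate_tendsto := h.rate_tendsto
  isMMeasure := h.isMMeasure
  ne_zero := h.ne_zero
  tendsto := by
    simp only [← Measure.map_congr (hX _)]
    exact h.tendsto

lemma isLDP_intenseLength [IsProbabilityMeasure P] (hA : ∀ i, Measurable (A i))
    (hA0 : ∀ i ω, 0 ≤ A i ω) (hind : iIndepFun A P) (hident : ∀ i, IdentDistrib (A i) (A 0) P P)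
    (hα : 1 < α) (hRV : RegularlyVarying (-α) fun t => P.real {ω | t < A 0 ω})
    (hm : m = ∫ ω, A 0 ω ∂P) (hmc : m < c) (hM : 0 < M) (hK : 0 < K) (hη : 0 < η) (hηK : η < K)
    (hj : 1 ≤ j) (hjM : j * ((K - η) / (c - m)) ≤ M) :
    IsLDP P (fun n ω => intenseLength hM.le η (scaledQueue M K c n fun i => A i ω))
      (ldpRate P (A 0) j)
      (limitMeasure hM.le α (m - c) K η (initialSegment M (((j : ℝ) - 1) * ((K - η) / (c - m)))) j)
      (initialSegment M (((j : ℝ) - 1) * ((K - η) / (c - m)))) := by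
  obtain ⟨p, hp, hp2, hint⟩ := exists_integrable_rpow hα hRV (hA 0) (hA0 0)
  have htail : ∀ t, (P.map (A 0)).real (Ioi t) = P.real {ω | t < A 0 ω} := fun t =>
    map_measureReal_apply (hA 0) measurableSet_Ioi
  have hRV' : RegularlyVarying (-α) fun t => (P.map (A 0)).real (Ioi t) := by
    simpa only [htail] using hRV
  set s := ((j : ℝ) - 1) * ((K - η) / (c - m)) with hs
  have hκ : 0 < (K - η) / (c - m) := div_pos (by linarith) (by linarith)
  have hs0 : 0 ≤ s := mul_nonneg (sub_nonneg.2 (by exact_mod_cast hj)) hκ.le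
  have hsM : s ≤ M := by rw [hs]; linarith
  have hd : m - c < 0 := by linarith
  have hX : ∀ n, 1 ≤ n → ∀ ω, (intenseLength hM.le η (scaledQueue M K c n fun i => A i ω) : ℝ) =
      queueRun M K c η n fun i => A i ω := fun n hn ω => intenseLength_scaledQueue hn hM.le hK
  have hXm : ∀ n, 1 ≤ n →
      Measurable fun ω => intenseLength hM.le η (scaledQueue M K c n fun i => A i ω) :=
    fun n hn => MeasurableEmbedding.measurable_comp_iff
      (MeasurableEmbedding.subtype_coe measurableSet_Icc) |>.1 (by
        simpa only [Function.comp_def, hX n hn] using measurable_queueRun hA hη.le)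
  have happly : ∀ S : Set (Icc (0 : ℝ) M), MeasurableSet S →
      (fun n => (ENNReal.ofReal (ldpRate P (A 0) j n) • P.map fun ω =>
        intenseLength hM.le η (scaledQueue M K c n fun i => A i ω)) S) =ᶠ[atTop]
      fun n : ℕ => ENNReal.ofReal (((n * (P.map (A 0)).real (Ioi (n : ℝ))) ^ j)⁻¹) *
        P {ω | intenseLength hM.le η (scaledQueue M K c n fun i => A i ω) ∈ S} := fun S hS => by
    filter_upwards [eventually_ge_atTop 1] with n hn
    rw [Measure.smul_apply, Measure.map_apply (hXm n hn) hS, htail, smul_eq_mul]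
    rfl
  have hlim : ∀ S : Set (Icc (0 : ℝ) M), MeasurableSet S →
      limitMeasure hM.le α (m - c) K η (initialSegment M s) j S =
        configMeasure α M j (configRun hM.le K (m - c) η j ⁻¹' (S ∩ (initialSegment M s)ᶜ)) :=
    fun S hS => limitMeasure_apply hM.le hK hd.le hη.le hS (measurableSet_initialSegment _ _)
  refine ⟨isClosed_initialSegment _ _, fun n hn => (hXm n hn).aemeasurable, fun n hn => ?_,
    tendsto_ldpRate hα hRV hj, ?_, ?_, fun F hF hFC => ?_, fun G hG _ => ?_⟩
  · exact inv_pos.2 (pow_pos (mul_tail_pos hRV hn) j)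
  · have := isMMeasure_limitMeasure (α := α) (j := j) (d := m - c) hM.le (by linarith) hK hd hη
      hηK.le (by rwa [neg_sub]) (by rwa [neg_sub])
    rwa [neg_sub] at this
  · have := limitMeasure_ne_zero (α := α) (d := m - c) hM.le (by linarith) hK hd hη.le hηK hj
      (by rwa [neg_sub])
    rwa [neg_sub] at this
  · obtain ⟨r, hr, hFr⟩ := exists_le_of_boundedAway hs0 hsM hFC
    have hFs : F ∩ (initialSegment M s)ᶜ = F := inter_eq_left.2 fun x hx (hxs : (x : ℝ) ≤ s) => by
      linarith [hFr x hx]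
    rw [limsup_congr (happly F hF.measurableSet), hlim F hF.measurableSet, hFs]
    exact limsup_rate_mul_measure_le hA hA0 hind hident hp hp2 hint hα hRV' hm hmc hM hK hη hηK.le
      hj hX hF hFr hr
  · rw [liminf_congr (happly G hG.measurableSet), hlim G hG.measurableSet]
    exact (measure_mono (preimage_mono inter_subset_left)).trans
      (le_liminf_rate_mul_measure hA hA0 hind hident hp hp2 hint hα hRV' hm hmc hM hK hη hX hG)

end ldp

end

/-! ### The theorem, by reduction to measurable and everywhere non-negative arrivals -/

theorem theorem4p4 {Ω : Type*} [MeasurableSpace Ω] (P : Measure Ω) [IsProbabilityMeasure P]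
    (A : ℕ → Ω → ℝ) (α c θ K M m κ : ℝ)
    (hindep : iIndepFun A P) (hident : ∀ i, IdentDistrib (A i) (A 0) P P)
    (hnonneg : ∀ i, ∀ᵐ ω ∂P, 0 ≤ A i ω)
    (hα : 1 < α) (hRV : RegularlyVarying (-α) fun t => P.real {ω | t < A 0 ω})
    (hm : m = ∫ ω, A 0 ω ∂P) (hc : m < c)
    (hθ₀ : 0 < θ) (hθ₁ : θ < 1) (hK : 0 < K) (hM : 0 < M)
    (hκ : κ = (1 - θ) / (c - m) * K) :
    IsLDPSequence P ⌊M / κ⌋₊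
      (fun n ω => intenseLength hM.le (θ * K) (scaledQueue M K c n fun i => A i ω))
      (ldpRate P (A 0))
      (fun j => limitMeasure hM.le α (m - c) K (θ * K) (initialSegment M (((j : ℝ) - 1) * κ)) j)
      (fun j => initialSegment M (((j : ℝ) - 1) * κ)) ∧
    ∀ j : ℕ, 1 ≤ j → j ≤ ⌊M / κ⌋₊ →
      limitMeasure hM.le α (m - c) K (θ * K) (initialSegment M (((j : ℝ) - 1) * κ)) j
        {y | ¬ ((y : ℝ) ∈ Ioc (((j : ℝ) - 1) * κ) (j * κ))} = 0 := by
  have hκ' : κ = (K - θ * K) / (c - m) := by rw [hκ]; ring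
  have hη : 0 < θ * K := mul_pos hθ₀ hK
  have hηK : θ * K < K := mul_lt_of_lt_one_left hK hθ₁
  have hκ0 : 0 < κ := by rw [hκ']; exact div_pos (by linarith) (by linarith)
  refine ⟨⟨fun j _ _ y (hy : (y : ℝ) ≤ _) => hy.trans ?_, fun j _ _ => tendsto_ldpRate_div hα hRV j,
    fun j hj hjJ => ?_⟩, fun j _ _ => ?_⟩
  · push_cast
    nlinarith
  -- Measurable, everywhere non-negative versions. Countably many null sets are discarded, so the
  -- run lengths agree almost surely for each `n`, and independence, tails and mean are unchanged.
  · set A' : ℕ → Ω → ℝ := fun i ω => max 0 ((hident i).aemeasurable_fst.mk (A i) ω)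
    have hAA' : ∀ i, A i =ᵐ[P] A' i := fun i => by
      filter_upwards [(hident i).aemeasurable_fst.ae_eq_mk, hnonneg i] with ω h1 h2
      simp only [A', ← h1, max_eq_right h2]
    have hA' : ∀ i, Measurable (A' i) := fun i =>
      measurable_const.max (hident i).aemeasurable_fst.measurable_mk
    have htail : ∀ t, P.real {ω | t < A 0 ω} = P.real {ω | t < A' 0 ω} := fun t =>
      measureReal_congr (by
        filter_upwards [hAA' 0] with ω h
        change (t < A 0 ω) = (t < A' 0 ω)
        rw [h])
    have hident' : ∀ i, IdentDistrib (A' i) (A' 0) P P := fun i =>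
      ⟨(hA' i).aemeasurable, (hA' 0).aemeasurable, by
        rw [← Measure.map_congr (hAA' i), ← Measure.map_congr (hAA' 0), (hident i).map_eq]⟩
    have hjM : j * ((K - θ * K) / (c - m)) ≤ M := by
      rw [← hκ', ← le_div_iff₀ hκ0]
      exact (Nat.le_floor_iff (by positivity)).1 hjJ
    have h := isLDP_intenseLength hA' (fun i ω => le_max_left _ _) (hindep.congr hAA') hident' hα
      (by simpa only [htail] using hRV) (hm.trans (integral_congr_ae (hAA' 0))) hc hM hK hη hηK hj
      hjM
    rw [← hκ'] at h
    have hrate : ldpRate P (A 0) j = ldpRate P (A' 0) j := by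
      funext n
      simp only [ldpRate, htail]
    rw [hrate]
    refine h.congr fun n => ?_
    filter_upwards [eventually_countable_forall.2 hAA'] with ω hω
    simp only [hω]
  · have h := limitMeasure_concentrated (α := α) (j := j) (d := m - c) hM.le hK (by linarith) hη
      hηK.le
    rwa [neg_sub, ← hκ'] at h
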